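/- Let $a<b$ be real, $R>0$, and write $\mathcal D(U)$, $\mathcal D'(U)$ for the test functions and the complex-valued distributions on an open set $U\subseteq\mathbb R$. For $x_0\in(a,b)$ put $\partial_{x_0}g=((x-x_0)g)'$, and use the following notions for $f\in\mathcal D'(a,b)$ and $\gamma\in\mathbb C$. - $f$ is *distributionally bounded at $x_0$* if there are $n\in\mathbb N$ and a distribution $f_n$ such that, near $x_0$, $f=\partial_{x_0}^n f_n$, and $f_n$ is a continuous bounded function in a pointed neighbourhood $(x_0-\delta,x_0)\cup(x_0,x_0+\delta)$, $\delta>0$. - $f(x_0)=\gamma$ (the *Łojasiewicz point value*) if there is $n\in\mathbb N$ such that, near $x_0$, $f=\partial_{x_0}^n f_n$ with $f_n$ a continuous function satisfying $f_n(x_0)=\gamma$. - $f(x_0+0)=\gamma$ (the *Łojasiewicz lateral limit from the right*) if $$\lim_{\varepsilon\to0^+}\langle f(x_0+\varepsilon x),\phi(x)\rangle=\gamma\int_{-\infty}^{\infty}\phi(x)\,dx\qquad(*)$$ for every $\phi\in\mathcal D(\mathbb R)$ with $\operatorname{supp}\phi\subset(0,\infty)$, where $\langle f(x_0+\varepsilon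 x),\phi(x)\rangle=\varepsilon^{-1}\langle f(x),\phi((x-x_0)/\varepsilon)\rangle$, which is defined for small $\varepsilon>0$. **Theorem.** Let $F$ be analytic in the rectangle $\{x+iy: a<x<b,\ 0<y<R\}$ and suppose that $f(x)=\lim_{y\to0^+}F(x+iy)$ in $\mathcal D'(a,b)$, that is, $\int F(x+iy)\phi(x)\,dx\to\langle f,\phi\rangle$ as $y\to0^+$ for every $\phi\in\mathcal D(a,b)$. Let $x_0\in(a,b)$ be such that $f(x_0+0)=\gamma$, and suppose that $f$ is distributionally bounded at $x_0$. Then $f(x_0)=\gamma$ (and $(*)$ holds for every $\phi\in\mathcal D(\mathbb R)$). Furthermore, $F(z)\to\gamma$ as $z\to x_0$ non-tangentially, that is, for each $M>0$, $F(z)\to\gamma$ as $z\to x_0$ with $\operatorname{Im}z>0$ and $|\operatorname{Re}z-x_0|\le M\operatorname{Im}z$. -/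

import Mathlib

open Set Filter MeasureTheory TopologicalSpace
open scoped Topology Distributions ContDiff

noncomputable section

namespace BoundaryValue

/-- The open interval `(a, b)` as an open subset of `ℝ`. Complex-valued distributions on `(a, b)`
are the elements of `𝓓'(openInterval a b, ℂ)`. -/
def openInterval (a b : ℝ) : Opens ℝ := ⟨Ioo a b, isOpen_Ioo⟩

variable {Ω : Opens ℝ}

/-- The transpose of the operator `∂ₐ g = ((x - a) g)'`. It acts on test functions by
`φ ↦ -(x - a) φ'`, so `⟨∂ₐ g, φ⟩ = ⟨g, transposeD a φ⟩` for every distribution `g`. -/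
def transposeD (a : ℝ) (φ : 𝓓(Ω, ℝ)) : 𝓓(Ω, ℝ) :=
  ⟨fun x => -((x - a) * deriv φ x),
    ((contDiff_id.sub contDiff_const).mul
      (contDiff_infty_iff_deriv.1 φ.contDiff).2).neg,
    (φ.hasCompactSupport.deriv.mul_left (f := fun x => x - a)).comp_left neg_zero,
    by
      refine subset_trans (closure_mono ?_)
        ((tsupport_deriv_subset (f := φ) (𝕜 := ℝ)).trans φ.tsupport_subset)
      intro x hx h0
      exact hx (by simp [h0])⟩

/-- `f = ∂ₐⁿ g` as distributions on the open set `Ω ∩ U`. -/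
def EqIterD (n : ℕ) (a : ℝ) (U : Set ℝ) (f g : 𝓓'(Ω, ℂ)) : Prop :=
  ∀ φ : 𝓓(Ω, ℝ), tsupport φ ⊆ U → f φ = g ((transposeD a)^[n] φ)

/-- The distribution `g` coincides with the function `h` on the open set `Ω ∩ U`. -/
def EqFunOn (U : Set ℝ) (g : 𝓓'(Ω, ℂ)) (h : ℝ → ℂ) : Prop :=
  ∀ φ : 𝓓(Ω, ℝ), tsupport φ ⊆ U → g φ = ∫ x, φ x • h x

/-- `f` is distributionally bounded at `a`: near `a` it is `∂ₐⁿ fₙ` for some `n` and some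
distribution `fₙ` that is a continuous bounded function in the pointed neighbourhood
`(a - δ, a) ∪ (a, a + δ)`. -/
def DistributionallyBoundedAt (f : 𝓓'(Ω, ℂ)) (a : ℝ) : Prop :=
  ∃ (n : ℕ) (fn : 𝓓'(Ω, ℂ)) (δ : ℝ) (h : ℝ → ℂ),
    0 < δ ∧ Ioo (a - δ) (a + δ) ⊆ (Ω : Set ℝ) ∧
    EqIterD n a (Ioo (a - δ) (a + δ)) f fn ∧
    ContinuousOn h (Ioo (a - δ) (a + δ) \ {a}) ∧
    (∃ C : ℝ, ∀ x ∈ Ioo (a - δ) (a + δ) \ {a}, ‖h x‖ ≤ C) ∧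
    EqFunOn (Ioo (a - δ) (a + δ) \ {a}) fn h

/-- The Łojasiewicz point value `f(a) = γ`: near `a`, `f = ∂ₐⁿ fₙ` for some `n` and some
distribution `fₙ` that is, near `a`, a continuous function with value `γ` at `a`. -/
def HasPointValue (f : 𝓓'(Ω, ℂ)) (a : ℝ) (γ : ℂ) : Prop :=
  ∃ (n : ℕ) (δ : ℝ) (h : ℝ → ℂ),
    0 < δ ∧ Ioo (a - δ) (a + δ) ⊆ (Ω : Set ℝ) ∧
    ContinuousOn h (Ioo (a - δ) (a + δ)) ∧ h a = γ ∧
    ∀ φ : 𝓓(Ω, ℝ), tsupport φ ⊆ Ioo (a - δ) (a + δ) →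
      f φ = ∫ x, ((transposeD a)^[n] φ) x • h x

open scoped Classical in
/-- The test function `x ↦ φ ((x - a) / ε)` on `Ω`. If `a ∈ Ω`, its support is a compact subset of
`Ω` for all sufficiently small `ε > 0`; otherwise the value is `0`. -/
def rescale (Ω : Opens ℝ) (a ε : ℝ) (φ : 𝓓((⊤ : Opens ℝ), ℝ)) : 𝓓(Ω, ℝ) :=
  if h : HasCompactSupport (fun x => φ ((x - a) / ε)) ∧
      tsupport (fun x => φ ((x - a) / ε)) ⊆ (Ω : Set ℝ) then
    ⟨fun x => φ ((x - a) / ε),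
      φ.contDiff.comp ((contDiff_id.sub contDiff_const).div_const ε), h.1, h.2⟩
  else 0

/-- The pairing `⟨f(a + ε x), φ(x)⟩ = ε⁻¹ ⟨f(x), φ((x - a) / ε)⟩` for small `ε > 0`. -/
def dilationPairing (f : 𝓓'(Ω, ℂ)) (a ε : ℝ) (φ : 𝓓((⊤ : Opens ℝ), ℝ)) : ℂ :=
  ε⁻¹ • f (rescale Ω a ε φ)

/-- `⟨f(a + ε x), φ(x)⟩ → γ ∫ φ` as `ε → 0⁺`, for all test functions `φ` with support in `S`. -/
def HasDilationLimit (S : Set ℝ) (f : 𝓓'(Ω, ℂ)) (a : ℝ) (γ : ℂ) : Prop :=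
  ∀ φ : 𝓓((⊤ : Opens ℝ), ℝ), tsupport φ ⊆ S →
    Tendsto (fun ε => dilationPairing f a ε φ) (𝓝[>] 0) (𝓝 (γ * ((∫ x, φ x : ℝ) : ℂ)))

/-- The distributional lateral limit from the right, `f(a + 0) = γ`. -/
def HasRightLimit (f : 𝓓'(Ω, ℂ)) (a : ℝ) (γ : ℂ) : Prop :=
  HasDilationLimit (Ioi 0) f a γ

/-- `f = F(x + i0)`: the functions `x ↦ F (x + iy)` converge to `f` in the sense of distributions
on `Ω` as `y → 0⁺`. -/
def IsBoundaryValue (F : ℂ → ℂ) (f : 𝓓'(Ω, ℂ)) : Prop :=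
  ∀ φ : 𝓓(Ω, ℝ),
    Tendsto (fun y : ℝ => ∫ x : ℝ, φ x • F ⟨x, y⟩) (𝓝[>] 0) (𝓝 (f φ))

/-- `F(z) → γ` as `z → x₀` angularly (non-tangentially) from the upper half plane. -/
def HasAngularLimit (F : ℂ → ℂ) (x₀ : ℝ) (γ : ℂ) : Prop :=
  ∀ M : ℝ, Tendsto F (𝓝[{z : ℂ | 0 < z.im ∧ |z.re - x₀| ≤ M * z.im}] (x₀ : ℂ)) (𝓝 γ)

end BoundaryValue

end

/-! Translating and subtracting the constant `γ` reduces everything to `x₀ = 0`, `γ = 0`, because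
the Euler operator `∂ g = (x g)'` fixes constants. What remains is an analytic `G` above a
neighbourhood of `0` with boundary functional `L`, equal to `∂ⁿ h` off `0` with `h` bounded, and
with lateral limit `0` from the right. This is the content of `BoundaryData`.

The central device is the substitution `z = exp w`. It maps a half strip `Re w ≤ ℓ`, `0 < Im w < π`
to a half disc at `0`, turns dilations into translations, and turns the transpose of `∂` into `φ ↦ φ
- φ'`. Averaging `G (exp w)` horizontally against a test kernel gives an analytic function in the
half strip. By distributional boundedness its boundary values on both horizontal sides are bounded;
by the lateral limit they tend to `0` on the lower side as `Re w → -∞`. A maximum principle of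
three-lines type (`SlowGrowth.maximum_principle`) carries this decay to every substrip `Im w ≤ π -
η`. The mean value property, smoothed by a radial bump, then removes the averaging: `G → 0`
non-tangentially, and `‖G z‖ ≤ B (‖z‖ / Im z) ^ (n + 1)` near `0`. The maximum principle needs an a
priori polynomial bound on `G` at the real axis, which comes from Banach-Steinhaus
(`exists_uniform_bound_lineInt`).

To return to `L`, a Taylor expansion in the height `y` expresses `L φ` by line integrals of `G` at a
positive height and a remainder whose factor `y ^ m` absorbs the blow-up of `G`
(`norm_boundary_le`). Applied to test functions dilated by `ε` at height `δ ε`, it makes the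
remainder small through `δ` and the main terms small through the angular limit. Hence the dilation
limit holds for all test functions, in particular on the left of `0`.

The point value is a Tauberian step. In logarithmic coordinates the dilation limit says that
correlations of `h (± exp s)` with kernels `logT^[n] φ` tend to `0`; since a bounded `f` with `f +
f' → 0` at `-∞` tends to `0`, the operators `logT` can be stripped off. Density in `L¹` then admits
the kernel of the Cesàro mean, so the mean `k` of `h` extends continuously by `0`, and `∂ k = h`
gives `L = ∂ⁿ⁺¹ k` off `0`. Nothing is concentrated at the origin, since on cutoffs at scale `ε`
both sides are `O(ε)` (`BoundaryData.repr_of_punctured`). -/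

noncomputable section

namespace BoundaryValue

section

/-! ### Integrals along horizontal lines -/

/-- The integral of `Q` against `φ` along the horizontal line through `w`. -/
def lineInt (Q : ℂ → ℂ) (φ : ℝ → ℝ) (w : ℂ) : ℂ := ∫ v : ℝ, (φ v : ℂ) * Q (w + v)

lemma continuous_mul_of_tsupport_subset {X : Type*} [TopologicalSpace X] {φ g : X → ℂ} {U : Set X}
    (hU : IsOpen U) (hφ : Continuous φ) (hg : ContinuousOn g U) (hs : tsupport φ ⊆ U) :
    Continuous fun v => φ v * g v :=
  (hφ.continuousOn.mul hg).continuous_of_tsupport_subset hU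
    ((tsupport_mul_subset_left).trans hs)

lemma tsupport_ofReal_comp (φ : ℝ → ℝ) : tsupport (fun v => (φ v : ℂ)) = tsupport φ := by
  have : Function.support (fun v => (φ v : ℂ)) = Function.support φ := by
    ext x; simp
  simp only [tsupport, this]

lemma continuous_lineInt_integrand {Q : ℂ → ℂ} {φ : ℝ → ℝ} {U : Set ℂ} {w : ℂ} (hU : IsOpen U)
    (hQ : ContinuousOn Q U) (hφ : Continuous φ) (hw : ∀ v ∈ tsupport φ, w + v ∈ U) :
    Continuous fun v : ℝ => (φ v : ℂ) * Q (w + v) := by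
  have hc : Continuous fun v : ℝ => w + v := by fun_prop
  refine continuous_mul_of_tsupport_subset (hU.preimage hc) (by fun_prop)
    (hQ.comp hc.continuousOn fun v hv => hv) ?_
  rw [tsupport_ofReal_comp]
  exact hw

lemma integrable_lineInt_integrand {Q : ℂ → ℂ} {φ : ℝ → ℝ} {U : Set ℂ} {w : ℂ} (hU : IsOpen U)
    (hQ : ContinuousOn Q U) (hφ : Continuous φ) (hc : HasCompactSupport φ)
    (hw : ∀ v ∈ tsupport φ, w + v ∈ U) :
    Integrable fun v : ℝ => (φ v : ℂ) * Q (w + v) := by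
  refine (continuous_lineInt_integrand hU hQ hφ hw).integrable_of_hasCompactSupport ?_
  exact (hc.comp_left (g := fun x : ℝ => (x : ℂ)) (by simp)).mul_right

lemma norm_lineInt_le {Q : ℂ → ℂ} {φ : ℝ → ℝ} {w : ℂ} {C : ℝ} (hφ : Continuous φ)
    (hc : HasCompactSupport φ) (hC : ∀ v ∈ tsupport φ, ‖Q (w + v)‖ ≤ C) :
    ‖lineInt Q φ w‖ ≤ C * ∫ v, |φ v| := by
  rw [lineInt, ← integral_const_mul]
  refine norm_integral_le_of_norm_le ?_ (ae_of_all _ fun v => ?_)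
  · exact ((hφ.abs.integrable_of_hasCompactSupport hc.abs).const_mul C)
  · by_cases hv : v ∈ tsupport φ
    · rw [norm_mul, Complex.norm_real, mul_comm, Real.norm_eq_abs]
      exact mul_le_mul_of_nonneg_right (hC v hv) (abs_nonneg _)
    · simp [image_eq_zero_of_notMem_tsupport hv]

/-- Differentiation under the integral puts the derivative on `Q`, and integration by parts moves it
to `φ`. The domination comes from a compact thickening of the translated support inside `U`. -/
lemma hasDerivAt_lineInt {Q : ℂ → ℂ} {φ : ℝ → ℝ} {U : Set ℂ} {w : ℂ} (hU : IsOpen U)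
    (hQ : DifferentiableOn ℂ Q U) (hφ : ContDiff ℝ 1 φ) (hc : HasCompactSupport φ)
    (hw : ∀ v ∈ tsupport φ, w + v ∈ U) :
    HasDerivAt (lineInt Q φ) (-lineInt Q (deriv φ) w) w := by
  have hQc := hQ.continuousOn
  have hQ'c : ContinuousOn (deriv Q) U := (hQ.deriv hU).continuousOn
  set K : Set ℂ := (fun v : ℝ => w + v) '' tsupport φ with hK
  have hKc : IsCompact K := hc.isCompact.image (by fun_prop)
  have hKU : K ⊆ U := by rintro _ ⟨v, hv, rfl⟩; exact hw v hv
  obtain ⟨δ, hδ, hδU⟩ := hKc.exists_cthickening_subset_open hU hKU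
  obtain ⟨C, hC⟩ := (hKc.cthickening (r := δ)).exists_bound_of_continuousOn (hQ'c.mono hδU)
  have hmem : ∀ x ∈ Metric.ball w δ, ∀ v ∈ tsupport φ, x + v ∈ Metric.cthickening δ K := by
    intro x hx v hv
    refine Metric.mem_cthickening_of_dist_le _ (w + v) _ _ ⟨v, hv, rfl⟩ ?_
    rw [dist_add_right]
    exact (Metric.mem_ball.1 hx).le
  have hcont : ∀ x ∈ Metric.ball w δ, Continuous fun v : ℝ => (φ v : ℂ) * Q (x + v) := fun x hx =>
    continuous_lineInt_integrand hU hQc hφ.continuous fun v hv => hδU (hmem x hx v hv)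
  have hφi : Integrable fun v => |φ v| :=
    (hφ.continuous.abs.integrable_of_hasCompactSupport hc.abs)
  have key := hasDerivAt_integral_of_dominated_loc_of_deriv_le (μ := volume) (𝕜 := ℂ)
    (F := fun x v => (φ v : ℂ) * Q (x + v)) (F' := fun x v => (φ v : ℂ) * deriv Q (x + v))
    (bound := fun v => C * |φ v|) (Metric.ball_mem_nhds w hδ)
    (by
      filter_upwards [Metric.ball_mem_nhds w hδ] with x hx
      exact (hcont x hx).aestronglyMeasurable)
    (integrable_lineInt_integrand hU hQc hφ.continuous hc hw)
    (continuous_lineInt_integrand hU hQ'c hφ.continuous hw).aestronglyMeasurable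
    (ae_of_all _ fun v x hx => by
      by_cases hv : v ∈ tsupport φ
      · rw [norm_mul, Complex.norm_real, mul_comm, Real.norm_eq_abs]
        exact mul_le_mul_of_nonneg_right (hC _ (hmem x hx v hv)) (abs_nonneg _)
      · simp [image_eq_zero_of_notMem_tsupport hv])
    (hφi.const_mul C)
    (ae_of_all _ fun v x hx => by
      by_cases hv : v ∈ tsupport φ
      · have h1 : DifferentiableAt ℂ Q (x + v) :=
          hQ.differentiableAt (hU.mem_nhds (hδU (hmem x hx v hv)))
        exact (h1.hasDerivAt.comp_add_const x (v : ℂ)).const_mul _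
      · simpa [image_eq_zero_of_notMem_tsupport hv] using hasDerivAt_const x (0 : ℂ))
  have hd : ∀ v : ℝ, HasDerivAt (fun v : ℝ => (φ v : ℂ) * Q (w + v))
      (((deriv φ v : ℝ) : ℂ) * Q (w + v) + (φ v : ℂ) * deriv Q (w + v)) v := by
    intro v
    by_cases hv : v ∈ tsupport φ
    · have h1 : HasDerivAt Q (deriv Q (w + v)) (w + v) :=
        (hQ.differentiableAt (hU.mem_nhds (hw v hv))).hasDerivAt
      have h3 := (hφ.differentiable one_ne_zero v).hasDerivAt.ofReal_comp
      have h4 : HasDerivAt (fun v : ℝ => Q (w + v)) (deriv Q (w + v)) v :=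
        (h1.comp_const_add w (v : ℂ)).comp_ofReal
      exact h3.mul h4
    · have h0 : φ =ᶠ[𝓝 v] 0 := notMem_tsupport_iff_eventuallyEq.1 hv
      have hd0 : deriv φ v = 0 := by rw [h0.deriv_eq]; simp
      rw [hd0, image_eq_zero_of_notMem_tsupport hv]
      simp only [Complex.ofReal_zero, zero_mul, add_zero]
      refine (hasDerivAt_const v (0 : ℂ)).congr_of_eventuallyEq ?_
      filter_upwards [h0] with x hx
      simp [hx]
  have hi1 : Integrable fun v : ℝ => ((deriv φ v : ℝ) : ℂ) * Q (w + v) :=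
    integrable_lineInt_integrand hU hQc (hφ.continuous_deriv le_rfl) hc.deriv fun v hv =>
      hw v (tsupport_deriv_subset (𝕜 := ℝ) hv)
  have h0 := integral_eq_zero_of_hasDerivAt_of_integrable hd (hi1.add key.1)
    (integrable_lineInt_integrand hU hQc hφ.continuous hc hw)
  rw [integral_add hi1 key.1] at h0
  have : (∫ v : ℝ, (φ v : ℂ) * deriv Q (w + v)) = -lineInt Q (deriv φ) w := by
    rw [lineInt]; linear_combination h0
  rw [← this]
  exact key.2

/-! ### A radial bump function and the mean value property -/

/-- A smooth radial bump on the plane, positive exactly on the open unit disc. -/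
def radialBump (u s : ℝ) : ℝ := Real.smoothTransition (1 - (u ^ 2 + s ^ 2))

lemma radialBump_nonneg (u s : ℝ) : 0 ≤ radialBump u s := Real.smoothTransition.nonneg _

lemma radialBump_eq_zero {u s : ℝ} (h : 1 ≤ u ^ 2 + s ^ 2) : radialBump u s = 0 :=
  Real.smoothTransition.zero_of_nonpos (by linarith)

lemma contDiff_radialBump : ContDiff ℝ ∞ fun p : ℝ × ℝ => radialBump p.1 p.2 := by
  unfold radialBump
  exact Real.smoothTransition.contDiff.comp (by fun_prop)

lemma hasCompactSupport_radialBump : HasCompactSupport fun p : ℝ × ℝ => radialBump p.1 p.2 := by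
  refine HasCompactSupport.intro (K := Icc (-1) 1 ×ˢ Icc (-1) 1)
    (isCompact_Icc.prod isCompact_Icc) fun p hp => radialBump_eq_zero ?_
  by_contra! h
  refine hp ⟨abs_le.1 ?_, abs_le.1 ?_⟩ <;> rw [← sq_le_one_iff_abs_le_one] <;> nlinarith [sq_nonneg p.1, sq_nonneg p.2]

/-- The induction replaces `κ` by its first partial derivative, again smooth with compact support in
the plane; this is what makes the bound uniform in the slice `s`. -/
lemma exists_bound_iteratedDeriv_fst {κ : ℝ × ℝ → ℝ} (h : ContDiff ℝ ∞ κ)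
    (hc : HasCompactSupport κ) (j : ℕ) :
    ∃ B, 0 ≤ B ∧ ∀ s u, |iteratedDeriv j (fun u => κ (u, s)) u| ≤ B := by
  induction j generalizing κ with
  | zero =>
    obtain ⟨B, hB⟩ := hc.exists_bound_of_continuous h.continuous
    exact ⟨B, (norm_nonneg _).trans (hB 0), fun s u => by simpa using hB (u, s)⟩
  | succ j ih =>
    have h1 : ContDiff ℝ ∞ fun p => fderiv ℝ κ p (1, 0) :=
      (h.fderiv_right (m := ∞) (by simp)).clm_apply contDiff_const
    have h2 : HasCompactSupport fun p => fderiv ℝ κ p (1, 0) :=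
      (hc.fderiv (𝕜 := ℝ)).comp_left (g := fun L : ℝ × ℝ →L[ℝ] ℝ => L (1, 0)) (by simp)
    obtain ⟨B, hB0, hB⟩ := ih h1 h2
    refine ⟨B, hB0, fun s u => ?_⟩
    rw [iteratedDeriv_succ']
    have : deriv (fun u => κ (u, s)) = fun u => fderiv ℝ κ (u, s) (1, 0) := by
      ext u
      have h3 : HasDerivAt (fun u : ℝ => (u, s)) ((1 : ℝ), (0 : ℝ)) u :=
        (hasDerivAt_id u).prodMk (hasDerivAt_const u s)
      exact ((h.differentiable (by simp) (u, s)).hasFDerivAt.comp_hasDerivAt u h3).deriv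
    rw [this]
    exact hB s u

/-- The total mass of `radialBump`. -/
def bumpMass : ℝ := ∫ p : ℝ × ℝ, radialBump p.1 p.2

lemma bumpMass_pos : 0 < bumpMass := by
  refine contDiff_radialBump.continuous.integral_pos_of_hasCompactSupport_nonneg_nonzero
    hasCompactSupport_radialBump (fun p => radialBump_nonneg _ _) (x := 0) ?_
  exact (Real.smoothTransition.pos_of_pos (by norm_num)).ne'

/-- In polar coordinates the bump depends on the radius alone, so the angular integral is a circle
average of `Q`, equal to `Q 0`. -/
lemma integral_radialBump_mul {Q : ℂ → ℂ} {U : Set ℂ} (hU : IsOpen U)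
    (hQ : DifferentiableOn ℂ Q U) (hb : Metric.closedBall 0 1 ⊆ U) :
    ∫ z : ℂ, (radialBump z.re z.im : ℂ) * Q z =
      (∫ r in Ioi (0 : ℝ), ((r * radialBump r 0 * (2 * Real.pi) : ℝ) : ℂ)) * Q 0 := by
  have hts : tsupport (fun z : ℂ => (radialBump z.re z.im : ℂ)) ⊆ Metric.closedBall 0 1 := by
    refine closure_minimal (fun z hz => ?_) Metric.isClosed_closedBall
    rw [mem_closedBall_zero_iff]
    by_contra! h
    refine hz ?_
    beta_reduce
    rw [radialBump_eq_zero, Complex.ofReal_zero]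
    have := Complex.sq_norm z
    rw [Complex.normSq_apply] at this
    nlinarith
  have hκc : Continuous fun z : ℂ => (radialBump z.re z.im : ℂ) := by
    have := contDiff_radialBump.continuous
    exact Complex.continuous_ofReal.comp
      (this.comp (Complex.continuous_re.prodMk Complex.continuous_im))
  have hfc : Continuous fun z : ℂ => (radialBump z.re z.im : ℂ) * Q z :=
    continuous_mul_of_tsupport_subset hU hκc hQ.continuousOn (hts.trans hb)
  rw [← Complex.integral_comp_polarCoord_symm]
  have hpol : ∀ p : ℝ × ℝ, Complex.polarCoord.symm p = circleMap 0 p.1 p.2 := by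
    intro p
    rw [Complex.polarCoord_symm_apply, circleMap, zero_add, Complex.exp_mul_I]
    push_cast
    rfl
  have hrad : ∀ r θ : ℝ, radialBump (circleMap 0 r θ).re (circleMap 0 r θ).im = radialBump r 0 := by
    intro r θ
    have h1 : (circleMap 0 r θ).re ^ 2 + (circleMap 0 r θ).im ^ 2 = r ^ 2 := by
      have := Complex.sq_norm (circleMap 0 r θ)
      rw [Complex.normSq_apply, norm_circleMap_zero, sq_abs] at this
      linarith
    rw [radialBump, radialBump, h1]
    simp
  have hgc : Continuous fun p : ℝ × ℝ =>
      (p.1 : ℂ) * ((radialBump p.1 0 : ℂ) * Q (circleMap 0 p.1 p.2)) := by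
    have h2 : Continuous fun p : ℝ × ℝ => circleMap 0 p.1 p.2 := by
      unfold circleMap; fun_prop
    refine (Complex.continuous_ofReal.comp continuous_fst).mul ((hfc.comp h2).congr fun p => ?_)
    simp only [Function.comp_apply, hrad]
  have hint : IntegrableOn (fun p : ℝ × ℝ =>
      (p.1 : ℂ) * ((radialBump p.1 0 : ℂ) * Q (circleMap 0 p.1 p.2)))
      (Ioi 0 ×ˢ Ioo (-Real.pi) Real.pi) (volume.prod volume) := by
    have h3 : IntegrableOn (fun p : ℝ × ℝ =>
      (p.1 : ℂ) * ((radialBump p.1 0 : ℂ) * Q (circleMap 0 p.1 p.2)))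
      (Icc 0 1 ×ˢ Icc (-Real.pi) Real.pi) (volume.prod volume) :=
      hgc.continuousOn.integrableOn_compact (isCompact_Icc.prod isCompact_Icc)
    refine h3.of_forall_sdiff_eq_zero (measurableSet_Ioi.prod measurableSet_Ioo) ?_
    -- The radial range is unbounded, but the bump vanishes for `r ≥ 1`, so integrability on a
    -- compact box suffices.
    rintro ⟨r, θ⟩ ⟨⟨hr, hθ⟩, h4⟩
    have : 1 ≤ r := by
      by_contra! h
      exact h4 ⟨⟨le_of_lt hr, h.le⟩, ⟨hθ.1.le, hθ.2.le⟩⟩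
    simp only
    rw [radialBump_eq_zero (by nlinarith)]
    simp
  have hcongr : ∀ p : ℝ × ℝ, p.1 • ((radialBump (Complex.polarCoord.symm p).re
      (Complex.polarCoord.symm p).im : ℂ) * Q (Complex.polarCoord.symm p)) =
      (p.1 : ℂ) * ((radialBump p.1 0 : ℂ) * Q (circleMap 0 p.1 p.2)) := by
    intro p
    rw [hpol, hrad, Complex.real_smul]
  simp_rw [hcongr]
  rw [polarCoord_target, Measure.volume_eq_prod, setIntegral_prod _ hint, ← integral_mul_const]
  refine setIntegral_congr_fun measurableSet_Ioi fun r hr => ?_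
  simp only
  rw [integral_const_mul, integral_const_mul]
  rcases le_or_gt 1 r with h1 | h1
  · rw [radialBump_eq_zero (by nlinarith)]
    simp
  have hr0 : 0 < r := hr
  have hd : DiffContOnCl ℂ Q (Metric.ball 0 |r|) := by
    refine DifferentiableOn.diffContOnCl (hQ.mono ?_)
    rw [closure_ball _ (by positivity), abs_of_pos hr0]
    exact (Metric.closedBall_subset_closedBall h1.le).trans hb
  have hca := hd.circleAverage
  have hper : Function.Periodic (fun θ => Q (circleMap 0 r θ)) (2 * Real.pi) := fun θ => by
    simp [periodic_circleMap 0 r θ]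
  -- Polar angles run over `(-π, π)`, circle averages over `(0, 2π)`; periodicity reconciles the
  -- two.
  have h5 := hper.intervalIntegral_add_eq (-Real.pi) 0
  rw [zero_add, show -Real.pi + 2 * Real.pi = Real.pi by ring,
    intervalIntegral.integral_of_le (by linarith [Real.pi_pos]),
    integral_Ioc_eq_integral_Ioo] at h5
  rw [Real.circleAverage_def, ← h5, Complex.real_smul] at hca
  have hpi : (2 * Real.pi : ℂ) ≠ 0 := by
    exact_mod_cast (mul_pos two_pos Real.pi_pos).ne'
  rw [← hca]
  push_cast
  field_simp

lemma integral_integral_radialBump {Q : ℂ → ℂ} {U : Set ℂ} (hU : IsOpen U)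
    (hQ : DifferentiableOn ℂ Q U) (hb : Metric.closedBall 0 1 ⊆ U) :
    ∫ s : ℝ, ∫ u : ℝ, (radialBump u s : ℂ) * Q (u + s * Complex.I) = bumpMass * Q 0 := by
  have hprod : ∀ {Q : ℂ → ℂ} {U : Set ℂ}, IsOpen U → DifferentiableOn ℂ Q U →
      Metric.closedBall 0 1 ⊆ U →
      ∫ z : ℂ, (radialBump z.re z.im : ℂ) * Q z =
        ∫ p : ℝ × ℝ, (radialBump p.1 p.2 : ℂ) * Q (p.1 + p.2 * Complex.I) := by
    intro Q U _ _ _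
    rw [← Complex.volume_preserving_equiv_real_prod.symm.integral_comp']
    refine integral_congr_ae (ae_of_all _ fun p => ?_)
    simp [Complex.measurableEquivRealProd_symm_apply, Complex.mk_eq_add_mul_I]
  -- The case `Q = 1` identifies the radial constant with `bumpMass`.
  have h1 := integral_radialBump_mul isOpen_univ
    (differentiableOn_const (c := (1 : ℂ))) (subset_univ _)
  rw [hprod isOpen_univ (differentiableOn_const (c := (1 : ℂ))) (subset_univ _)] at h1
  simp only [mul_one] at h1
  rw [integral_complex_ofReal, ← bumpMass] at h1
  rw [h1, ← integral_radialBump_mul hU hQ hb, hprod hU hQ hb, Measure.volume_eq_prod,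
    integral_prod_symm]
  have hcm : Continuous fun p : ℝ × ℝ => (p.1 : ℂ) + p.2 * Complex.I := by fun_prop
  have hts : tsupport (fun p : ℝ × ℝ => (radialBump p.1 p.2 : ℂ)) ⊆
      (fun p : ℝ × ℝ => (p.1 : ℂ) + p.2 * Complex.I) ⁻¹' Metric.closedBall 0 1 := by
    refine closure_minimal (fun p hp => ?_) (Metric.isClosed_closedBall.preimage hcm)
    rw [mem_preimage, mem_closedBall_zero_iff]
    by_contra! h
    refine hp ?_
    beta_reduce
    rw [radialBump_eq_zero, Complex.ofReal_zero]
    have := Complex.sq_norm ((p.1 : ℂ) + p.2 * Complex.I)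
    rw [Complex.normSq_add_mul_I] at this
    nlinarith
  refine Continuous.integrable_of_hasCompactSupport ?_ ?_
  · exact continuous_mul_of_tsupport_subset (hU.preimage hcm)
      (Complex.continuous_ofReal.comp contDiff_radialBump.continuous)
      (hQ.continuousOn.comp hcm.continuousOn fun p hp => hp)
      (hts.trans (preimage_mono hb))
  · exact (hasCompactSupport_radialBump.comp_left (g := fun x : ℝ => (x : ℂ)) (by simp)).mul_right

/-- A smoothed mean value property, sliced along horizontal lines. -/
lemma integral_lineInt_radialBump {Q : ℂ → ℂ} {U : Set ℂ} {w : ℂ} {d : ℝ} (hU : IsOpen U)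
    (hQ : DifferentiableOn ℂ Q U) (hd : 0 < d) (hb : Metric.closedBall w d ⊆ U) :
    ∫ s in Icc (-1 : ℝ) 1, lineInt Q (fun u => radialBump (u / d) s) (w + (d * s : ℝ) * Complex.I)
      = d * bumpMass * Q w := by
  have hb' : Metric.closedBall (0 : ℂ) 1 ⊆ (fun z => w + d * z) ⁻¹' U := by
    intro z hz
    refine hb ?_
    rw [mem_closedBall_zero_iff] at hz
    rw [Metric.mem_closedBall, dist_eq_norm, add_sub_cancel_left, norm_mul, Complex.norm_real,
      Real.norm_eq_abs, abs_of_pos hd]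
    nlinarith
  have h := integral_integral_radialBump (Q := fun z => Q (w + d * z)) (hU.preimage (by fun_prop))
    (hQ.comp (by fun_prop) fun z hz => hz) hb'
  simp only [mul_zero, add_zero] at h
  rw [mul_assoc, ← h, ← integral_const_mul, setIntegral_eq_integral_of_forall_compl_eq_zero]
  · refine integral_congr_ae (ae_of_all _ fun s => ?_)
    simp only
    have := Measure.integral_comp_div (fun u : ℝ => (radialBump u s : ℂ) *
      Q (w + d * (u + s * Complex.I))) d
    rw [abs_of_pos hd, Complex.real_smul] at this
    rw [← this, lineInt]
    refine integral_congr_ae (ae_of_all _ fun u => ?_)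
    simp only
    congr 2
    have : (d : ℂ) ≠ 0 := by exact_mod_cast hd.ne'
    push_cast
    field_simp
    ring
  · intro s hs
    have : 1 ≤ s ^ 2 := by
      by_contra! h1
      exact hs (abs_le.1 ((sq_le_one_iff_abs_le_one s).1 h1.le))
    have h0 : ∀ u, radialBump (u / d) s = 0 := fun u =>
      radialBump_eq_zero (by nlinarith [sq_nonneg (u / d)])
    simp [lineInt, h0]

/-- A pointwise bound from bounds for the integrals along horizontal segments. -/
lemma norm_le_of_lineInt_radialBump_le {Q : ℂ → ℂ} {U : Set ℂ} {w : ℂ} {d B : ℝ} (hU : IsOpen U)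
    (hQ : DifferentiableOn ℂ Q U) (hd : 0 < d) (hb : Metric.closedBall w d ⊆ U)
    (hB : ∀ s ∈ Icc (-1 : ℝ) 1,
      ‖lineInt Q (fun u => radialBump (u / d) s) (w + (d * s : ℝ) * Complex.I)‖ ≤ B) :
    ‖Q w‖ ≤ 2 * B / (d * bumpMass) := by
  have h := norm_setIntegral_le_of_norm_le_const (μ := volume) (s := Icc (-1 : ℝ) 1) (C := B)
    (by simp) hB
  rw [integral_lineInt_radialBump hU hQ hd hb] at h
  have hm := bumpMass_pos
  rw [le_div_iff₀ (by positivity)]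
  simp only [norm_mul, Complex.norm_real, Real.norm_eq_abs, abs_of_pos hd, abs_of_pos hm,
    Real.volume_real_Icc] at h
  norm_num at h
  linarith

end

section

/-! ### Uniform boundedness -/

/-- `φ` is a test function whose topological support is a compact subset of `S`. -/
structure IsTest (S : Set ℝ) (φ : ℝ → ℝ) : Prop where
  contDiff : ContDiff ℝ ∞ φ
  hasCompactSupport : HasCompactSupport φ
  tsupport_subset : tsupport φ ⊆ S

lemma IsTest.continuous {S : Set ℝ} {φ : ℝ → ℝ} (h : IsTest S φ) : Continuous φ :=
  h.contDiff.continuous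

lemma IsTest.mono {S S' : Set ℝ} {φ : ℝ → ℝ} (h : IsTest S φ) (hS : S ⊆ S') : IsTest S' φ :=
  ⟨h.1, h.2, h.3.trans hS⟩

lemma IsTest.deriv {S : Set ℝ} {φ : ℝ → ℝ} (h : IsTest S φ) : IsTest S (deriv φ) :=
  ⟨(contDiff_infty_iff_deriv.1 h.1).2, h.2.deriv, (tsupport_deriv_subset (𝕜 := ℝ)).trans h.3⟩

lemma isTest_of_forall_notMem {S : Set ℝ} {φ : ℝ → ℝ} (h : ContDiff ℝ ∞ φ) {K : Set ℝ}
    (hK : IsCompact K) (hKS : K ⊆ S) (h0 : ∀ x ∉ K, φ x = 0) : IsTest S φ := by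
  have hs : tsupport φ ⊆ K := closure_minimal
    (fun x hx => by by_contra hxK; exact hx (h0 x hxK)) hK.isClosed
  exact ⟨h, hK.of_isClosed_subset (isClosed_tsupport φ) hs, hs.trans hKS⟩

lemma lineInt_const_mul (Q : ℂ → ℂ) (φ : ℝ → ℝ) (c : ℝ) (w : ℂ) :
    lineInt Q (fun x => c * φ x) w = c * lineInt Q φ w := by
  simp only [lineInt, ← integral_const_mul, Complex.ofReal_mul, mul_assoc]

lemma lineInt_add {Q : ℂ → ℂ} {φ ψ : ℝ → ℝ} {U : Set ℂ} {w : ℂ} {S : Set ℝ} (hU : IsOpen U)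
    (hQ : ContinuousOn Q U) (hφ : IsTest S φ) (hψ : IsTest S ψ) (hw : ∀ v ∈ S, w + v ∈ U) :
    lineInt Q (fun x => φ x + ψ x) w = lineInt Q φ w + lineInt Q ψ w := by
  rw [lineInt, lineInt, lineInt, ← integral_add]
  · simp only [Complex.ofReal_add, add_mul]
  · exact integrable_lineInt_integrand hU hQ hφ.continuous hφ.2 fun v hv => hw v (hφ.3 hv)
  · exact integrable_lineInt_integrand hU hQ hψ.continuous hψ.2 fun v hv => hw v (hψ.3 hv)

lemma isOpen_rect (ρ : ℝ) : IsOpen (Ioo (-ρ) ρ ×ℂ Ioo 0 ρ) := isOpen_Ioo.reProdIm isOpen_Ioo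

lemma exists_bound_on_slab {G : ℂ → ℂ} {ρ a y₀ : ℝ} (haρ : a < ρ) (hy₀ : 0 < y₀)
    (hG : ContinuousOn G (Ioo (-ρ) ρ ×ℂ Ioo 0 ρ)) :
    ∃ C, 0 ≤ C ∧ ∀ y ∈ Icc y₀ a, ∀ x ∈ Icc (-a) a, ‖G (y * Complex.I + x)‖ ≤ C := by
  have hK : IsCompact (Icc (-a) a ×ℂ Icc y₀ a) := isCompact_Icc.reProdIm isCompact_Icc
  have hsub : Icc (-a) a ×ℂ Icc y₀ a ⊆ Ioo (-ρ) ρ ×ℂ Ioo 0 ρ := by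
    rintro z ⟨h1, h2⟩
    exact ⟨⟨by linarith [h1.1], h1.2.trans_lt haρ⟩, ⟨hy₀.trans_le h2.1, h2.2.trans_lt haρ⟩⟩
  obtain ⟨C, hC⟩ := hK.exists_bound_of_continuousOn (hG.mono hsub)
  refine ⟨max C 0, le_max_right _ _, fun y hy x hx => (hC _ ?_).trans (le_max_left _ _)⟩
  rw [Complex.mem_reProdIm]
  simpa using ⟨hx, hy⟩

/-- Banach-Steinhaus without a topology on test functions: a sequence of violators is packed into
one bounded linear family on the Banach space of bounded sequences, via `c ↦ ∑ c i 2⁻ⁱ φ i`. -/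
lemma exists_uniform_bound_lineInt {G : ℂ → ℂ} {ρ a : ℝ} (haρ : a < ρ)
    (hG : ContinuousOn G (Ioo (-ρ) ρ ×ℂ Ioo 0 ρ))
    (hlim : ∀ φ, IsTest (Ioo (-ρ) ρ) φ →
      ∃ l, Tendsto (fun y : ℝ => lineInt G φ (y * Complex.I)) (𝓝[>] 0) (𝓝 l)) :
    ∃ N : ℕ, ∃ C, 0 ≤ C ∧ ∀ y ∈ Ioc 0 a, ∀ φ, IsTest (Icc (-a) a) φ → ∀ M,
      (∀ j ≤ N, ∀ x, |iteratedDeriv j φ x| ≤ M) → ‖lineInt G φ (y * Complex.I)‖ ≤ C * M := by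
  by_contra! hcon
  -- Violators are normalized by `M`, which is positive because `M = 0` would force `φ = 0`. The
  -- size `N * 2 ^ N` outweighs the later factor `2⁻ⁿ`.
  have hex : ∀ N : ℕ, ∃ y ∈ Ioc 0 a, ∃ φ, IsTest (Icc (-a) a) φ ∧
      (∀ j ≤ N, ∀ x, |iteratedDeriv j φ x| ≤ 1) ∧
      N * 2 ^ N < ‖lineInt G φ (y * Complex.I)‖ := by
    intro N
    obtain ⟨y, hy, φ, hφ, M, hM, hlt⟩ := hcon N (N * 2 ^ N) (by positivity)
    have hM0 : 0 ≤ M := (abs_nonneg _).trans (hM 0 (Nat.zero_le _) 0)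
    have hMpos : 0 < M := by
      refine hM0.lt_of_ne fun h => ?_
      have h0 : φ = 0 := by
        ext x
        simpa [← h] using hM 0 (Nat.zero_le _) x
      rw [h0, ← h] at hlt
      simp [lineInt] at hlt
    refine ⟨y, hy, fun x => M⁻¹ * φ x, ?_, fun j hj x => ?_, ?_⟩
    · exact ⟨contDiff_const.mul hφ.1, hφ.2.mul_left, (tsupport_mul_subset_right).trans hφ.3⟩
    · rw [iteratedDeriv_const_mul_field, abs_mul, abs_of_pos (inv_pos.2 hMpos),
        inv_mul_le_iff₀ hMpos, mul_one]
      exact hM j hj x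
    · rw [lineInt_const_mul, norm_mul, Complex.norm_real, Real.norm_eq_abs,
        abs_of_pos (inv_pos.2 hMpos), lt_inv_mul_iff₀ hMpos, mul_comm]
      exact hlt
  choose y hy φ hφ hφb hlt using hex
  have hφ1 : ∀ N x, |φ N x| ≤ 1 := fun N x => by simpa using hφb N 0 (Nat.zero_le _) x
  let S : BoundedContinuousFunction ℕ ℝ → ℝ → ℝ := fun c x => ∑' i, c i * (2⁻¹ ^ i * φ i x)
  have hterm : ∀ (c : BoundedContinuousFunction ℕ ℝ) i x, ‖c i * (2⁻¹ ^ i * φ i x)‖ ≤ ‖c‖ * 2⁻¹ ^ i := by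
    intro c i x
    rw [norm_mul, norm_mul, norm_pow, norm_inv, Real.norm_ofNat]
    have h1 := c.norm_coe_le_norm i
    have h2 : ‖φ i x‖ ≤ 1 := hφ1 i x
    calc _ ≤ ‖c‖ * (2⁻¹ ^ i * 1) := by gcongr
      _ = _ := by ring
  have hgeo : Summable fun i : ℕ => (2⁻¹ : ℝ) ^ i :=
    summable_geometric_of_lt_one (by norm_num) (by norm_num)
  have hgeo2 : ∑' i : ℕ, (2⁻¹ : ℝ) ^ i = 2 := tsum_geometric_inv_two
  have hsum : ∀ (c : BoundedContinuousFunction ℕ ℝ) x, Summable fun i => c i * (2⁻¹ ^ i * φ i x) := fun c x =>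
    Summable.of_norm_bounded (hgeo.mul_left ‖c‖) fun i => hterm c i x
  have hSb : ∀ c x, |S c x| ≤ ‖c‖ * 2 := by
    intro c x
    rw [← hgeo2, ← tsum_mul_left]
    exact tsum_of_norm_bounded (hgeo.mul_left ‖c‖).hasSum fun i => hterm c i x
  have hStest : ∀ c, IsTest (Icc (-a) a) (S c) := by
    intro c
    refine isTest_of_forall_notMem ?_ isCompact_Icc le_rfl fun x hx => ?_
    · refine contDiff_tsum_of_eventually (v := fun _ i => ‖c‖ * 2⁻¹ ^ i)
        (fun i => contDiff_const.mul (contDiff_const.mul (hφ i).1))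
        -- Only derivatives of order at most `i` of `φ i` are controlled, so the `k`-th derivatives
        -- are dominated only for `i ≥ k`, which suffices.
        (fun k _ => hgeo.mul_left _) fun k _ => ?_
      rw [Nat.cofinite_eq_atTop]
      filter_upwards [eventually_ge_atTop k] with i hi x
      rw [norm_iteratedFDeriv_eq_norm_iteratedDeriv, iteratedDeriv_const_mul_field,
        iteratedDeriv_const_mul_field, norm_mul, norm_mul, norm_pow, norm_inv, Real.norm_ofNat]
      have h1 := c.norm_coe_le_norm i
      have h2 : ‖iteratedDeriv k (φ i) x‖ ≤ 1 := hφb i k hi x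
      calc _ ≤ ‖c‖ * (2⁻¹ ^ i * 1) := by gcongr
        _ = _ := by ring
    · have h0 : ∀ i, φ i x = 0 := fun i =>
        image_eq_zero_of_notMem_tsupport fun h => hx ((hφ i).3 h)
      simp [S, h0]
  have hmem : ∀ t ∈ Ioc 0 a, ∀ v ∈ Icc (-a) a,
      (t : ℂ) * Complex.I + (v : ℝ) ∈ Ioo (-ρ) ρ ×ℂ Ioo 0 ρ := by
    intro t ht v hv
    rw [Complex.mem_reProdIm]
    simp only [Complex.add_re, Complex.mul_re, Complex.ofReal_re, Complex.I_re, mul_zero,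
      Complex.ofReal_im, Complex.I_im, mul_one, sub_self, zero_add, Complex.add_im,
      Complex.mul_im, add_zero]
    exact ⟨⟨by linarith [hv.1], hv.2.trans_lt haρ⟩, ⟨ht.1, ht.2.trans_lt haρ⟩⟩
  have hint1 : ∀ c, ∫ v, |S c v| ≤ ‖c‖ * 2 * (2 * a ⊔ 0) := by
    intro c
    have h1 : ∫ v, |S c v| = ∫ v in Icc (-a) a, |S c v| := by
      rw [setIntegral_eq_integral_of_forall_compl_eq_zero]
      intro x hx
      rw [image_eq_zero_of_notMem_tsupport fun h => hx ((hStest c).3 h), abs_zero]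
    have h2 := norm_setIntegral_le_of_norm_le_const (μ := volume) (s := Icc (-a) a)
      (f := fun v => |S c v|) (C := ‖c‖ * 2) (by simp)
      (fun x _ => by rw [Real.norm_eq_abs, abs_abs]; exact hSb c x)
    rw [h1]
    refine (le_abs_self _).trans (h2.trans ?_)
    rw [Real.volume_real_Icc, sub_neg_eq_add, two_mul a]
  have hbound : ∀ t : Ioc 0 a, ∃ K, 0 ≤ K ∧ ∀ c : BoundedContinuousFunction ℕ ℝ,
      ‖lineInt G (S c) ((t : ℝ) * Complex.I)‖ ≤ K * ‖c‖ := by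
    intro t
    obtain ⟨K, hK0, hK⟩ := exists_bound_on_slab haρ t.2.1 hG
    refine ⟨K * (2 * (2 * a ⊔ 0)), by positivity, fun c => ?_⟩
    have h1 := norm_lineInt_le (Q := G) (w := (t : ℝ) * Complex.I) (C := K)
      (hStest c).continuous (hStest c).2 fun v hv =>
        hK t ⟨le_rfl, t.2.2⟩ v ((hStest c).3 hv)
    calc _ ≤ K * ∫ v, |S c v| := h1
      _ ≤ K * (‖c‖ * 2 * (2 * a ⊔ 0)) := by gcongr; exact hint1 c
      _ = _ := by ring
  choose K hK0 hK using hbound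
  let g : Ioc 0 a → BoundedContinuousFunction ℕ ℝ →L[ℝ] ℂ := fun t => LinearMap.mkContinuous
    { toFun := fun c => lineInt G (S c) ((t : ℝ) * Complex.I)
      map_add' := fun c c' => by
        rw [← lineInt_add (isOpen_rect ρ) hG (hStest c) (hStest c') (hmem t t.2)]
        congr 1
        ext x
        simp only [S, ← Summable.tsum_add (hsum c x) (hsum c' x)]
        simp [add_mul]
      map_smul' := fun r c => by
        rw [RingHom.id_apply, Complex.real_smul, ← lineInt_const_mul]
        congr 1
        ext x
        simp only [S, ← tsum_mul_left]
        simp [mul_assoc] } (K t) (hK t)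
  -- Pointwise boundedness: heights near `0` are covered by the existence of the limit, the others
  -- by compactness.
  obtain ⟨B, hB⟩ := banach_steinhaus (g := g) (by
    intro c
    obtain ⟨l, hl⟩ := hlim (S c) ((hStest c).mono fun x hx =>
      ⟨by linarith [hx.1], hx.2.trans_lt haρ⟩)
    have hev := hl.norm.eventually (gt_mem_nhds (lt_add_one ‖l‖))
    obtain ⟨ε, hε, hεs⟩ := mem_nhdsGT_iff_exists_Ioo_subset.1 hev
    obtain ⟨D, hD0, hD⟩ := exists_bound_on_slab haρ hε hG
    refine ⟨max (‖l‖ + 1) (D * ∫ v, |S c v|), fun t => ?_⟩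
    rcases lt_or_ge (t : ℝ) ε with h | h
    · exact le_max_of_le_left (le_of_lt (hεs ⟨t.2.1, h⟩))
    · refine le_max_of_le_right ?_
      exact norm_lineInt_le (Q := G) (w := (t : ℝ) * Complex.I) (C := D)
        (hStest c).continuous (hStest c).2 fun v hv => hD t ⟨h, t.2.2⟩ v ((hStest c).3 hv))
  obtain ⟨n, hn⟩ := exists_nat_gt B
  -- The unit sequence at `n > B` isolates `2⁻ⁿ φ n` and contradicts the choice of `φ n`.
  let e : BoundedContinuousFunction ℕ ℝ := BoundedContinuousFunction.ofNormedAddCommGroupDiscrete (Pi.single n 1) 1 (by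
    intro i
    rcases eq_or_ne i n with rfl | h <;> simp [*])
  have hei : ∀ i, e i = (Pi.single n 1 : ℕ → ℝ) i := fun i => rfl
  have he : ‖e‖ ≤ 1 := BoundedContinuousFunction.norm_ofNormedAddCommGroup_le _ zero_le_one _
  have hSe : S e = fun x => 2⁻¹ ^ n * φ n x := by
    ext x
    simp only [S]
    rw [tsum_eq_single n]
    · simp [hei]
    · intro i hi
      simp [hei, hi]
  have h1 : ‖g ⟨y n, hy n⟩ e‖ ≤ B := by
    refine ((g ⟨y n, hy n⟩).le_opNorm e).trans ?_
    have := hB ⟨y n, hy n⟩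
    nlinarith [norm_nonneg e, norm_nonneg (g ⟨y n, hy n⟩)]
  have h2 : g ⟨y n, hy n⟩ e = lineInt G (S e) (y n * Complex.I) := rfl
  rw [h2, hSe, lineInt_const_mul, norm_mul, Complex.norm_real, norm_pow, norm_inv,
    Real.norm_ofNat, inv_pow, inv_mul_le_iff₀ (by positivity)] at h1
  have h3 := hlt n
  have : B * 2 ^ n ≤ n * 2 ^ n := by gcongr
  linarith

/-! ### Polynomial growth of `G` towards the real axis -/

lemma iteratedDeriv_comp_sub_div {f : ℝ → ℝ} (hf : ContDiff ℝ ∞ f) (j : ℕ) (x d v : ℝ) :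
    iteratedDeriv j (fun v => f ((v - x) / d)) v = d⁻¹ ^ j * iteratedDeriv j f ((v - x) / d) := by
  have h1 := iteratedDeriv_comp_const_mul (n := j) (hf.of_le (by exact_mod_cast le_top)) d⁻¹
  have h2 := congrFun (iteratedDeriv_comp_sub_const j (fun v => f (d⁻¹ * v)) x) v
  simp only [div_eq_inv_mul]
  rw [h2, h1]

lemma lineInt_comp_sub (Q : ℂ → ℂ) (φ : ℝ → ℝ) (x : ℝ) (w : ℂ) :
    lineInt Q (fun v => φ (v - x)) w = lineInt Q φ (w + x) := by
  rw [lineInt, lineInt, ← integral_sub_right_eq_self (fun v : ℝ => (φ v : ℂ) * Q (w + x + v)) x]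
  refine integral_congr_ae (ae_of_all _ fun v => ?_)
  simp only
  congr 2
  push_cast
  ring

lemma exists_bound_iteratedDeriv_radialBump (N : ℕ) :
    ∃ B, 0 ≤ B ∧ ∀ j ≤ N, ∀ s u, |iteratedDeriv j (fun u => radialBump u s) u| ≤ B := by
  choose B hB0 hB using exists_bound_iteratedDeriv_fst contDiff_radialBump
    hasCompactSupport_radialBump
  refine ⟨∑ j ∈ Finset.range (N + 1), B j, Finset.sum_nonneg fun j _ => hB0 j,
    fun j hj s u => (hB j s u).trans ?_⟩
  exact Finset.single_le_sum (f := B) (fun j _ => hB0 j) (Finset.mem_range.2 (by omega))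

lemma contDiff_radialBump_left (s : ℝ) : ContDiff ℝ ∞ fun u => radialBump u s :=
  contDiff_radialBump.comp (contDiff_id.prodMk contDiff_const)

lemma radialBump_eq_zero_of_notMem {u s : ℝ} (h : u ∉ Icc (-1 : ℝ) 1) : radialBump u s = 0 := by
  refine radialBump_eq_zero ?_
  have : 1 < |u| := by
    by_contra! h1
    exact h (abs_le.1 h1)
  have := (one_lt_sq_iff_one_lt_abs u).2 this
  nlinarith [sq_nonneg s]

/-- The smoothed mean value property at radius `d = y / 2` reduces the value of `G` to line
integrals against bumps of width `d`. Up to `N` derivatives cost `d⁻¹ ^ N`, and the normalization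
costs one more power. The condition `a ≤ 1` gives `d⁻¹ ≥ 1`, so the top order dominates. -/
lemma exists_pow_bound {G : ℂ → ℂ} {ρ a : ℝ} (ha1 : a ≤ 1) (haρ : a < ρ)
    (hG : DifferentiableOn ℂ G (Ioo (-ρ) ρ ×ℂ Ioo 0 ρ))
    (hlim : ∀ φ, IsTest (Ioo (-ρ) ρ) φ →
      ∃ l, Tendsto (fun y : ℝ => lineInt G φ (y * Complex.I)) (𝓝[>] 0) (𝓝 l)) :
    ∃ N : ℕ, ∃ C, 0 ≤ C ∧ ∀ z : ℂ, |z.re| ≤ a / 2 → 0 < z.im → z.im ≤ a / 2 →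
      ‖G z‖ ≤ C / z.im ^ N := by
  obtain ⟨N, C, hC0, hC⟩ := exists_uniform_bound_lineInt haρ hG.continuousOn hlim
  obtain ⟨B, hB0, hB⟩ := exists_bound_iteratedDeriv_radialBump N
  have hm := bumpMass_pos
  refine ⟨N + 1, 2 * (C * (2 ^ N * B)) / bumpMass * 2, by positivity, fun z hx hy0 hy => ?_⟩
  set x := z.re
  set y := z.im
  have hz : z = x + y * Complex.I := (Complex.re_add_im z).symm
  set d := y / 2 with hd
  have hd0 : 0 < d := by positivity
  have hx' := abs_le.1 hx
  have hball : Metric.closedBall z d ⊆ Ioo (-ρ) ρ ×ℂ Ioo 0 ρ := by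
    intro w hw
    rw [Metric.mem_closedBall, dist_eq_norm] at hw
    have h1 := abs_le.1 ((Complex.abs_re_le_norm (w - z)).trans hw)
    have h2 := abs_le.1 ((Complex.abs_im_le_norm (w - z)).trans hw)
    rw [Complex.sub_re] at h1
    rw [Complex.sub_im] at h2
    exact ⟨⟨by linarith, by linarith⟩, ⟨by linarith, by linarith⟩⟩
  have key := norm_le_of_lineInt_radialBump_le (isOpen_rect ρ) hG hd0 hball
    (B := C * (d⁻¹ ^ N * B)) (by
    intro s hs
    have hsh := lineInt_comp_sub G (fun v => radialBump (v / d) s) x ((y + d * s : ℝ) * Complex.I)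
    have heq : ((y + d * s : ℝ) : ℂ) * Complex.I + x = z + (d * s : ℝ) * Complex.I := by
      rw [hz]; push_cast; ring
    rw [heq] at hsh
    rw [← hsh]
    have hds : |d * s| ≤ d := by
      rw [abs_mul, abs_of_pos hd0]
      have := abs_le.2 hs
      nlinarith
    have hds' := abs_le.1 hds
    refine hC _ ⟨by linarith, by linarith⟩ _ ?_ _ fun j hj v => ?_
    · refine isTest_of_forall_notMem ?_ (K := Icc (x - d) (x + d)) isCompact_Icc ?_ fun v hv => ?_
      · exact (contDiff_radialBump_left s).comp (by fun_prop)
      · intro v hv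
        exact ⟨by linarith [hv.1], by linarith [hv.2]⟩
      · refine radialBump_eq_zero_of_notMem fun h => hv ?_
        have h1 := (le_div_iff₀ hd0).1 h.1
        have h2 := (div_le_iff₀ hd0).1 h.2
        exact ⟨by linarith, by linarith⟩
    · rw [iteratedDeriv_comp_sub_div (contDiff_radialBump_left s), abs_mul, abs_pow, abs_inv,
        abs_of_pos hd0]
      have h1 : (1 : ℝ) ≤ d⁻¹ := (one_le_inv₀ hd0).2 (by linarith)
      exact mul_le_mul (pow_le_pow_right₀ h1 hj) (hB j hj s _) (abs_nonneg _) (by positivity))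
  refine key.trans (le_of_eq ?_)
  rw [hd, inv_div, div_pow]
  field_simp
  ring

end

section

/-! ### Euler operators, dilations and logarithmic coordinates -/

/-- The transpose of `g ↦ (x g)'`. -/
def eulerT (φ : ℝ → ℝ) : ℝ → ℝ := fun x => -(x * deriv φ x)

/-- The operator `eulerT` in logarithmic coordinates. -/
def logT (φ : ℝ → ℝ) : ℝ → ℝ := fun v => φ v - deriv φ v

/-- The density `φ (log x) / x` on the positive half line. -/
def expLift (φ : ℝ → ℝ) : ℝ → ℝ := fun x => if 0 < x then φ (Real.log x) / x else 0

/-- The `L¹`-normalized dilation by a nonzero factor. -/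
def dil (ψ : ℝ → ℝ) (c : ℝ) : ℝ → ℝ := fun x => |c|⁻¹ * ψ (x / c)

lemma IsTest.eulerT {S : Set ℝ} {φ : ℝ → ℝ} (h : IsTest S φ) : IsTest S (eulerT φ) := by
  have h1 := h.deriv
  refine ⟨(contDiff_id.mul h1.1).neg, ?_, ?_⟩
  · exact (h1.2.mul_left (f := fun x => x)).comp_left neg_zero
  · refine subset_trans (closure_mono ?_) h1.3
    intro x hx h0
    exact hx (by simp [BoundaryValue.eulerT, h0])

lemma IsTest.logT {S : Set ℝ} {φ : ℝ → ℝ} (h : IsTest S φ) : IsTest S (logT φ) :=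
  ⟨h.1.sub h.deriv.1, h.2.sub h.deriv.2,
    (tsupport_sub _ _).trans (union_subset h.3 h.deriv.3)⟩

lemma IsTest.iterate {S : Set ℝ} {T : (ℝ → ℝ) → ℝ → ℝ} (hT : ∀ φ, IsTest S φ → IsTest S (T φ))
    (n : ℕ) {φ : ℝ → ℝ} (h : IsTest S φ) : IsTest S (T^[n] φ) := by
  induction n generalizing φ with
  | zero => exact h
  | succ n ih => exact ih (hT φ h)

lemma isTest_expLift {α β : ℝ} {φ : ℝ → ℝ} (h : IsTest (Icc α β) φ) :
    IsTest (Icc (Real.exp α) (Real.exp β)) (expLift φ) := by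
  have h0 : ∀ x ∉ Icc (Real.exp α) (Real.exp β), expLift φ x = 0 := by
    intro x hx
    rw [expLift]
    split_ifs with hpos
    · have h1 : Real.log x ∉ tsupport φ := fun h1 => hx
        ⟨(Real.le_log_iff_exp_le hpos).1 (h.3 h1).1, (Real.log_le_iff_le_exp hpos).1 (h.3 h1).2⟩
      rw [image_eq_zero_of_notMem_tsupport h1, zero_div]
    · rfl
  refine isTest_of_forall_notMem ?_ isCompact_Icc le_rfl h0
  rw [contDiff_iff_contDiffAt]
  intro x
  rcases lt_or_ge x (Real.exp α) with hx | hx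
  · refine (contDiffAt_const (c := (0 : ℝ))).congr_of_eventuallyEq ?_
    filter_upwards [gt_mem_nhds hx] with y hy
    exact h0 y fun h1 => absurd h1.1 (not_le.2 hy)
  · have hpos : 0 < x := (Real.exp_pos _).trans_le hx
    have h1 : ContDiffAt ℝ ∞ (fun y => φ (Real.log y) / y) x :=
      (h.1.contDiffAt.comp x (Real.contDiffAt_log.2 hpos.ne')).div contDiffAt_id hpos.ne'
    refine h1.congr_of_eventuallyEq ?_
    filter_upwards [lt_mem_nhds hpos] with y hy
    simp [expLift, hy]

/-- Differentiating `φ (log x) / x` gives `(φ' - φ)(log x) / x ^ 2`; multiplication by `-x` restores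
the form of a lift. -/
lemma eulerT_expLift {φ : ℝ → ℝ} (h : ContDiff ℝ ∞ φ) :
    eulerT (expLift φ) = expLift (logT φ) := by
  ext x
  rcases lt_trichotomy x 0 with hx | rfl | hx
  · have : expLift φ =ᶠ[𝓝 x] fun _ => 0 := by
      filter_upwards [gt_mem_nhds hx] with y hy
      simp [expLift, not_lt.2 (le_of_lt hy)]
    simp [eulerT, this.deriv_eq, expLift, not_lt.2 hx.le]
  · simp [eulerT, expLift]
  · have h1 : expLift φ =ᶠ[𝓝 x] fun y => φ (Real.log y) / y := by
      filter_upwards [lt_mem_nhds hx] with y hy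
      simp [expLift, hy]
    have h2 : HasDerivAt φ (deriv φ (Real.log x)) (Real.log x) :=
      (h.differentiable (by simp) _).hasDerivAt
    have h3 := (h2.comp x (Real.hasDerivAt_log hx.ne')).div (hasDerivAt_id x) hx.ne'
    rw [eulerT, h1.deriv_eq]
    have h4 : deriv (fun y => φ (Real.log y) / y) x = _ := h3.deriv
    rw [h4]
    simp only [expLift, hx, if_true, logT, Function.comp_apply, id]
    field_simp
    ring

lemma iterate_eulerT_expLift {S : Set ℝ} (n : ℕ) {φ : ℝ → ℝ} (h : IsTest S φ) :
    eulerT^[n] (expLift φ) = expLift (logT^[n] φ) := by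
  induction n generalizing φ with
  | zero => rfl
  | succ n ih =>
    rw [Function.iterate_succ_apply, Function.iterate_succ_apply, eulerT_expLift h.1, ih h.logT]

lemma eulerT_comp_div (ψ : ℝ → ℝ) (c : ℝ) :
    eulerT (fun x => ψ (x / c)) = fun x => eulerT ψ (x / c) := by
  ext x
  have := deriv_comp_mul_left c⁻¹ ψ x
  simp only [eulerT, div_eq_inv_mul]
  rw [this, smul_eq_mul]
  ring

lemma eulerT_const_mul (ψ : ℝ → ℝ) (c : ℝ) :
    eulerT (fun x => c * ψ x) = fun x => c * eulerT ψ x := by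
  ext x
  simp only [eulerT, deriv_const_mul_field]
  ring

lemma iterate_eulerT_const_mul (n : ℕ) (ψ : ℝ → ℝ) (c : ℝ) :
    eulerT^[n] (fun x => c * ψ x) = fun x => c * eulerT^[n] ψ x := by
  induction n generalizing ψ with
  | zero => rfl
  | succ n ih => rw [Function.iterate_succ_apply, eulerT_const_mul, ih, Function.iterate_succ_apply]

lemma iterate_eulerT_comp_div (n : ℕ) (ψ : ℝ → ℝ) (c : ℝ) :
    eulerT^[n] (fun x => ψ (x / c)) = fun x => eulerT^[n] ψ (x / c) := by
  induction n generalizing ψ with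
  | zero => rfl
  | succ n ih => rw [Function.iterate_succ_apply, eulerT_comp_div, ih, Function.iterate_succ_apply]

/-- The Euler operator is homogeneous of degree zero, hence commutes with dilations. -/
lemma iterate_eulerT_dil (n : ℕ) (ψ : ℝ → ℝ) (c : ℝ) :
    eulerT^[n] (dil ψ c) = dil (eulerT^[n] ψ) c := by
  unfold dil
  rw [iterate_eulerT_const_mul n (fun x => ψ (x / c)), iterate_eulerT_comp_div]

lemma isTest_comp_div {S S' : Set ℝ} {ψ : ℝ → ℝ} {c : ℝ} (hc : c ≠ 0) (h : IsTest S ψ)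
    (hS : ∀ x ∈ S, c * x ∈ S') : IsTest S' (fun x => ψ (x / c)) := by
  refine isTest_of_forall_notMem (h.1.comp (by fun_prop)) (K := (fun x => c * x) '' tsupport ψ)
    (h.2.isCompact.image (by fun_prop)) ?_ fun x hx => ?_
  · rintro _ ⟨x, hx, rfl⟩
    exact hS x (h.3 hx)
  · refine image_eq_zero_of_notMem_tsupport fun h1 => hx ⟨x / c, h1, ?_⟩
    field_simp

lemma isTest_dil {S S' : Set ℝ} {ψ : ℝ → ℝ} {c : ℝ} (hc : c ≠ 0) (h : IsTest S ψ)
    (hS : ∀ x ∈ S, c * x ∈ S') : IsTest S' (dil ψ c) := by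
  have h1 := isTest_comp_div hc h hS
  exact ⟨contDiff_const.mul h1.1, h1.2.mul_left, tsupport_mul_subset_right.trans h1.3⟩

lemma integral_dil_mul (ψ : ℝ → ℝ) (H : ℝ → ℂ) {c : ℝ} (hc : c ≠ 0) :
    ∫ x, (dil ψ c x : ℂ) * H x = ∫ x, (ψ x : ℂ) * H (c * x) := by
  have := Measure.integral_comp_mul_left (fun x => (dil ψ c x : ℂ) * H x) c
  have hc' : ((|c| : ℝ) : ℂ) ≠ 0 := by exact_mod_cast (abs_pos.2 hc).ne'
  have h2 : ∫ x, (dil ψ c x : ℂ) * H x = |c| * ∫ x, (dil ψ c (c * x) : ℂ) * H (c * x) := by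
    rw [this, Complex.real_smul, abs_inv]
    push_cast
    rw [← mul_assoc, mul_inv_cancel₀ hc', one_mul]
  rw [h2, ← integral_const_mul]
  refine integral_congr_ae (ae_of_all _ fun x => ?_)
  simp only [dil]
  rw [mul_div_cancel_left₀ x hc]
  push_cast
  field_simp

lemma integral_expLift_mul (φ : ℝ → ℝ) (H : ℝ → ℂ) :
    ∫ x, (expLift φ x : ℂ) * H x = ∫ v, (φ v : ℂ) * H (Real.exp v) := by
  have h1 : ∫ x, (expLift φ x : ℂ) * H x = ∫ x in Ioi 0, (expLift φ x : ℂ) * H x := by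
    rw [setIntegral_eq_integral_of_forall_compl_eq_zero]
    intro x hx
    simp [expLift, not_lt.1 (show ¬ 0 < x from hx)]
  have h2 := integral_image_eq_integral_abs_deriv_smul (s := univ) MeasurableSet.univ
    (f := Real.exp) (f' := Real.exp) (fun x _ => (Real.hasDerivAt_exp x).hasDerivWithinAt)
    Real.exp_injective.injOn (fun x => (expLift φ x : ℂ) * H x)
  rw [image_univ, Real.range_exp, setIntegral_univ] at h2
  rw [h1, h2]
  refine integral_congr_ae (ae_of_all _ fun v => ?_)
  simp only [expLift, Real.exp_pos, if_true, Real.log_exp, Complex.real_smul,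
    abs_of_pos (Real.exp_pos v)]
  have : ((Real.exp v : ℝ) : ℂ) ≠ 0 := by exact_mod_cast (Real.exp_pos v).ne'
  push_cast at *
  field_simp

/-- Integrals along horizontal lines in logarithmic coordinates. -/
lemma lineInt_exp (G : ℂ → ℂ) (φ : ℝ → ℝ) (τ : ℝ) {w : ℂ} {c : ℝ} (hc : c ≠ 0)
    (hw : Complex.exp w = c) :
    lineInt (fun w => G (Complex.exp w + τ * Complex.I)) φ w =
      lineInt G (dil (expLift φ) c) (τ * Complex.I) := by
  rw [lineInt, lineInt, integral_dil_mul _ (fun x : ℝ => G (τ * Complex.I + x)) hc,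
    integral_expLift_mul φ (fun x => G (τ * Complex.I + (c * x : ℝ)))]
  refine integral_congr_ae (ae_of_all _ fun v => ?_)
  simp only
  rw [Complex.exp_add, hw, add_comm]
  push_cast
  rfl

/-- An analytic function `G` on the upper half of a neighbourhood of `0` with boundary values `L`,
where `L` is the `n`-th Euler derivative of a bounded continuous function `h` away from `0` and has
the lateral limit `0` from the right. -/
structure BoundaryData (ρ : ℝ) (G : ℂ → ℂ) (L : (ℝ → ℝ) → ℂ) (n : ℕ) (h : ℝ → ℂ) (C : ℝ) :
    Prop where
  pos : 0 < ρ
  diff : DifferentiableOn ℂ G (Ioo (-ρ) ρ ×ℂ Ioo 0 ρ)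
  tendsto : ∀ φ, IsTest (Ioo (-ρ) ρ) φ →
    Tendsto (fun y : ℝ => lineInt G φ (y * Complex.I)) (𝓝[>] 0) (𝓝 (L φ))
  contOn : ContinuousOn h (Ioo (-ρ) ρ \ {0})
  bound : ∀ x ∈ Ioo (-ρ) ρ \ {0}, ‖h x‖ ≤ C
  repr : ∀ φ, IsTest (Ioo (-ρ) ρ \ {0}) φ → L φ = ∫ x, ((eulerT^[n] φ x : ℝ) : ℂ) * h x
  right : ∀ φ, IsTest (Ioi 0) φ →
    Tendsto (fun ε : ℝ => L (dil φ ε)) (𝓝[>] 0) (𝓝 0)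

variable {ρ : ℝ} {G : ℂ → ℂ} {L : (ℝ → ℝ) → ℂ} {n : ℕ} {h : ℝ → ℂ} {C : ℝ}

lemma BoundaryData.nonneg (D : BoundaryData ρ G L n h C) : 0 ≤ C :=
  (norm_nonneg _).trans (D.bound (ρ / 2)
    ⟨⟨by linarith [D.pos], by linarith [D.pos]⟩, by simpa using D.pos.ne'⟩)

lemma mul_exp_mem {c b x : ℝ} (hc : c ≠ 0) (hb : |c| * Real.exp b < ρ)
    (hx : x ∈ Icc (Real.exp (-b)) (Real.exp b)) : c * x ∈ Ioo (-ρ) ρ \ {0} := by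
  have hx0 : 0 < x := (Real.exp_pos _).trans_le hx.1
  have h1 : |c * x| < ρ := by
    rw [abs_mul, abs_of_pos hx0]
    exact (mul_le_mul_of_nonneg_left hx.2 (abs_nonneg c)).trans_lt hb
  exact ⟨abs_lt.1 h1, by simp [hc, hx0.ne']⟩

lemma BoundaryData.isTest_dil_expLift (_D : BoundaryData ρ G L n h C) {φ : ℝ → ℝ} {b c : ℝ}
    (hφ : IsTest (Icc (-b) b) φ) (hc : c ≠ 0) (hb : |c| * Real.exp b < ρ) :
    IsTest (Ioo (-ρ) ρ \ {0}) (dil (expLift φ) c) :=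
  isTest_dil hc (isTest_expLift hφ) fun _ hx => mul_exp_mem hc hb hx

lemma BoundaryData.apply_dil_expLift (D : BoundaryData ρ G L n h C) {φ : ℝ → ℝ} {b c : ℝ}
    (hφ : IsTest (Icc (-b) b) φ) (hc : c ≠ 0) (hb : |c| * Real.exp b < ρ) :
    L (dil (expLift φ) c) = ∫ v, ((logT^[n] φ v : ℝ) : ℂ) * h (c * Real.exp v) := by
  rw [D.repr _ (D.isTest_dil_expLift hφ hc hb), iterate_eulerT_dil, integral_dil_mul _ _ hc,
    iterate_eulerT_expLift n hφ, integral_expLift_mul _ (fun x => h (c * x))]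

/-- All Euler derivatives fall on the kernel in logarithmic coordinates, where `c` only translates
the argument of `h`; the bound is therefore independent of `c`. -/
lemma BoundaryData.norm_apply_dil_expLift_le (D : BoundaryData ρ G L n h C) {φ : ℝ → ℝ} {b c : ℝ}
    (hφ : IsTest (Icc (-b) b) φ) (hc : c ≠ 0) (hb : |c| * Real.exp b < ρ) :
    ‖L (dil (expLift φ) c)‖ ≤ C * ∫ v, |logT^[n] φ v| := by
  have hφn := IsTest.iterate (fun _ hf => hf.logT) n hφ
  rw [D.apply_dil_expLift hφ hc hb, ← integral_const_mul]
  refine norm_integral_le_of_norm_le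
    ((hφn.continuous.abs.integrable_of_hasCompactSupport hφn.2.abs).const_mul C)
    (ae_of_all _ fun v => ?_)
  by_cases hv : v ∈ tsupport (logT^[n] φ)
  · rw [norm_mul, Complex.norm_real, mul_comm, Real.norm_eq_abs]
    have hv' := hφn.3 hv
    exact mul_le_mul_of_nonneg_right (D.bound _ (mul_exp_mem hc hb
      ⟨Real.exp_le_exp.2 hv'.1, Real.exp_le_exp.2 hv'.2⟩)) (abs_nonneg _)
  · simp [image_eq_zero_of_notMem_tsupport hv]

/-- When `exp w` is real, `τ` is exactly the height of the line over which `G` is integrated, so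
this is the definition of the boundary value. Positive `c` is the lower side of the strip, negative
`c` the upper side. -/
lemma BoundaryData.tendsto_lineInt_exp (D : BoundaryData ρ G L n h C) {φ : ℝ → ℝ} {b c : ℝ}
    {w : ℂ} (hφ : IsTest (Icc (-b) b) φ) (hc : c ≠ 0) (hb : |c| * Real.exp b < ρ)
    (hw : Complex.exp w = c) :
    Tendsto (fun τ : ℝ => lineInt (fun w => G (Complex.exp w + τ * Complex.I)) φ w) (𝓝[>] 0)
      (𝓝 (L (dil (expLift φ) c))) := by
  simp_rw [lineInt_exp G φ _ hc hw]
  exact D.tendsto _ ((D.isTest_dil_expLift hφ hc hb).mono sdiff_subset)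

end

section

/-! ### The maximum principle in a half strip -/

/-- `G` is analytic in the upper half of a neighbourhood of `0` and grows at most polynomially
towards the real axis. -/
structure SlowGrowth (ρ a : ℝ) (G : ℂ → ℂ) (N : ℕ) (A : ℝ) : Prop where
  pos : 0 < a
  lt : a < ρ
  nonneg : 0 ≤ A
  diff : DifferentiableOn ℂ G (Ioo (-ρ) ρ ×ℂ Ioo 0 ρ)
  bound : ∀ z : ℂ, |z.re| ≤ a / 2 → 0 < z.im → z.im ≤ a / 2 → ‖G z‖ ≤ A / z.im ^ N

/-- The function `G (· + iτ)` in logarithmic coordinates. -/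
def logShift (G : ℂ → ℂ) (τ : ℝ) (w : ℂ) : ℂ := G (Complex.exp w + τ * Complex.I)

lemma isOpen_logShift_domain (ρ τ : ℝ) :
    IsOpen ((fun w => Complex.exp w + τ * Complex.I) ⁻¹' (Ioo (-ρ) ρ ×ℂ Ioo 0 ρ)) :=
  (isOpen_rect ρ).preimage (by fun_prop)

lemma differentiableOn_logShift {ρ : ℝ} {G : ℂ → ℂ} (τ : ℝ)
    (hG : DifferentiableOn ℂ G (Ioo (-ρ) ρ ×ℂ Ioo 0 ρ)) :
    DifferentiableOn ℂ (logShift G τ)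
      ((fun w => Complex.exp w + τ * Complex.I) ⁻¹' (Ioo (-ρ) ρ ×ℂ Ioo 0 ρ)) :=
  hG.comp (t := Ioo (-ρ) ρ ×ℂ Ioo 0 ρ) (by fun_prop) fun _ hw => hw

variable {ρ a : ℝ} {G : ℂ → ℂ} {N : ℕ} {A ℓ : ℝ}

lemma exp_shift_re (w : ℂ) (v τ : ℝ) : (Complex.exp (w + v) + τ * Complex.I).re =
    Real.exp (w.re + v) * Real.cos w.im := by
  simp [Complex.exp_re]

lemma exp_shift_im (w : ℂ) (v τ : ℝ) : (Complex.exp (w + v) + τ * Complex.I).im =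
    Real.exp (w.re + v) * Real.sin w.im + τ := by
  simp [Complex.exp_im]

/-- The `1` in `ℓ + 1` leaves room for kernels supported in `[-1, 1]`; the exponential and the shift
each use up `a / 4`. -/
lemma exp_shift_bounds (hℓ : Real.exp (ℓ + 1) ≤ a / 4) {w : ℂ} {v τ : ℝ}
    (hw : w.re ≤ ℓ) (hv : v ∈ Icc (-1 : ℝ) 1) (hτ : τ ≤ a / 4) :
    |(Complex.exp (w + v) + τ * Complex.I).re| ≤ a / 2 ∧
      (Complex.exp (w + v) + τ * Complex.I).im ≤ a / 2 := by
  have h0 := Real.exp_pos (w.re + v)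
  have h1 : Real.exp (w.re + v) ≤ a / 4 :=
    (Real.exp_le_exp.2 (by linarith [hv.2])).trans hℓ
  rw [exp_shift_re, exp_shift_im]
  constructor
  · rw [abs_mul, abs_of_pos h0]
    nlinarith [Real.abs_cos_le_one w.im, abs_nonneg (Real.cos w.im)]
  · nlinarith [Real.sin_le_one w.im]

lemma SlowGrowth.mem (H : SlowGrowth ρ a G N A) {z : ℂ} (h1 : |z.re| ≤ a / 2) (h2 : 0 < z.im)
    (h3 : z.im ≤ a / 2) : z ∈ Ioo (-ρ) ρ ×ℂ Ioo 0 ρ := by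
  have h4 := abs_le.1 h1
  have := H.pos
  have := H.lt
  exact ⟨⟨by linarith, by linarith⟩, ⟨h2, by linarith⟩⟩

lemma SlowGrowth.mem_domain (H : SlowGrowth ρ a G N A) (hℓ : Real.exp (ℓ + 1) ≤ a / 4) {w : ℂ}
    {v τ : ℝ} (hw : w.re ≤ ℓ) (hv : v ∈ Icc (-1 : ℝ) 1) (hτ : τ ≤ a / 4)
    (hpos : 0 < Real.exp (w.re + v) * Real.sin w.im + τ) :
    w + v ∈ (fun w => Complex.exp w + τ * Complex.I) ⁻¹' (Ioo (-ρ) ρ ×ℂ Ioo 0 ρ) := by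
  obtain ⟨h1, h2⟩ := exp_shift_bounds hℓ hw hv hτ
  exact H.mem h1 (by rwa [exp_shift_im]) h2

lemma SlowGrowth.norm_logShift_le (H : SlowGrowth ρ a G N A) (hℓ : Real.exp (ℓ + 1) ≤ a / 4)
    {w : ℂ} {v τ q : ℝ} (hw : w.re ≤ ℓ) (hv : v ∈ Icc (-1 : ℝ) 1) (hτ : τ ≤ a / 4) (hq : 0 < q)
    (hpos : q ≤ Real.exp (w.re + v) * Real.sin w.im + τ) :
    ‖logShift G τ (w + v)‖ ≤ A / q ^ N := by
  obtain ⟨h1, h2⟩ := exp_shift_bounds hℓ hw hv hτ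
  have h3 : q ≤ (Complex.exp (w + v) + τ * Complex.I).im := by rwa [exp_shift_im]
  refine (H.bound _ h1 (hq.trans_le h3) h2).trans ?_
  have := H.nonneg
  gcongr

lemma exp_mul_sin_le {w : ℂ} {v : ℝ} (hv : v ∈ Icc (-1 : ℝ) 1) (h0 : 0 ≤ w.im)
    (h1 : w.im ≤ Real.pi) :
    Real.exp (w.re - 1) * Real.sin w.im ≤ Real.exp (w.re + v) * Real.sin w.im := by
  have := Real.sin_nonneg_of_nonneg_of_le_pi h0 h1
  gcongr
  linarith [hv.1]

lemma tendsto_exp_neg_sq_sub_atBot (u K : ℝ) :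
    Tendsto (fun s : ℝ => Real.exp (-(s - u) ^ 2 - K * s)) atBot (𝓝 0) := by
  have h : Tendsto (fun s : ℝ => Real.exp (s + ((K + 1) ^ 2 / 4 - (K + 1) * u))) atBot (𝓝 0) :=
    Real.tendsto_exp_atBot.comp (tendsto_atBot_add_const_right _ _ tendsto_id)
  refine squeeze_zero (fun s => (Real.exp_pos _).le) (fun s => Real.exp_le_exp.2 ?_) h
  nlinarith [sq_nonneg (s - u + (K + 1) / 2)]

/-- The weight used in the maximum principle. -/
def stripWeight (ℓ u lam : ℝ) (N : ℕ) (w : ℂ) : ℂ :=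
  (1 - Complex.exp (2 * (w - ℓ))) ^ N * Complex.exp (-(w - u) ^ 2 + lam * Complex.I * w)

/-- Role of the factors: `1 - exp (2 (w - ℓ))` vanishes at the corners `ℓ` and `ℓ + iπ`, and its
`N`-th power cancels the growth of `G` there. The Gaussian localizes at `Re w = u` and gives decay
at `-∞`. The factor `exp (-lam Im w)` discounts the upper side, where only boundedness is known. -/
lemma norm_stripWeight (ℓ u lam : ℝ) (N : ℕ) (w : ℂ) : ‖stripWeight ℓ u lam N w‖ =
    ‖1 - Complex.exp (2 * (w - ℓ))‖ ^ N *
      Real.exp (-(w.re - u) ^ 2 + w.im ^ 2 - lam * w.im) := by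
  rw [stripWeight, norm_mul, norm_pow, Complex.norm_exp]
  congr 2
  simp [pow_two]
  ring

lemma norm_one_sub_exp_of_real {ℓ s k : ℝ} (hs : s ≤ ℓ) {w : ℂ} (hw : w = s + k * Complex.I)
    (hk : Complex.exp (2 * (k * Complex.I)) = 1) :
    ‖1 - Complex.exp (2 * (w - ℓ))‖ ≤ 1 := by
  have h1 : Complex.exp (2 * (w - ℓ)) = (Real.exp (2 * (s - ℓ)) : ℝ) := by
    rw [hw, show (2 : ℂ) * (s + k * Complex.I - ℓ) = 2 * (s - ℓ) + 2 * (k * Complex.I) by ring,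
      Complex.exp_add, hk, mul_one]
    push_cast
    rfl
  rw [h1, ← Complex.ofReal_one, ← Complex.ofReal_sub, Complex.norm_real, Real.norm_eq_abs, abs_le]
  have h2 : Real.exp (2 * (s - ℓ)) ≤ 1 := Real.exp_le_one_iff.2 (by linarith)
  constructor <;> linarith [Real.exp_pos (2 * (s - ℓ))]

/-- For `τ > 0` the function `G (exp w + iτ)` is analytic across the closed sides, so the classical
maximum principle applies to a long rectangle. The bound `S` does not involve the crude bound `A / τ
^ N`, which only serves to dispose of the far left side. -/
lemma SlowGrowth.maximum_principle (H : SlowGrowth ρ a G N A) (hℓ : Real.exp (ℓ + 1) ≤ a / 4)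
    {φ : ℝ → ℝ} (hφ : IsTest (Icc (-1) 1) φ) {τ u lam S : ℝ} (hτ0 : 0 < τ) (hτ : τ ≤ a / 4)
    (hlam : 0 ≤ lam)
    (hbot : ∀ s ≤ ℓ, ‖lineInt (logShift G τ) φ s‖ * Real.exp (-(s - u) ^ 2) ≤ S)
    (htop : ∀ s ≤ ℓ, ‖lineInt (logShift G τ) φ (s + Real.pi * Complex.I)‖ *
      Real.exp (Real.pi ^ 2 - lam * Real.pi) * Real.exp (-(s - u) ^ 2) ≤ S)
    (harc : A * 2 ^ N / Real.exp (ℓ - 1) ^ N * (∫ v, |φ v|) *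
      Real.exp (Real.pi ^ 2 - (ℓ - u) ^ 2) ≤ S)
    {w : ℂ} (hw : w.re ≤ ℓ) (hw0 : 0 < w.im) (hwpi : w.im < Real.pi) :
    ‖lineInt (logShift G τ) φ w‖ * ‖stripWeight ℓ u lam N w‖ ≤ S := by
  have hpi := Real.pi_pos
  set M := ∫ v, |φ v| with hM
  have hM0 : 0 ≤ M := integral_nonneg fun v => abs_nonneg _
  have hS : 0 ≤ S := le_trans (by positivity) (hbot ℓ le_rfl)
  have hA := H.nonneg
  -- a crude bound, uniform in the closed strip
  have hcrude : ∀ z : ℂ, z.re ≤ ℓ → 0 ≤ z.im → z.im ≤ Real.pi →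
      ‖lineInt (logShift G τ) φ z‖ ≤ A / τ ^ N * M := by
    intro z hz h0 h1
    refine norm_lineInt_le hφ.continuous hφ.2 fun v hv => ?_
    refine H.norm_logShift_le hℓ hz (hφ.3 hv) hτ hτ0 ?_
    have := Real.sin_nonneg_of_nonneg_of_le_pi h0 h1
    have := mul_nonneg (Real.exp_pos (z.re + v)).le this
    linarith
  have hdiff : ∀ z : ℂ, z.re ≤ ℓ → 0 ≤ z.im → z.im ≤ Real.pi →
      DifferentiableAt ℂ (lineInt (logShift G τ) φ) z := by
    intro z hz h0 h1
    refine (hasDerivAt_lineInt (isOpen_logShift_domain ρ τ) (differentiableOn_logShift τ H.diff)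
      (hφ.1.of_le (by simp)) hφ.2 fun v hv => ?_).differentiableAt
    refine H.mem_domain hℓ hz (hφ.3 hv) hτ ?_
    have := Real.sin_nonneg_of_nonneg_of_le_pi h0 h1
    have := mul_nonneg (Real.exp_pos (z.re + v)).le this
    linarith
  have hlim := (tendsto_exp_neg_sq_sub_atBot u 0).const_mul
    (A / τ ^ N * M * (2 ^ N * Real.exp (Real.pi ^ 2)))
  rw [mul_zero] at hlim
  refine le_of_forall_pos_le_add fun δ hδ => ?_
  -- The left side is placed so far out that the Gaussian pushes even the `τ`-dependent bound below
  -- `δ`.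
  obtain ⟨s₁, hs₁, hs₁w⟩ := ((hlim.eventually (gt_mem_nhds hδ)).and
    (eventually_lt_atBot w.re)).exists
  have hs₁ℓ : s₁ < ℓ := hs₁w.trans_le hw
  have hcl : closure (Ioo s₁ ℓ ×ℂ Ioo 0 Real.pi) = Icc s₁ ℓ ×ℂ Icc 0 Real.pi := by
    rw [Complex.closure_reProdIm, closure_Ioo hs₁ℓ.ne, closure_Ioo hpi.ne]
  have hbdd : Bornology.IsBounded (Ioo s₁ ℓ ×ℂ Ioo 0 Real.pi) :=
    (isCompact_Icc.reProdIm isCompact_Icc).isBounded.subset (hcl ▸ subset_closure)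
  rw [← norm_mul]
  refine Complex.norm_le_of_forall_mem_frontier_norm_le hbdd
    (f := fun z => lineInt (logShift G τ) φ z * stripWeight ℓ u lam N z) ?_ ?_
    (z := w) (hcl ▸ ⟨⟨hs₁w.le, hw⟩, ⟨hw0.le, hwpi.le⟩⟩)
  · refine DifferentiableOn.diffContOnCl fun z hz => ?_
    rw [hcl] at hz
    refine ((hdiff z hz.1.2 hz.2.1 hz.2.2).mul ?_).differentiableWithinAt
    unfold stripWeight
    fun_prop
  · intro z hz
    have hz' : z ∈ Icc s₁ ℓ ×ℂ Icc 0 Real.pi := hcl ▸ frontier_subset_closure hz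
    rw [Complex.frontier_reProdIm, frontier_Ioo hpi, frontier_Ioo hs₁ℓ] at hz
    obtain ⟨⟨hz1, hz2⟩, hz3, hz4⟩ := hz'
    rw [norm_mul, norm_stripWeight]
    have hpow1 : ∀ x : ℝ, 0 ≤ x → x ≤ 1 → ∀ p q : ℝ, 0 ≤ p → 0 ≤ q → p * (x ^ N * q) ≤ p * q := by
      intro x h0 h1 p q hp hq
      have : x ^ N ≤ 1 := pow_le_one₀ h0 h1
      exact mul_le_mul_of_nonneg_left (mul_le_of_le_one_left hq this) hp
    rcases hz3.eq_or_lt with h0 | h0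
    · have hzr : z = (z.re : ℂ) := by
        apply Complex.ext <;> simp [← h0]
      have h1 : ‖1 - Complex.exp (2 * (z - ℓ))‖ ≤ 1 :=
        norm_one_sub_exp_of_real (k := 0) hz2 (by simpa using hzr) (by simp)
      refine (hpow1 _ (norm_nonneg _) h1 _ _ (norm_nonneg _) (Real.exp_pos _).le).trans ?_
      have h2 := hbot z.re hz2
      rw [← hzr] at h2
      rw [← h0, show -(z.re - u) ^ 2 + (0 : ℝ) ^ 2 - lam * 0 = -(z.re - u) ^ 2 by ring]
      linarith
    rcases hz4.eq_or_lt with h3 | h3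
    · have hzr : z = (z.re : ℂ) + Real.pi * Complex.I := by
        apply Complex.ext <;> simp [h3]
      have h1 : ‖1 - Complex.exp (2 * (z - ℓ))‖ ≤ 1 :=
        norm_one_sub_exp_of_real (k := Real.pi) hz2 hzr (by
          rw [← mul_assoc, Complex.exp_two_pi_mul_I])
      refine (hpow1 _ (norm_nonneg _) h1 _ _ (norm_nonneg _) (Real.exp_pos _).le).trans ?_
      have h2 := htop z.re hz2
      rw [← hzr, mul_assoc, ← Real.exp_add] at h2
      rw [h3, show -(z.re - u) ^ 2 + Real.pi ^ 2 - lam * Real.pi =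
        Real.pi ^ 2 - lam * Real.pi + -(z.re - u) ^ 2 by ring]
      linarith
    have him2 : z.im ^ 2 - lam * z.im ≤ Real.pi ^ 2 := by
      have := mul_nonneg hlam h0.le
      nlinarith
    have hre : z.re = s₁ ∨ z.re = ℓ := by
      rcases hz with hz | hz
      · rcases hz.2 with h | h
        · exact absurd h h0.ne'
        · exact absurd h h3.ne
      · exact hz.1
    rcases hre with hre | hre
    · have h1 : ‖1 - Complex.exp (2 * (z - ℓ))‖ ≤ 2 := by
        refine (norm_sub_le _ _).trans ?_
        rw [norm_one, Complex.norm_exp]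
        have : Real.exp ((2 * (z - ℓ)).re) ≤ 1 := by
          rw [Real.exp_le_one_iff]
          simp
          linarith
        linarith
      have h2 := hcrude z hz2 h0.le h3.le
      calc _ ≤ A / τ ^ N * M * (2 ^ N * Real.exp (Real.pi ^ 2 + (-(s₁ - u) ^ 2 - 0 * s₁))) := by
            gcongr
            rw [hre]
            linarith
        _ = A / τ ^ N * M * (2 ^ N * Real.exp (Real.pi ^ 2)) *
            Real.exp (-(s₁ - u) ^ 2 - 0 * s₁) := by rw [Real.exp_add]; ring
        _ ≤ S + δ := by linarith
    · have hsin := Real.sin_pos_of_pos_of_lt_pi h0 h3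
      -- On the side `Re z = ℓ` the corner factor is exactly `2 sin (Im z)`, and the imaginary part
      -- of the argument of `G` is at least `exp (ℓ - 1) sin (Im z)`; the powers of the sine cancel.
      have h1 : ‖1 - Complex.exp (2 * (z - ℓ))‖ = 2 * Real.sin z.im := by
        have h4 : (1 : ℂ) - Complex.exp (2 * (z - ℓ)) =
            Complex.exp (z.im * Complex.I) * (-2 * Complex.sin z.im * Complex.I) := by
          have h5 : 2 * (z - ℓ) = z.im * Complex.I + z.im * Complex.I := by
            apply Complex.ext
            · simp [hre]
            · simp
              ring
          rw [h5, Complex.exp_add, Complex.sin]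
          have h6 : Complex.exp (z.im * Complex.I) * Complex.exp (-z.im * Complex.I) = 1 := by
            rw [← Complex.exp_add]
            simp
          linear_combination (-1 : ℂ) * h6 + (Complex.exp (z.im * Complex.I) * Complex.exp (-z.im * Complex.I) - Complex.exp (z.im * Complex.I) ^ 2) * Complex.I_sq
        rw [h4, norm_mul, Complex.norm_exp_ofReal_mul_I, one_mul, norm_mul, norm_mul,
          ← Complex.ofReal_sin, Complex.norm_real, Complex.norm_I, Real.norm_eq_abs,
          abs_of_pos hsin]
        simp
      have h2 : ‖lineInt (logShift G τ) φ z‖ ≤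
          A / (Real.exp (ℓ - 1) * Real.sin z.im) ^ N * M := by
        refine norm_lineInt_le hφ.continuous hφ.2 fun v hv => ?_
        refine H.norm_logShift_le hℓ hz2 (hφ.3 hv) hτ (by positivity) ?_
        have := exp_mul_sin_le (w := z) (hφ.3 hv) h0.le h3.le
        rw [hre] at this ⊢
        linarith
      rw [h1, hre]
      calc _ ≤ A / (Real.exp (ℓ - 1) * Real.sin z.im) ^ N * M *
            ((2 * Real.sin z.im) ^ N * Real.exp (Real.pi ^ 2 - (ℓ - u) ^ 2)) := by
            have h5 : -(ℓ - u) ^ 2 + z.im ^ 2 - lam * z.im ≤ Real.pi ^ 2 - (ℓ - u) ^ 2 := by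
              linarith
            exact mul_le_mul h2 (mul_le_mul_of_nonneg_left (Real.exp_le_exp.2 h5) (by positivity))
              (by positivity) (by positivity)
        _ = A * 2 ^ N / Real.exp (ℓ - 1) ^ N * M * Real.exp (Real.pi ^ 2 - (ℓ - u) ^ 2) := by
            rw [mul_pow, mul_pow]
            field_simp
        _ ≤ S + δ := by linarith

end

section

/-! ### Passage to the boundary -/

/-- Pointwise convergence on a half line improves to convergence of weighted suprema, in the
presence of locally uniform bounds for the functions and their derivatives. -/
lemma eventually_forall_weighted_le {f f' : ℝ → ℝ → ℂ} {v : ℝ → ℂ} {W : ℝ → ℝ} {ℓ K B B' S ε : ℝ}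
    {l : Filter ℝ} {P : Set ℝ} (hP : P ∈ l) (hε : 0 < ε) (hW : Continuous W) (hW0 : ∀ s, 0 ≤ W s)
    (hWlim : Tendsto (fun s => Real.exp (-K * s) * W s) atBot (𝓝 0)) (hK : 0 ≤ K) (hB' : 0 ≤ B')
    (hS : 0 ≤ S)
    (hb : ∀ τ ∈ P, ∀ s ≤ ℓ, ‖f τ s‖ ≤ B * Real.exp (-K * s))
    (hd : ∀ τ ∈ P, ∀ s ≤ ℓ, HasDerivAt (f τ) (f' τ s) s)
    (hb' : ∀ τ ∈ P, ∀ s ≤ ℓ, ‖f' τ s‖ ≤ B' * Real.exp (-K * s))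
    (hlim : ∀ s ≤ ℓ, Tendsto (fun τ => f τ s) l (𝓝 (v s)))
    (hv : ∀ s ≤ ℓ, ‖v s‖ * W s ≤ S) :
    ∀ᶠ τ in l, ∀ s ≤ ℓ, ‖f τ s‖ * W s ≤ S + ε := by
  have h1 := hWlim.const_mul B
  rw [mul_zero] at h1
  -- To the left of `s₁` the uniform bound on `f τ` times the weight is already below `ε`; only a
  -- compact interval needs the pointwise limits.
  obtain ⟨s₁, hs₁⟩ := (h1.eventually (gt_mem_nhds hε)).exists_forall_of_atBot
  have hcpt : ∀ᶠ τ in l, ∀ s ∈ Icc s₁ ℓ, ‖f τ s‖ * W s ≤ S + ε := by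
    refine isCompact_Icc.induction_on (p := fun t => ∀ᶠ τ in l, ∀ s ∈ t, ‖f τ s‖ * W s ≤ S + ε)
      (by simp) (fun s t hst ht => ht.mono fun τ h x hx => h x (hst hx))
      (fun s t hs ht => by
        filter_upwards [hs, ht] with τ h1 h2 x hx
        exact hx.elim (h1 x) (h2 x)) fun x hx => ?_
    set M := B' * Real.exp (-K * s₁) with hM
    have hlip : ∀ τ ∈ P, ∀ s ∈ Icc s₁ ℓ, ‖f τ s‖ ≤ ‖f τ x‖ + M * |s - x| := by
      intro τ hτ s hs
      have h2 := (convex_Icc s₁ ℓ).norm_image_sub_le_of_norm_hasDerivWithin_le (f := f τ) (C := M)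
        (fun y hy => (hd τ hτ y hy.2).hasDerivWithinAt) (fun y hy => (hb' τ hτ y hy.2).trans (by
          have : -K * y ≤ -K * s₁ := by nlinarith [hy.1]
          rw [hM]
          gcongr)) hx hs
      have h3 := norm_sub_norm_le (f τ s) (f τ x)
      rw [Real.norm_eq_abs] at h2
      linarith
    -- Joint continuity in the error at `x` and in the position yields a neighbourhood of `x` and a
    -- tolerance at once; the Lipschitz bound transports the limit from `x` to that neighbourhood.
    have hcont : Tendsto (fun p : ℝ × ℝ => (‖v x‖ + p.1 + M * |p.2 - x|) * W p.2) (𝓝 (0, x))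
        (𝓝 ((‖v x‖ + 0 + M * |x - x|) * W x)) := by
      have : Continuous fun p : ℝ × ℝ => (‖v x‖ + p.1 + M * |p.2 - x|) * W p.2 := by fun_prop
      exact this.tendsto (0, x)
    have h4 := hcont.eventually (gt_mem_nhds (show _ < S + ε by
      have := hv x hx.2
      simp
      linarith))
    rw [nhds_prod_eq] at h4
    obtain ⟨pa, hpa, pb, hpb, hpp⟩ := eventually_prod_iff.1 h4
    obtain ⟨δ, hδ, hδs⟩ := Metric.eventually_nhds_iff.1 hpa
    refine ⟨Icc s₁ ℓ ∩ {y | pb y}, inter_mem self_mem_nhdsWithin (mem_nhdsWithin_of_mem_nhds hpb),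
      ?_⟩
    have h5 := (hlim x hx.2).norm.eventually (gt_mem_nhds (show ‖v x‖ < ‖v x‖ + δ / 2 by linarith))
    filter_upwards [h5, hP] with τ h6 hτ s hs
    have h7 := hpp (x := δ / 2) (hδs (by
      rw [Real.dist_eq, sub_zero, abs_of_pos (by linarith)]; linarith)) hs.2
    refine le_trans (mul_le_mul_of_nonneg_right ((hlip τ hτ s hs.1).trans ?_) (hW0 s)) h7.le
    linarith
  filter_upwards [hcpt, hP] with τ h2 hτ s hs
  rcases le_or_gt s₁ s with h3 | h3
  · exact h2 s ⟨h3, hs⟩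
  · refine (mul_le_mul_of_nonneg_right (hb τ hτ s hs) (hW0 s)).trans ?_
    have := hs₁ s h3.le
    linarith

/-! ### Finite order of the line integrals and the sides of the strip -/

variable {ρ a : ℝ} {G : ℂ → ℂ} {L : (ℝ → ℝ) → ℂ} {n N : ℕ} {h : ℝ → ℂ} {A C ℓ : ℝ}

/-- A bound for the integrals along horizontal lines by finitely many derivatives. -/
def UniformOrder (a : ℝ) (G : ℂ → ℂ) (N : ℕ) (A : ℝ) : Prop :=
  ∀ y ∈ Ioc 0 a, ∀ φ, IsTest (Icc (-a) a) φ → ∀ M,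
    (∀ j ≤ N, ∀ x, |iteratedDeriv j φ x| ≤ M) → ‖lineInt G φ (y * Complex.I)‖ ≤ A * M

lemma exists_bound_iteratedDeriv {S : Set ℝ} {φ : ℝ → ℝ} (hφ : IsTest S φ) (N : ℕ) :
    ∃ B, 0 ≤ B ∧ ∀ j ≤ N, ∀ x, |iteratedDeriv j φ x| ≤ B := by
  have h1 : ∀ j, ∃ B, 0 ≤ B ∧ ∀ x, |iteratedDeriv j φ x| ≤ B := by
    intro j
    have h2 : IsTest S (iteratedDeriv j φ) := by
      rw [iteratedDeriv_eq_iterate]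
      exact IsTest.iterate (fun _ hf => hf.deriv) j hφ
    obtain ⟨B, hB⟩ := h2.2.exists_bound_of_continuous h2.continuous
    exact ⟨B, (norm_nonneg _).trans (hB 0), hB⟩
  choose B hB0 hB using h1
  refine ⟨∑ j ∈ Finset.range (N + 1), B j, Finset.sum_nonneg fun j _ => hB0 j,
    fun j hj x => (hB j x).trans ?_⟩
  exact Finset.single_le_sum (f := B) (fun j _ => hB0 j) (Finset.mem_range.2 (by omega))

/-- Up to `N` derivatives of a dilated kernel cost `|c|⁻¹ ^ N`, and the `L¹` normalization costs one
further power. -/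
lemma UniformOrder.exists_bound_dil (hU : UniformOrder a G N A) (hA : 0 ≤ A) {φ : ℝ → ℝ}
    (hφ : IsTest (Icc (-1) 1) φ) :
    ∃ B, 0 ≤ B ∧ ∀ c : ℝ, c ≠ 0 → |c| ≤ 1 → |c| * Real.exp 1 ≤ a → ∀ y ∈ Ioc 0 a,
      ‖lineInt G (dil (expLift φ) c) (y * Complex.I)‖ ≤ B * |c|⁻¹ ^ (N + 1) := by
  have hψ := isTest_expLift hφ
  obtain ⟨B, hB0, hB⟩ := exists_bound_iteratedDeriv hψ N
  refine ⟨A * B, by positivity, fun c hc hc1 hca y hy => ?_⟩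
  have hcpos := abs_pos.2 hc
  rw [mul_assoc]
  refine hU y hy _ (isTest_dil hc hψ fun x hx => ?_) _ fun j hj x => ?_
  · have hx0 : 0 < x := (Real.exp_pos _).trans_le hx.1
    refine abs_le.1 ?_
    rw [abs_mul, abs_of_pos hx0]
    exact (mul_le_mul_of_nonneg_left hx.2 hcpos.le).trans hca
  · have h1 := iteratedDeriv_comp_sub_div hψ.1 j 0 c x
    simp only [sub_zero] at h1
    unfold dil
    rw [iteratedDeriv_const_mul_field, h1, abs_mul, abs_mul, abs_inv, abs_abs, abs_pow, abs_inv,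
      pow_succ']
    have h2 : (1 : ℝ) ≤ |c|⁻¹ := (one_le_inv₀ hcpos).2 hc1
    calc _ ≤ |c|⁻¹ * (|c|⁻¹ ^ N * B) := by
          gcongr
          exact hB j hj _
      _ = _ := by ring

lemma BoundaryData.exists_slowGrowth (D : BoundaryData ρ G L n h C) :
    ∃ a ≤ (1 : ℝ), ∃ N A N' A', 0 ≤ A' ∧ SlowGrowth ρ a G N A ∧ UniformOrder a G N' A' := by
  have hlim : ∀ φ, IsTest (Ioo (-ρ) ρ) φ →
      ∃ l, Tendsto (fun y : ℝ => lineInt G φ (y * Complex.I)) (𝓝[>] 0) (𝓝 l) :=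
    fun φ hφ => ⟨_, D.tendsto φ hφ⟩
  have hρ := D.pos
  have ha1 : min (ρ / 2) 1 ≤ 1 := min_le_right _ _
  have haρ : min (ρ / 2) 1 < ρ := (min_le_left _ _).trans_lt (by linarith)
  obtain ⟨N, A, hA, hb⟩ := exists_pow_bound ha1 haρ D.diff hlim
  obtain ⟨N', A', hA', hb'⟩ := exists_uniform_bound_lineInt haρ D.diff.continuousOn hlim
  exact ⟨min (ρ / 2) 1, ha1, N, A, N', A', hA', ⟨lt_min (by linarith) one_pos, haρ, hA, D.diff, hb⟩,
    hb'⟩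

/-- The two sides of the half strip in logarithmic coordinates. -/
lemma exp_side {k σ : ℝ} (hk : Complex.exp (k * Complex.I) = σ) (s : ℝ) :
    Complex.exp (s + k * Complex.I) = ((σ * Real.exp s : ℝ) : ℂ) := by
  rw [Complex.exp_add, hk]
  push_cast
  ring

/-- Serves both sides: `k = 0`, `σ = 1` below and `k = π`, `σ = -1` above. Convergence as `τ → 0` is
known only pointwise in `s`; bounds of size `exp (-(N' + 1) s)` for the integrals and their
derivatives, beaten by the Gaussian, make it uniform in the weighted sense. -/
lemma BoundaryData.eventually_side_le {N' : ℕ} {A' : ℝ} (D : BoundaryData ρ G L n h C)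
    (H : SlowGrowth ρ a G N A) (ha1 : a ≤ 1) (hA' : 0 ≤ A') (hU : UniformOrder a G N' A')
    (hℓ : Real.exp (ℓ + 1) ≤ a / 4)
    {φ : ℝ → ℝ} (hφ : IsTest (Icc (-1) 1) φ) {k σ : ℝ} (hk : Complex.exp (k * Complex.I) = σ)
    (hσ : |σ| = 1) (hsin : Real.sin k = 0) {u c S ε : ℝ} (hε : 0 < ε) (hc : 0 ≤ c) (hS : 0 ≤ S)
    (hv : ∀ s ≤ ℓ, ‖L (dil (expLift φ) (σ * Real.exp s))‖ * (c * Real.exp (-(s - u) ^ 2)) ≤ S) :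
    ∀ᶠ τ in 𝓝[>] (0 : ℝ), ∀ s ≤ ℓ, ‖lineInt (logShift G τ) φ (s + k * Complex.I)‖ *
      (c * Real.exp (-(s - u) ^ 2)) ≤ S + ε := by
  have ha := H.pos
  obtain ⟨B, hB0, hB⟩ := hU.exists_bound_dil hA' hφ
  obtain ⟨B', hB'0, hB'⟩ := hU.exists_bound_dil hA' hφ.deriv
  have hne : ∀ s, σ * Real.exp s ≠ 0 := fun s => by
    have : σ ≠ 0 := by
      rintro rfl
      simp at hσ
    exact mul_ne_zero this (Real.exp_pos s).ne'
  have habs : ∀ s, |σ * Real.exp s| = Real.exp s := fun s => by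
    rw [abs_mul, hσ, one_mul, abs_of_pos (Real.exp_pos s)]
  have hsize : ∀ s ≤ ℓ, Real.exp s * Real.exp 1 ≤ a / 4 := fun s hs => by
    rw [← Real.exp_add]
    exact (Real.exp_le_exp.2 (by linarith)).trans hℓ
  have hone : ∀ s ≤ ℓ, Real.exp s ≤ 1 := fun s hs => by
    have h1 := hsize s hs
    have h2 := Real.add_one_le_exp (1 : ℝ)
    nlinarith [Real.exp_pos s]
  have hpow : ∀ s : ℝ, (Real.exp s)⁻¹ ^ (N' + 1) = Real.exp (-(N' + 1 : ℝ) * s) := fun s => by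
    rw [← Real.exp_neg, ← Real.exp_nat_mul]
    congr 1
    push_cast
    ring
  have hb : ∀ {φ B}, (∀ c : ℝ, c ≠ 0 → |c| ≤ 1 → |c| * Real.exp 1 ≤ a → ∀ y ∈ Ioc 0 a,
      ‖lineInt G (dil (expLift φ) c) (y * Complex.I)‖ ≤ B * |c|⁻¹ ^ (N' + 1)) →
      ∀ τ ∈ Ioc 0 (a / 4), ∀ s ≤ ℓ, ‖lineInt (logShift G τ) φ (s + k * Complex.I)‖ ≤
        B * Real.exp (-(N' + 1 : ℝ) * s) := by
    intro φ B hB τ hτ s hs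
    have h1 := hB (σ * Real.exp s) (hne s) (by rw [habs]; exact hone s hs)
      (by rw [habs]; linarith [hsize s hs]) τ ⟨hτ.1, by linarith [hτ.2]⟩
    rw [habs, hpow, ← lineInt_exp G φ τ (hne s) (exp_side hk s)] at h1
    exact h1
  refine eventually_forall_weighted_le (f := fun τ s => lineInt (logShift G τ) φ (s + k * Complex.I))
    (f' := fun τ s => -lineInt (logShift G τ) (deriv φ) (s + k * Complex.I))
    (v := fun s => L (dil (expLift φ) (σ * Real.exp s)))
    (W := fun s => c * Real.exp (-(s - u) ^ 2)) (K := N' + 1) (B := B) (B' := B')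
    (P := Ioc 0 (a / 4)) (Ioc_mem_nhdsGT (by linarith)) hε (by fun_prop)
    (fun s => by positivity) ?_ (by positivity) hB'0 hS (hb hB) ?_ ?_ ?_ hv
  · have h1 := (tendsto_exp_neg_sq_sub_atBot u (N' + 1)).const_mul c
    rw [mul_zero] at h1
    refine h1.congr fun s => ?_
    rw [mul_left_comm, ← Real.exp_add]
    congr 2
    ring
  · intro τ hτ s hs
    have hmem : ∀ v ∈ tsupport φ, ((s : ℂ) + k * Complex.I) + v ∈
        (fun w => Complex.exp w + τ * Complex.I) ⁻¹' (Ioo (-ρ) ρ ×ℂ Ioo 0 ρ) := fun v hv => by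
      refine H.mem_domain hℓ (by simpa using hs) (hφ.3 hv) hτ.2 ?_
      simpa [hsin] using hτ.1
    have h1 := hasDerivAt_lineInt (isOpen_logShift_domain ρ τ) (differentiableOn_logShift τ H.diff)
      (hφ.1.of_le (by simp)) hφ.2 hmem
    exact (h1.comp_add_const (s : ℂ) (k * Complex.I)).comp_ofReal
  · intro τ hτ s hs
    rw [norm_neg]
    exact hb hB' τ hτ s hs
  · intro s hs
    refine D.tendsto_lineInt_exp hφ (hne s) ?_ (exp_side hk s)
    rw [habs]
    linarith [hsize s hs, H.lt]

end

/-! ### Bounds and decay of the smoothed function in the half strip -/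

section

variable {ρ a : ℝ} {G : ℂ → ℂ} {L : (ℝ → ℝ) → ℂ} {n N : ℕ} {h : ℝ → ℂ} {A C ℓ : ℝ}

lemma SlowGrowth.tendsto_lineInt_logShift (H : SlowGrowth ρ a G N A)
    (hℓ : Real.exp (ℓ + 1) ≤ a / 4) {φ : ℝ → ℝ} (hφ : IsTest (Icc (-1) 1) φ) {w : ℂ}
    (hw : w.re ≤ ℓ) (hw0 : 0 < w.im) (hwpi : w.im < Real.pi) :
    Tendsto (fun τ => lineInt (logShift G τ) φ w) (𝓝[>] 0) (𝓝 (lineInt (logShift G 0) φ w)) := by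
  have ha := H.pos
  have hsin := Real.sin_pos_of_pos_of_lt_pi hw0 hwpi
  set q := Real.exp (w.re - 1) * Real.sin w.im with hq
  have hq0 : 0 < q := by positivity
  have hle : ∀ v ∈ Icc (-1 : ℝ) 1, q ≤ Real.exp (w.re + v) * Real.sin w.im := fun v hv =>
    exp_mul_sin_le hv hw0.le hwpi.le
  have hev : ∀ᶠ τ in 𝓝[>] (0 : ℝ), τ ∈ Ioc 0 (a / 4) := Ioc_mem_nhdsGT (by linarith)
  refine tendsto_integral_filter_of_dominated_convergence (fun v => A / q ^ N * |φ v|) ?_ ?_ ?_ ?_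
  · filter_upwards [hev] with τ hτ
    refine (continuous_lineInt_integrand (isOpen_logShift_domain ρ τ)
      (differentiableOn_logShift τ H.diff).continuousOn hφ.continuous fun v hv => ?_).aestronglyMeasurable
    refine H.mem_domain hℓ hw (hφ.3 hv) hτ.2 ?_
    linarith [hle v (hφ.3 hv), hτ.1]
  · filter_upwards [hev] with τ hτ
    refine ae_of_all _ fun v => ?_
    by_cases hv : v ∈ tsupport φ
    · rw [norm_mul, Complex.norm_real, mul_comm, Real.norm_eq_abs]
      refine mul_le_mul_of_nonneg_right ?_ (abs_nonneg _)
      exact H.norm_logShift_le hℓ hw (hφ.3 hv) hτ.2 hq0 (by linarith [hle v (hφ.3 hv), hτ.1])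
    · simp [image_eq_zero_of_notMem_tsupport hv]
  · exact (hφ.continuous.abs.integrable_of_hasCompactSupport hφ.2.abs).const_mul _
  · refine ae_of_all _ fun v => ?_
    by_cases hv : v ∈ tsupport φ
    · refine Tendsto.const_mul _ ?_
      have hmem := H.mem_domain (v := v) (τ := 0) hℓ hw (hφ.3 hv) (by linarith)
        (by linarith [hle v (hφ.3 hv)])
      have h1 : ContinuousAt G (Complex.exp (w + v) + (0 : ℝ) * Complex.I) :=
        H.diff.continuousOn.continuousAt ((isOpen_rect ρ).mem_nhds hmem)
      have h2 : ContinuousAt (fun τ : ℝ => Complex.exp (w + v) + τ * Complex.I) 0 := by fun_prop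
      exact (h1.comp_of_eq h2 rfl).tendsto.mono_left nhdsWithin_le_nhds
    · simp [image_eq_zero_of_notMem_tsupport hv]

/-- The limit `τ → 0` in the maximum principle: the side conditions now concern `L` itself, at the
price of an arbitrary `ε`. -/
lemma BoundaryData.norm_mul_stripWeight_le {N' : ℕ} {A' : ℝ} (D : BoundaryData ρ G L n h C)
    (H : SlowGrowth ρ a G N A) (ha1 : a ≤ 1) (hA' : 0 ≤ A') (hU : UniformOrder a G N' A')
    (hℓ : Real.exp (ℓ + 1) ≤ a / 4) {φ : ℝ → ℝ} (hφ : IsTest (Icc (-1) 1) φ) {u lam S : ℝ}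
    (hlam : 0 ≤ lam)
    (hbot : ∀ s ≤ ℓ, ‖L (dil (expLift φ) (Real.exp s))‖ * Real.exp (-(s - u) ^ 2) ≤ S)
    (htop : ∀ s ≤ ℓ, ‖L (dil (expLift φ) (-Real.exp s))‖ *
      (Real.exp (Real.pi ^ 2 - lam * Real.pi) * Real.exp (-(s - u) ^ 2)) ≤ S)
    (harc : A * 2 ^ N / Real.exp (ℓ - 1) ^ N * (∫ v, |φ v|) *
      Real.exp (Real.pi ^ 2 - (ℓ - u) ^ 2) ≤ S)
    {w : ℂ} (hw : w.re ≤ ℓ) (hw0 : 0 < w.im) (hwpi : w.im < Real.pi) :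
    ‖lineInt (logShift G 0) φ w‖ * ‖stripWeight ℓ u lam N w‖ ≤ S := by
  have ha := H.pos
  have hS : 0 ≤ S := le_trans (by positivity) (hbot ℓ le_rfl)
  refine le_of_forall_pos_le_add fun ε hε => ?_
  have h1 := D.eventually_side_le (u := u) (c := 1) H ha1 hA' hU hℓ hφ (k := 0) (σ := 1) (by simp)
    (by simp) (by simp) hε zero_le_one hS (by simpa using hbot)
  have h2 := D.eventually_side_le (u := u) (c := Real.exp (Real.pi ^ 2 - lam * Real.pi)) H ha1 hA'
    hU hℓ hφ (k := Real.pi) (σ := -1) (by simp [Complex.exp_pi_mul_I])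
    (by simp) (by simp) hε (Real.exp_pos _).le hS (by simpa using htop)
  have h3 : ∀ᶠ τ in 𝓝[>] (0 : ℝ),
      ‖lineInt (logShift G τ) φ w‖ * ‖stripWeight ℓ u lam N w‖ ≤ S + ε := by
    filter_upwards [h1, h2, Ioc_mem_nhdsGT (show (0 : ℝ) < a / 4 by linarith)] with τ hτ1 hτ2 hτ
    refine H.maximum_principle hℓ hφ hτ.1 hτ.2 hlam ?_ ?_ (by linarith) hw hw0 hwpi
    · simpa using hτ1
    · simpa only [mul_assoc] using hτ2
  exact le_of_tendsto ((H.tendsto_lineInt_logShift hℓ hφ hw hw0 hwpi).norm.mul_const _) h3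

/-- Centring the Gaussian at `Re w` makes it equal to one there, and at distance one from the side
`Re w = ℓ` the corner factor is at least one half, so the weight can be divided out. -/
lemma half_pow_le_norm_stripWeight {u lam : ℝ} {w : ℂ} (hw : w.re ≤ ℓ - 1) (hu : u = w.re) :
    2⁻¹ ^ N * Real.exp (w.im ^ 2 - lam * w.im) ≤ ‖stripWeight ℓ u lam N w‖ := by
  rw [norm_stripWeight, hu, sub_self]
  have h1 : (2 : ℝ)⁻¹ ≤ ‖1 - Complex.exp (2 * (w - ℓ))‖ := by
    have h2 := norm_sub_norm_le 1 (Complex.exp (2 * (w - ℓ)))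
    have h3 : ‖Complex.exp (2 * (w - ℓ))‖ ≤ 2⁻¹ := by
      rw [Complex.norm_exp]
      have h4 : (2 * (w - ℓ)).re ≤ -1 := by
        simp
        linarith
      have h5 : (2 : ℝ) ≤ Real.exp 1 := by linarith [Real.add_one_le_exp (1 : ℝ)]
      calc _ ≤ Real.exp (-1) := Real.exp_le_exp.2 h4
        _ = (Real.exp 1)⁻¹ := Real.exp_neg 1
        _ ≤ 2⁻¹ := by gcongr
    rw [norm_one] at h2
    linarith
  gcongr
  simp

lemma BoundaryData.side_bound (D : BoundaryData ρ G L n h C) (H : SlowGrowth ρ a G N A)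
    (hℓ : Real.exp (ℓ + 1) ≤ a / 4) {φ : ℝ → ℝ} (hφ : IsTest (Icc (-1) 1) φ) {σ : ℝ}
    (hσ : |σ| = 1) {s : ℝ} (hs : s ≤ ℓ) :
    ‖L (dil (expLift φ) (σ * Real.exp s))‖ ≤ C * ∫ v, |logT^[n] φ v| := by
  refine D.norm_apply_dil_expLift_le hφ ?_ ?_
  · have : σ ≠ 0 := by
      rintro rfl
      simp at hσ
    exact mul_ne_zero this (Real.exp_pos s).ne'
  · rw [abs_mul, hσ, one_mul, abs_of_pos (Real.exp_pos s), ← Real.exp_add]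
    have : Real.exp (s + 1) ≤ Real.exp (ℓ + 1) := Real.exp_le_exp.2 (by linarith)
    linarith [H.pos, H.lt]

/-- The smoothed function is bounded, by norms of the kernel. -/
lemma BoundaryData.exists_bound_lineInt (D : BoundaryData ρ G L n h C) {N' : ℕ} {A' : ℝ}
    (H : SlowGrowth ρ a G N A) (ha1 : a ≤ 1) (hA' : 0 ≤ A') (hU : UniformOrder a G N' A')
    (hℓ : Real.exp (ℓ + 1) ≤ a / 4) :
    ∃ B, 0 ≤ B ∧ ∀ φ, IsTest (Icc (-1) 1) φ → ∀ w : ℂ, w.re ≤ ℓ - 1 → 0 < w.im → w.im < Real.pi →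
      ‖lineInt (logShift G 0) φ w‖ ≤ B * ((∫ v, |φ v|) + ∫ v, |logT^[n] φ v|) := by
  have hC := D.nonneg
  have hA := H.nonneg
  set E := Real.exp (Real.pi ^ 2) with hE
  set B₁ := A * 2 ^ N / Real.exp (ℓ - 1) ^ N with hB₁
  have hB₁0 : 0 ≤ B₁ := by positivity
  refine ⟨2 ^ N * (E * (B₁ + C)), by positivity, fun φ hφ w hw hw0 hwpi => ?_⟩
  set M₁ := ∫ v, |φ v|
  set M₂ := ∫ v, |logT^[n] φ v|
  have hM₁ : 0 ≤ M₁ := integral_nonneg fun v => abs_nonneg _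
  have hM₂ : 0 ≤ M₂ := integral_nonneg fun v => abs_nonneg _
  have hE1 : 1 ≤ E := Real.one_le_exp (by positivity)
  have hexp1 : ∀ s : ℝ, Real.exp (-(s - w.re) ^ 2) ≤ 1 := fun s =>
    Real.exp_le_one_iff.2 (by nlinarith [sq_nonneg (s - w.re)])
  have hS : C * M₂ ≤ E * (B₁ * M₁ + C * M₂) := by
    have : 0 ≤ B₁ * M₁ := by positivity
    have : 0 ≤ C * M₂ := by positivity
    nlinarith
  -- No discount of the upper side is needed for mere boundedness; recentring the Gaussian at each
  -- `w` keeps the constant uniform.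
  have key := D.norm_mul_stripWeight_le H ha1 hA' hU hℓ hφ (u := w.re) (lam := 0)
    (S := E * (B₁ * M₁ + C * M₂)) le_rfl ?_ ?_ ?_ (w := w) (by linarith) hw0 hwpi
  · have h1 := half_pow_le_norm_stripWeight (N := N) (lam := 0) hw rfl
    have h2 : (1 : ℝ) ≤ Real.exp (w.im ^ 2 - 0 * w.im) := Real.one_le_exp (by nlinarith)
    have h3 : (2 : ℝ)⁻¹ ^ N ≤ ‖stripWeight ℓ w.re 0 N w‖ := by
      have : (0 : ℝ) < 2⁻¹ ^ N := by positivity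
      nlinarith
    have h4 := (mul_le_mul_of_nonneg_left h3 (norm_nonneg _)).trans key
    rw [inv_pow, ← div_eq_mul_inv, div_le_iff₀ (by positivity)] at h4
    refine h4.trans ?_
    have : 0 ≤ B₁ * M₂ + C * M₁ := by positivity
    have : 0 ≤ 2 ^ N * E * (B₁ * M₂ + C * M₁) := by positivity
    nlinarith
  · intro s hs
    have h1 := D.side_bound H hℓ hφ (σ := 1) (by simp) hs
    rw [one_mul] at h1
    exact (mul_le_of_le_one_right (norm_nonneg _) (hexp1 s)).trans (h1.trans hS)
  · intro s hs
    have h1 := D.side_bound H hℓ hφ (σ := -1) (by simp) hs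
    rw [neg_one_mul] at h1
    rw [zero_mul, sub_zero]
    calc _ ≤ C * M₂ * (E * 1) := by gcongr; exact hexp1 s
      _ ≤ _ := by
        have : 0 ≤ B₁ * M₁ := by positivity
        nlinarith
  · calc _ ≤ B₁ * M₁ * E := by
          gcongr
          exact Real.exp_le_exp.2 (by nlinarith [sq_nonneg (ℓ - w.re)])
      _ ≤ _ := by
        have : 0 ≤ C * M₂ := by positivity
        nlinarith

/-- The smoothed function tends to `0` away from the left side of the strip. -/
lemma BoundaryData.eventually_norm_lineInt_le (D : BoundaryData ρ G L n h C) {N' : ℕ} {A' : ℝ}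
    (H : SlowGrowth ρ a G N A) (ha1 : a ≤ 1) (hA' : 0 ≤ A') (hU : UniformOrder a G N' A')
    (hℓ : Real.exp (ℓ + 1) ≤ a / 4) {φ : ℝ → ℝ} (hφ : IsTest (Icc (-1) 1) φ) {η ε : ℝ}
    (hη : 0 < η) (hε : 0 < ε) :
    ∀ᶠ x : ℝ in atBot, ∀ w : ℂ, w.re = x → 0 < w.im → w.im ≤ Real.pi - η →
      ‖lineInt (logShift G 0) φ w‖ ≤ ε := by
  have hC := D.nonneg
  have hA := H.nonneg
  set E := Real.exp (Real.pi ^ 2) with hE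
  have hEpos : 0 < E := Real.exp_pos _
  set B₁ := A * 2 ^ N / Real.exp (ℓ - 1) ^ N * ∫ v, |φ v|
  set B := C * (∫ v, |logT^[n] φ v|) + 1 with hB
  have hM₂ : 0 ≤ ∫ v, |logT^[n] φ v| := integral_nonneg fun v => abs_nonneg _
  have hBpos : 0 < B := by positivity
  have hexp : Tendsto (fun lam : ℝ => 2 ^ N * (B * E) * Real.exp (-(η * lam))) atTop (𝓝 0) := by
    have h1 : Tendsto (fun lam : ℝ => Real.exp (-(η * lam))) atTop (𝓝 0) :=
      Real.tendsto_exp_neg_atTop_nhds_zero.comp (tendsto_id.const_mul_atTop hη)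
    simpa using h1.const_mul (2 ^ N * (B * E))
  -- With `δ` proportional to `exp (-lam π)`, dividing by the weight at height at most `π - η` loses
  -- `exp (lam (π - η))`; the net factor `exp (-η lam)` is made small here, before `Re w` is sent to
  -- `-∞`.
  obtain ⟨lam, hlam, hlam0⟩ := ((hexp.eventually (gt_mem_nhds hε)).and
    (eventually_ge_atTop 0)).exists
  set δ := B * (E * Real.exp (-(lam * Real.pi))) with hδ
  have hδpos : 0 < δ := by positivity
  have hright : Tendsto (fun s => ‖L (dil (expLift φ) (Real.exp s))‖) atBot (𝓝 0) := by
    have h1 := (D.right (expLift φ) ((isTest_expLift hφ).mono fun x hx =>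
      (Real.exp_pos _).trans_le hx.1)).norm
    rw [norm_zero] at h1
    refine h1.comp (tendsto_nhdsWithin_iff.2 ⟨Real.tendsto_exp_atBot, ?_⟩)
    exact Eventually.of_forall fun s => Real.exp_pos s
  obtain ⟨s₀, hs₀⟩ := (hright.eventually (gt_mem_nhds hδpos)).exists_forall_of_atBot
  have hgauss : ∀ k c : ℝ, Tendsto (fun u : ℝ => c * Real.exp (-(u - k) ^ 2 - 0 * u)) atBot (𝓝 0) :=
    fun k c => by simpa using (tendsto_exp_neg_sq_sub_atBot k 0).const_mul c
  -- On the lower side the values are below `δ` left of `s₀` by the lateral limit. Right of `s₀`,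
  -- and on the vertical side, only boundedness is used, and the Gaussian centred far to the left
  -- supplies the smallness.
  filter_upwards [(hgauss s₀ B).eventually (gt_mem_nhds hδpos),
    (hgauss ℓ (B₁ * E)).eventually (gt_mem_nhds hδpos), eventually_le_atBot s₀,
    eventually_le_atBot (ℓ - 1)] with x hx1 hx2 hx3 hx4 w hwx hw0 hwη
  subst hwx
  have key := D.norm_mul_stripWeight_le H ha1 hA' hU hℓ hφ (u := w.re) (lam := lam)
    (S := δ) hlam0 ?_ ?_ ?_ (w := w) (by linarith) hw0 (by linarith)
  · have h1 := half_pow_le_norm_stripWeight (N := N) (lam := lam) hx4 rfl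
    have h2 : Real.exp (-(lam * (Real.pi - η))) ≤ Real.exp (w.im ^ 2 - lam * w.im) := by
      refine Real.exp_le_exp.2 ?_
      nlinarith [sq_nonneg w.im]
    have h3 : (2 : ℝ)⁻¹ ^ N * Real.exp (-(lam * (Real.pi - η))) ≤ ‖stripWeight ℓ w.re lam N w‖ :=
      (mul_le_mul_of_nonneg_left h2 (by positivity)).trans h1
    have h4 := (mul_le_mul_of_nonneg_left h3 (norm_nonneg _)).trans key
    have h5 : ‖lineInt (logShift G 0) φ w‖ ≤ 2 ^ N * (B * E) * Real.exp (-(η * lam)) := by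
      rw [inv_pow, Real.exp_neg, ← mul_inv, ← div_eq_mul_inv, div_le_iff₀ (by positivity)] at h4
      refine h4.trans (le_of_eq ?_)
      rw [hδ, show -(lam * Real.pi) = -(η * lam) + -(lam * (Real.pi - η)) by ring, Real.exp_add,
        Real.exp_neg (lam * (Real.pi - η))]
      field_simp
    linarith
  · intro s hs
    rcases le_or_gt s s₀ with h | h
    · refine (mul_le_of_le_one_right (norm_nonneg _) ?_).trans (hs₀ s h).le
      exact Real.exp_le_one_iff.2 (by nlinarith [sq_nonneg (s - w.re)])
    · have h1 := D.side_bound H hℓ hφ (σ := 1) (by simp) hs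
      rw [one_mul] at h1
      refine le_trans (mul_le_mul (b := B) ?_ (Real.exp_le_exp.2 ?_) (Real.exp_pos _).le hBpos.le)
        hx1.le
      · linarith
      · nlinarith
  · intro s hs
    have h1 := D.side_bound H hℓ hφ (σ := -1) (by simp) hs
    rw [neg_one_mul] at h1
    have h2 : Real.exp (-(s - w.re) ^ 2) ≤ 1 :=
      Real.exp_le_one_iff.2 (by nlinarith [sq_nonneg (s - w.re)])
    calc _ ≤ B * (Real.exp (Real.pi ^ 2 - lam * Real.pi) * 1) := by
          gcongr
          linarith
      _ = δ := by rw [hδ, hE, ← Real.exp_add, mul_one, sub_eq_add_neg]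
  · refine le_trans (le_of_eq ?_) hx2.le
    rw [mul_assoc B₁, hE, ← Real.exp_add]
    congr 2
    ring

end

section

/-! ### Pointwise bounds and the angular limit -/

variable {ρ a : ℝ} {G : ℂ → ℂ} {L : (ℝ → ℝ) → ℂ} {n N : ℕ} {h : ℝ → ℂ} {A C ℓ : ℝ}

lemma abs_iterate_logT_le {φ : ℝ → ℝ} (hφ : ContDiff ℝ ∞ φ) (n : ℕ) {M : ℝ}
    (hM : ∀ j ≤ n, ∀ x, |iteratedDeriv j φ x| ≤ M) (x : ℝ) : |logT^[n] φ x| ≤ 2 ^ n * M := by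
  induction n generalizing φ M with
  | zero => simpa using hM 0 le_rfl x
  | succ n ih =>
    have hd : ContDiff ℝ ∞ (deriv φ) := (contDiff_infty_iff_deriv.1 hφ).2
    rw [Function.iterate_succ_apply, pow_succ, mul_assoc]
    refine ih (hφ.sub hd) fun j hj y => ?_
    have h1 : iteratedDeriv j (logT φ) y = iteratedDeriv j φ y - iteratedDeriv (j + 1) φ y := by
      rw [iteratedDeriv_succ']
      exact iteratedDeriv_fun_sub (hφ.contDiffAt.of_le (by exact_mod_cast le_top))
        (hd.contDiffAt.of_le (by exact_mod_cast le_top))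
    change |iteratedDeriv j (logT φ) y| ≤ _
    rw [h1]
    have h2 := hM j (by omega) y
    have h3 := hM (j + 1) (by omega) y
    have h4 := abs_sub (iteratedDeriv j φ y) (iteratedDeriv (j + 1) φ y)
    linarith

lemma integral_abs_le_of_tsupport {φ : ℝ → ℝ} {b : ℝ} (hb : 0 ≤ b) (hφ : IsTest (Icc (-b) b) φ)
    {M : ℝ} (hM : ∀ x, |φ x| ≤ M) : ∫ v, |φ v| ≤ 2 * b * M := by
  have h1 : ∫ v, |φ v| = ∫ v in Icc (-b) b, |φ v| := by
    rw [setIntegral_eq_integral_of_forall_compl_eq_zero]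
    intro x hx
    rw [image_eq_zero_of_notMem_tsupport fun h => hx (hφ.3 h), abs_zero]
  have h2 := norm_setIntegral_le_of_norm_le_const (μ := volume) (s := Icc (-b) b)
    (f := fun v => |φ v|) (C := M) (by simp) (fun x _ => by simpa using hM x)
  rw [Real.volume_real_Icc, max_eq_left (by linarith)] at h2
  rw [h1]
  linarith [le_abs_self (∫ v in Icc (-b) b, |φ v|), Real.norm_eq_abs (∫ v in Icc (-b) b, |φ v|)]

lemma isTest_radialBump {d : ℝ} (hd0 : 0 < d) (hd : d ≤ 1) (s : ℝ) :
    IsTest (Icc (-1) 1) fun u => radialBump (u / d) s := by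
  refine isTest_of_forall_notMem ((contDiff_radialBump_left s).comp (by fun_prop))
    isCompact_Icc le_rfl fun u hu => radialBump_eq_zero_of_notMem fun h => hu ?_
  have h1 := (le_div_iff₀ hd0).1 h.1
  have h2 := (div_le_iff₀ hd0).1 h.2
  exact ⟨by linarith, by linarith⟩

lemma SlowGrowth.closedBall_subset (H : SlowGrowth ρ a G N A) (hℓ : Real.exp (ℓ + 1) ≤ a / 4)
    {w : ℂ} {d : ℝ} (hd : d ≤ 1) (hw : w.re ≤ ℓ - 1) (h0 : d < w.im) (h1 : w.im < Real.pi - d) :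
    Metric.closedBall w d ⊆
      (fun w => Complex.exp w + (0 : ℝ) * Complex.I) ⁻¹' (Ioo (-ρ) ρ ×ℂ Ioo 0 ρ) := by
  intro z hz
  rw [Metric.mem_closedBall, dist_eq_norm] at hz
  have h2 := abs_le.1 ((Complex.abs_re_le_norm (z - w)).trans hz)
  have h3 := abs_le.1 ((Complex.abs_im_le_norm (z - w)).trans hz)
  rw [Complex.sub_re] at h2
  rw [Complex.sub_im] at h3
  have := H.mem_domain (w := z) (v := 0) (τ := 0) hℓ (by linarith) (by norm_num)
    (by linarith [H.pos]) (by
      have := Real.sin_pos_of_pos_of_lt_pi (x := z.im) (by linarith) (by linarith)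
      rw [add_zero, add_zero]
      positivity)
  simpa only [Complex.ofReal_zero, add_zero] using this

/-- The smoothed function for bump kernels of width `d`. -/
lemma BoundaryData.exists_bound_lineInt_radialBump (D : BoundaryData ρ G L n h C) {N' : ℕ} {A' : ℝ}
    (H : SlowGrowth ρ a G N A) (ha1 : a ≤ 1) (hA' : 0 ≤ A') (hU : UniformOrder a G N' A')
    (hℓ : Real.exp (ℓ + 1) ≤ a / 4) :
    ∃ B, 0 ≤ B ∧ ∀ d : ℝ, 0 < d → d ≤ 1 → ∀ s, ∀ w : ℂ, w.re ≤ ℓ - 1 → 0 < w.im →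
      w.im < Real.pi →
      ‖lineInt (logShift G 0) (fun u => radialBump (u / d) s) w‖ ≤ B / d ^ n := by
  obtain ⟨B, hB0, hB⟩ := D.exists_bound_lineInt H ha1 hA' hU hℓ
  obtain ⟨K, hK0, hK⟩ := exists_bound_iteratedDeriv_radialBump n
  refine ⟨B * (2 + 2 * (2 ^ n * K)), by positivity, fun d hd0 hd s w hw hw0 hwpi => ?_⟩
  have ht := isTest_radialBump hd0 hd s
  refine (hB _ ht w hw hw0 hwpi).trans ?_
  rw [mul_div_assoc]
  refine mul_le_mul_of_nonneg_left ?_ hB0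
  have h1 : ∫ v, |radialBump (v / d) s| ≤ 2 * 1 * 1 := integral_abs_le_of_tsupport zero_le_one ht fun x => by
    rw [abs_of_nonneg (radialBump_nonneg _ _)]
    exact Real.smoothTransition.le_one _
  have hdi : (1 : ℝ) ≤ d⁻¹ := (one_le_inv₀ hd0).2 hd
  have h2 : ∀ x, |logT^[n] (fun u => radialBump (u / d) s) x| ≤ 2 ^ n * (d⁻¹ ^ n * K) := by
    refine abs_iterate_logT_le ht.1 n fun j hj x => ?_
    have h3 := iteratedDeriv_comp_sub_div (contDiff_radialBump_left s) j 0 d x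
    simp only [sub_zero] at h3
    rw [h3, abs_mul, abs_pow, abs_inv, abs_of_pos hd0]
    exact mul_le_mul (pow_le_pow_right₀ hdi hj) (hK j hj s _) (abs_nonneg _) (by positivity)
  have h3 := integral_abs_le_of_tsupport zero_le_one (IsTest.iterate (fun _ hf => hf.logT) n ht) h2
  have h4 : (1 : ℝ) ≤ d⁻¹ ^ n := one_le_pow₀ hdi
  calc _ ≤ 2 * d⁻¹ ^ n + 2 * (2 ^ n * (d⁻¹ ^ n * K)) := by linarith
    _ = _ := by rw [inv_pow]; field_simp

/-- Half the sine of `Im w` is a radius smaller than the distance to either side of the strip. Up to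
`n` derivatives of the kernel and the mean value normalization give the exponent `n + 1`. -/
lemma BoundaryData.exists_bound_logShift (D : BoundaryData ρ G L n h C) {N' : ℕ} {A' : ℝ}
    (H : SlowGrowth ρ a G N A) (ha1 : a ≤ 1) (hA' : 0 ≤ A') (hU : UniformOrder a G N' A')
    (hℓ : Real.exp (ℓ + 1) ≤ a / 4) :
    ∃ B, 0 ≤ B ∧ ∀ w : ℂ, w.re ≤ ℓ - 2 → 0 < w.im → w.im < Real.pi →
      ‖logShift G 0 w‖ ≤ B / Real.sin w.im ^ (n + 1) := by
  obtain ⟨B, hB0, hB⟩ := D.exists_bound_lineInt_radialBump H ha1 hA' hU hℓ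
  have hm := bumpMass_pos
  refine ⟨2 * B / bumpMass * 2 ^ (n + 1), by positivity, fun w hw hw0 hwpi => ?_⟩
  have hsin := Real.sin_pos_of_pos_of_lt_pi hw0 hwpi
  set d := Real.sin w.im / 2 with hd
  have hd0 : 0 < d := by positivity
  have hd1 : d ≤ 1 := by linarith [Real.sin_le_one w.im]
  have h1 : Real.sin w.im < w.im := Real.sin_lt hw0
  have h2 : Real.sin w.im < Real.pi - w.im := by
    rw [← Real.sin_pi_sub]
    exact Real.sin_lt (by linarith)
  have key := norm_le_of_lineInt_radialBump_le (isOpen_logShift_domain ρ 0)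
    (differentiableOn_logShift 0 H.diff) hd0
    (H.closedBall_subset hℓ hd1 (by linarith) (by linarith) (by linarith)) (B := B / d ^ n)
    fun s hs => by
      have hds : |d * s| ≤ d := by
        rw [abs_mul, abs_of_pos hd0]
        have := abs_le.2 hs
        nlinarith
      have hds' := abs_le.1 hds
      refine hB d hd0 hd1 s _ ?_ ?_ ?_
      · simp
        linarith
      · simp
        linarith
      · simp
        linarith
  refine key.trans (le_of_eq ?_)
  rw [hd, div_pow]
  field_simp
  ring

/-- The radius `η / 2` is now fixed, so the mean value formula uses a fixed family of kernels. Decay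
is available for each slice `s` separately; dominated convergence in `s` replaces uniformity. -/
lemma BoundaryData.tendsto_logShift (D : BoundaryData ρ G L n h C) {N' : ℕ} {A' : ℝ}
    (H : SlowGrowth ρ a G N A) (ha1 : a ≤ 1) (hA' : 0 ≤ A') (hU : UniformOrder a G N' A')
    (hℓ : Real.exp (ℓ + 1) ≤ a / 4) {η : ℝ} (hη : 0 < η) (hη1 : η ≤ 1) :
    Tendsto (logShift G 0)
      (comap Complex.re atBot ⊓ 𝓟 {w | η ≤ w.im ∧ w.im ≤ Real.pi - η}) (𝓝 0) := by
  set F := comap Complex.re atBot ⊓ 𝓟 {w : ℂ | η ≤ w.im ∧ w.im ≤ Real.pi - η}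
  set d := η / 2 with hd
  have hd0 : 0 < d := by positivity
  have hd1 : d ≤ 1 := by linarith
  have hm := bumpMass_pos
  obtain ⟨B, hB0, hB⟩ := D.exists_bound_lineInt_radialBump H ha1 hA' hU hℓ
  have hFim : ∀ᶠ w in F, η ≤ w.im ∧ w.im ≤ Real.pi - η :=
    mem_inf_of_right (mem_principal_self _)
  have hFre : ∀ {p : ℝ → Prop}, (∀ᶠ x in atBot, p x) → ∀ᶠ w in F, p w.re := fun hp =>
    mem_inf_of_left (preimage_mem_comap hp)
  have hFw := hFre (eventually_le_atBot (ℓ - 2))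
  have hds : ∀ s ∈ Icc (-1 : ℝ) 1, -d ≤ d * s ∧ d * s ≤ d := fun s hs =>
    ⟨by nlinarith [hs.1], by nlinarith [hs.2]⟩
  have key : Tendsto (fun w : ℂ => ∫ s in Icc (-1 : ℝ) 1, lineInt (logShift G 0)
      (fun u => radialBump (u / d) s) (w + (d * s : ℝ) * Complex.I)) F
      (𝓝 (∫ s in Icc (-1 : ℝ) 1, (0 : ℂ))) := by
    refine tendsto_integral_filter_of_dominated_convergence (fun _ => B / d ^ n) ?_ ?_ ?_ ?_
    · filter_upwards [hFim, hFw] with w hw hwr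
      have hball := H.closedBall_subset hℓ hd1 (w := w) (by linarith) (by linarith) (by linarith)
      have hcm : Continuous fun p : ℝ × ℝ => (w + (d * p.1 : ℝ) * Complex.I) + (p.2 : ℂ) := by
        fun_prop
      have hκ : Continuous fun p : ℝ × ℝ => (radialBump (p.2 / d) p.1 : ℂ) :=
        Complex.continuous_ofReal.comp (contDiff_radialBump.continuous.comp
          (g := fun p : ℝ × ℝ => radialBump p.1 p.2) (f := fun p : ℝ × ℝ => (p.2 / d, p.1))
          (by fun_prop))
      have hc : Continuous fun p : ℝ × ℝ => (radialBump (p.2 / d) p.1 : ℂ) *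
          logShift G 0 ((w + (d * p.1 : ℝ) * Complex.I) + (p.2 : ℂ)) := by
        refine continuous_mul_of_tsupport_subset ((isOpen_logShift_domain ρ 0).preimage hcm) hκ
          ((differentiableOn_logShift 0 H.diff).continuousOn.comp hcm.continuousOn
            fun p hp => hp) ?_
        refine (closure_minimal (t := (fun p : ℝ × ℝ =>
          (w + (d * p.1 : ℝ) * Complex.I) + (p.2 : ℂ)) ⁻¹' Metric.closedBall w d) ?_
          (Metric.isClosed_closedBall.preimage hcm)).trans (preimage_mono hball)
        intro p hp
        rw [mem_preimage, Metric.mem_closedBall, dist_eq_norm]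
        by_contra! hlt
        refine hp ?_
        beta_reduce
        rw [radialBump_eq_zero, Complex.ofReal_zero]
        have h1 := Complex.sq_norm (w + (d * p.1 : ℝ) * Complex.I + (p.2 : ℂ) - w)
        rw [show w + (d * p.1 : ℝ) * Complex.I + (p.2 : ℂ) - w =
          (p.2 : ℂ) + (d * p.1 : ℝ) * Complex.I by ring, Complex.normSq_add_mul_I] at h1
        rw [show w + (d * p.1 : ℝ) * Complex.I + (p.2 : ℂ) - w =
          (p.2 : ℂ) + (d * p.1 : ℝ) * Complex.I by ring] at hlt
        rw [div_pow, div_add' _ _ _ (by positivity), le_div_iff₀ (by positivity)]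
        nlinarith
      exact hc.aestronglyMeasurable.integral_prod_right'.restrict
    · filter_upwards [hFim, hFw] with w hw hwr
      refine (ae_restrict_iff' measurableSet_Icc).2 (ae_of_all _ fun s hs => ?_)
      have := hds s hs
      refine hB d hd0 hd1 s _ ?_ ?_ ?_
      · simp
        linarith
      · simp
        linarith
      · simp
        linarith
    · exact integrableOn_const (by simp)
    · refine (ae_restrict_iff' measurableSet_Icc).2 (ae_of_all _ fun s hs => ?_)
      rw [tendsto_zero_iff_norm_tendsto_zero, Metric.tendsto_nhds]
      intro ε hε
      have h1 := hFre (D.eventually_norm_lineInt_le H ha1 hA' hU hℓ (isTest_radialBump hd0 hd1 s)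
        hd0 (half_pos hε))
      filter_upwards [hFim, h1] with w hw h2
      have := hds s hs
      -- The slice moves the height by at most `d = η / 2`, so the point stays at distance at least
      -- `d` from the upper side.
      have h3 := h2 (w + (d * s : ℝ) * Complex.I) (by simp) (by simp; linarith)
        (by simp; linarith)
      rw [dist_zero_right, norm_norm]
      linarith
  rw [integral_zero] at key
  have h2 := key.const_mul ((d * bumpMass : ℂ)⁻¹)
  rw [mul_zero] at h2
  refine h2.congr' ?_
  filter_upwards [hFim, hFw] with w hw hwr
  rw [integral_lineInt_radialBump (isOpen_logShift_domain ρ 0)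
    (differentiableOn_logShift 0 H.diff) hd0
    (H.closedBall_subset hℓ hd1 (by linarith) (by linarith) (by linarith))]
  have h3 : (d : ℂ) ≠ 0 := by exact_mod_cast hd0.ne'
  have h4 : (bumpMass : ℂ) ≠ 0 := by exact_mod_cast hm.ne'
  field_simp

lemma exists_log_of_im_pos {z : ℂ} (hz : 0 < z.im) :
    Complex.exp (Complex.log z) = z ∧ 0 < (Complex.log z).im ∧ (Complex.log z).im < Real.pi ∧
      Real.sin (Complex.log z).im = z.im / ‖z‖ := by
  have hz0 : z ≠ 0 := by
    rintro rfl
    simp at hz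
  rw [Complex.log_im]
  refine ⟨Complex.exp_log hz0, ?_, ?_, Complex.sin_arg z⟩
  · refine (Complex.arg_nonneg_iff.2 hz.le).lt_of_ne fun h => ?_
    have := Complex.arg_eq_zero_iff.1 h.symm
    exact hz.ne' this.2
  · refine (Complex.arg_le_pi z).lt_of_ne fun h => ?_
    have := Complex.arg_eq_pi_iff.1 h
    exact hz.ne' this.2

lemma logShift_log {z : ℂ} (hz : 0 < z.im) : logShift G 0 (Complex.log z) = G z := by
  simp [logShift, (exists_log_of_im_pos hz).1]

/-- Consequences for `G`: a bound in terms of the angle, and the angular limit. -/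
theorem BoundaryData.exists_bound_and_tendsto (D : BoundaryData ρ G L n h C) :
    (∃ r > 0, r < ρ ∧ r ≤ 1 ∧ ∃ B, 0 ≤ B ∧ ∀ z : ℂ, ‖z‖ ≤ r → 0 < z.im →
      ‖G z‖ ≤ B * (‖z‖ / z.im) ^ (n + 1)) ∧
    ∀ M : ℝ, Tendsto G (𝓝[{z : ℂ | 0 < z.im ∧ |z.re| ≤ M * z.im}] 0) (𝓝 0) := by
  obtain ⟨a, ha1, N, A, N', A', hA', H, hU⟩ := D.exists_slowGrowth
  have ha := H.pos
  set ℓ := Real.log (a / 4) - 1 with hℓd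
  have hℓ : Real.exp (ℓ + 1) ≤ a / 4 := by
    rw [hℓd, sub_add_cancel, Real.exp_log (by linarith)]
  have hr : Real.exp (ℓ - 2) ≤ a / 4 := (Real.exp_le_exp.2 (by linarith)).trans hℓ
  constructor
  · obtain ⟨B, hB0, hB⟩ := D.exists_bound_logShift H ha1 hA' hU hℓ
    refine ⟨Real.exp (ℓ - 2), Real.exp_pos _, by linarith [H.lt], by linarith, B, hB0,
      fun z hz hz0 => ?_⟩
    obtain ⟨h1, h2, h3, h4⟩ := exists_log_of_im_pos hz0
    have hn : 0 < ‖z‖ := hz0.trans_le ((le_abs_self _).trans (Complex.abs_im_le_norm z))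
    have h5 := hB (Complex.log z) (by
      rw [Complex.log_re]
      exact (Real.log_le_iff_le_exp hn).2 hz) h2 h3
    rw [logShift_log hz0, h4, div_pow, div_div_eq_mul_div] at h5
    rwa [div_pow, ← mul_div_assoc]
  · intro M
    -- In the cone `‖z‖ ≤ (|M| + 1) Im z`, so the sine of the argument is at least `η`; being at
    -- most `θ` and at most `π - θ`, it keeps the argument away from both sides.
    set η := 1 / (|M| + 1) with hη
    have hM := abs_nonneg M
    have hη0 : 0 < η := by positivity
    have hη1 : η ≤ 1 := by
      rw [hη, div_le_one (by positivity)]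
      linarith
    have key := D.tendsto_logShift H ha1 hA' hU hℓ hη0 hη1
    have hlog : Tendsto Complex.log (𝓝[{z : ℂ | 0 < z.im ∧ |z.re| ≤ M * z.im}] 0)
        (comap Complex.re atBot ⊓ 𝓟 {w | η ≤ w.im ∧ w.im ≤ Real.pi - η}) := by
      refine tendsto_inf.2 ⟨tendsto_comap_iff.2 ?_, tendsto_principal.2 ?_⟩
      · have h1 : Tendsto (fun z : ℂ => ‖z‖) (𝓝[{z : ℂ | 0 < z.im ∧ |z.re| ≤ M * z.im}] 0)
            (𝓝[>] 0) := by
          refine tendsto_nhdsWithin_iff.2 ⟨?_, ?_⟩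
          · have : Tendsto (fun z : ℂ => ‖z‖) (𝓝 0) (𝓝 ‖(0 : ℂ)‖) := continuous_norm.tendsto 0
            rw [norm_zero] at this
            exact this.mono_left nhdsWithin_le_nhds
          · filter_upwards [self_mem_nhdsWithin] with z hz
            exact hz.1.trans_le ((le_abs_self _).trans (Complex.abs_im_le_norm z))
        refine (Real.tendsto_log_nhdsGT_zero.comp h1).congr fun z => ?_
        simp [Complex.log_re]
      · filter_upwards [self_mem_nhdsWithin] with z hz
        obtain ⟨h1, h2, h3, h4⟩ := exists_log_of_im_pos hz.1
        have hn : 0 < ‖z‖ := hz.1.trans_le ((le_abs_self _).trans (Complex.abs_im_le_norm z))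
        have h5 : η ≤ Real.sin (Complex.log z).im := by
          rw [h4, hη, div_le_div_iff₀ (by positivity) hn, one_mul]
          have h6 := Complex.norm_le_abs_re_add_abs_im z
          have h7 := hz.2
          rw [abs_of_pos hz.1] at h6
          have h8 := mul_le_mul_of_nonneg_right (le_abs_self M) hz.1.le
          linarith
        constructor
        · exact h5.trans (Real.sin_le h2.le)
        · have h6 : Real.sin (Complex.log z).im ≤ Real.pi - (Complex.log z).im := by
            rw [← Real.sin_pi_sub]
            exact Real.sin_le (by linarith)
          linarith
    refine (key.comp hlog).congr' ?_
    filter_upwards [self_mem_nhdsWithin] with z hz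
    exact logShift_log hz.1

end

section

/-! ### From the analytic function back to its boundary distribution -/

variable {ρ r : ℝ} {G : ℂ → ℂ} {L : (ℝ → ℝ) → ℂ} {n m : ℕ} {h : ℝ → ℂ} {B C : ℝ}

lemma IsTest.iterate_deriv {S : Set ℝ} {φ : ℝ → ℝ} (hφ : IsTest S φ) (j : ℕ) :
    IsTest S (_root_.deriv^[j] φ) :=
  IsTest.iterate (fun _ hf => hf.deriv) j hφ

lemma mem_rect_of_line {x y : ℝ} (hx : x ∈ Ioo (-ρ) ρ) (hy : y ∈ Ioo 0 ρ) :
    (y : ℂ) * Complex.I + x ∈ Ioo (-ρ) ρ ×ℂ Ioo 0 ρ := by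
  rw [Complex.mem_reProdIm]
  simpa using ⟨hx, hy⟩

/-- By the Cauchy-Riemann equations a vertical derivative is `I` times a horizontal one, which
integration by parts moves to `φ`. -/
lemma hasDerivAt_lineInt_vertical (hG : DifferentiableOn ℂ G (Ioo (-ρ) ρ ×ℂ Ioo 0 ρ)) {φ : ℝ → ℝ}
    (hφ : IsTest (Ioo (-ρ) ρ) φ) {y : ℝ} (hy : y ∈ Ioo 0 ρ) :
    HasDerivAt (fun y : ℝ => lineInt G φ (y * Complex.I))
      (-(Complex.I * lineInt G (deriv φ) (y * Complex.I))) y := by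
  have h1 := hasDerivAt_lineInt (w := y * Complex.I) (isOpen_rect ρ) hG (hφ.1.of_le (by simp)) hφ.2
    fun v hv => mem_rect_of_line (hφ.3 hv) hy
  have h2 : HasDerivAt (fun y : ℂ => y * Complex.I) Complex.I (y : ℂ) := by
    simpa using (hasDerivAt_id (y : ℂ)).mul_const Complex.I
  have h3 := (HasDerivAt.comp (y : ℂ) h1 h2).comp_ofReal
  convert! h3 using 1
  ring

/-- The Taylor-type expression whose derivative in `y` involves a single line integral. -/
def taylorLine (G : ℂ → ℂ) (φ : ℝ → ℝ) (m : ℕ) (y : ℝ) : ℂ :=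
  ∑ j ∈ Finset.range (m + 1), (Complex.I * y) ^ j / (j.factorial : ℂ) *
    lineInt G (deriv^[j] φ) (y * Complex.I)

/-- The sum telescopes: differentiating the coefficient of one term cancels the derivative of the
line integral in the preceding one, leaving only the top term. -/
lemma hasDerivAt_taylorLine (hG : DifferentiableOn ℂ G (Ioo (-ρ) ρ ×ℂ Ioo 0 ρ)) {φ : ℝ → ℝ}
    (hφ : IsTest (Ioo (-ρ) ρ) φ) (m : ℕ) {y : ℝ} (hy : y ∈ Ioo 0 ρ) :
    HasDerivAt (taylorLine G φ m)
      (-(Complex.I * ((Complex.I * y) ^ m / (m.factorial : ℂ) *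
        lineInt G (deriv^[m + 1] φ) (y * Complex.I)))) y := by
  induction m with
  | zero =>
    have h0 : taylorLine G φ 0 = fun y : ℝ => lineInt G φ (y * Complex.I) := by
      ext y
      simp [taylorLine]
    rw [h0]
    simpa using hasDerivAt_lineInt_vertical hG hφ hy
  | succ m ih =>
    have h1 := hasDerivAt_lineInt_vertical hG (hφ.iterate_deriv (m + 1)) hy
    rw [← Function.iterate_succ_apply' deriv] at h1
    have h2 : HasDerivAt (fun y : ℝ => (Complex.I * y) ^ (m + 1) / ((m + 1).factorial : ℂ))
        (Complex.I * ((Complex.I * y) ^ m / (m.factorial : ℂ))) y := by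
      have h3 : HasDerivAt (fun y : ℂ => (Complex.I * y) ^ (m + 1) / ((m + 1).factorial : ℂ))
          (((m + 1 : ℕ) * (Complex.I * y) ^ m * Complex.I) / ((m + 1).factorial : ℂ)) (y : ℂ) := by
        have h4 : HasDerivAt (fun y : ℂ => Complex.I * y) Complex.I (y : ℂ) := by
          simpa using (hasDerivAt_id (y : ℂ)).const_mul Complex.I
        exact (h4.pow (m + 1)).div_const _
      convert! h3.comp_ofReal using 1
      have hf : (m.factorial : ℂ) ≠ 0 := by exact_mod_cast m.factorial_ne_zero
      have hm1 : ((m : ℂ) + 1) ≠ 0 := by exact_mod_cast m.succ_ne_zero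
      rw [Nat.factorial_succ]
      push_cast
      field_simp
    have h5 := ih.add (h2.mul h1)
    have h6 : taylorLine G φ (m + 1) = fun y => taylorLine G φ m y +
        (Complex.I * y) ^ (m + 1) / ((m + 1).factorial : ℂ) *
          lineInt G (deriv^[m + 1] φ) (y * Complex.I) := by
      ext y
      rw [taylorLine, Finset.sum_range_succ, taylorLine]
    rw [h6]
    convert! h5 using 1
    ring

lemma norm_taylor_coeff_le (j : ℕ) {y : ℝ} (hy : 0 ≤ y) :
    ‖(Complex.I * y) ^ j / (j.factorial : ℂ)‖ ≤ y ^ j := by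
  rw [norm_div, norm_pow, norm_mul, Complex.norm_I, one_mul, Complex.norm_real, Real.norm_eq_abs,
    abs_of_nonneg hy, Complex.norm_natCast]
  exact div_le_self (by positivity) (by exact_mod_cast Nat.one_le_iff_ne_zero.2 j.factorial_ne_zero)

/-- As `y → 0` only the term `j = 0` of the Taylor expression survives and gives `L φ`. The mean
value inequality between heights `y` and `Y` involves only the top line integral, whose factor `y ^
m` compensates a blow-up of order `m` at the axis. -/
lemma norm_boundary_le (hG : DifferentiableOn ℂ G (Ioo (-ρ) ρ ×ℂ Ioo 0 ρ))
    (hL : ∀ φ, IsTest (Ioo (-ρ) ρ) φ →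
      Tendsto (fun y : ℝ => lineInt G φ (y * Complex.I)) (𝓝[>] 0) (𝓝 (L φ)))
    {φ : ℝ → ℝ} (hφ : IsTest (Ioo (-ρ) ρ) φ) (m : ℕ) {Y K : ℝ} (hY0 : 0 < Y) (hY : Y < ρ)
    (hK : ∀ y ∈ Ioc 0 Y, y ^ m * ‖lineInt G (deriv^[m + 1] φ) (y * Complex.I)‖ ≤ K) :
    ‖L φ‖ ≤ (∑ j ∈ Finset.range (m + 1), Y ^ j * ‖lineInt G (deriv^[j] φ) (Y * Complex.I)‖) +
      K * Y := by
  have hK0 : 0 ≤ K := le_trans (by positivity) (hK Y ⟨hY0, le_rfl⟩)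
  have hlim : Tendsto (taylorLine G φ m) (𝓝[>] 0) (𝓝 (L φ)) := by
    have h1 : Tendsto (taylorLine G φ m) (𝓝[>] 0) (𝓝 (∑ j ∈ Finset.range (m + 1),
        (Complex.I * (0 : ℝ)) ^ j / (j.factorial : ℂ) * L (deriv^[j] φ))) := by
      refine tendsto_finsetSum _ fun j _ => Tendsto.mul ?_ (hL _ (hφ.iterate_deriv j))
      have : Continuous fun y : ℝ => (Complex.I * y) ^ j / (j.factorial : ℂ) := by fun_prop
      exact (this.tendsto 0).mono_left nhdsWithin_le_nhds
    rw [Finset.sum_range_succ'] at h1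
    simpa using h1
  have hle : ∀ᶠ y in 𝓝[>] (0 : ℝ), ‖taylorLine G φ m y‖ ≤ (∑ j ∈ Finset.range (m + 1),
      Y ^ j * ‖lineInt G (deriv^[j] φ) (Y * Complex.I)‖) + K * Y := by
    filter_upwards [Ioc_mem_nhdsGT hY0] with y hy
    have h1 := (convex_Icc y Y).norm_image_sub_le_of_norm_hasDerivWithin_le
      (f := taylorLine G φ m) (C := K)
      (fun t ht => (hasDerivAt_taylorLine hG hφ m
        ⟨hy.1.trans_le ht.1, ht.2.trans_lt hY⟩).hasDerivWithinAt)
      (fun t ht => by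
        have ht0 : 0 < t := hy.1.trans_le ht.1
        rw [norm_neg, norm_mul, Complex.norm_I, one_mul, norm_mul]
        exact (mul_le_mul_of_nonneg_right (norm_taylor_coeff_le m ht0.le) (norm_nonneg _)).trans
          (hK t ⟨ht0, ht.2⟩)) (left_mem_Icc.2 hy.2) (right_mem_Icc.2 hy.2)
    have h2 : ‖taylorLine G φ m Y‖ ≤ ∑ j ∈ Finset.range (m + 1),
        Y ^ j * ‖lineInt G (deriv^[j] φ) (Y * Complex.I)‖ := by
      refine norm_sum_le_of_le _ fun j _ => ?_
      rw [norm_mul]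
      exact mul_le_mul_of_nonneg_right (norm_taylor_coeff_le j hY0.le) (norm_nonneg _)
    have h3 := norm_sub_norm_le (taylorLine G φ m y) (taylorLine G φ m Y)
    rw [norm_sub_rev] at h3
    have h4 : K * ‖Y - y‖ ≤ K * Y := by
      refine mul_le_mul_of_nonneg_left ?_ hK0
      rw [Real.norm_eq_abs, abs_of_nonneg (by linarith [hy.2])]
      linarith [hy.1]
    linarith
  exact le_of_tendsto hlim.norm hle

/-- A bound in terms of the angle, as in the conclusion of `BoundaryData.exists_bound_and_tendsto`. -/
def AngularBound (G : ℂ → ℂ) (r B : ℝ) (m : ℕ) : Prop :=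
  ∀ z : ℂ, ‖z‖ ≤ r → 0 < z.im → ‖G z‖ ≤ B * (‖z‖ / z.im) ^ m

/-- On a segment of half-length `ε` at height `y ≤ ε` one has `‖z‖ ≤ 2 ε`, so `G` is at most `B (2 ε
/ y) ^ m`; the power of `y` cancels. -/
lemma AngularBound.norm_lineInt_le (hB : AngularBound G r B m) (hB0 : 0 ≤ B) {ε y K : ℝ}
    (hε : 2 * ε ≤ r) (hy0 : 0 < y) (hy : y ≤ ε) {χ : ℝ → ℝ} (hχ : IsTest (Icc (-ε) ε) χ)
    (hK : ∀ x, |χ x| ≤ K) :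
    y ^ m * ‖lineInt G χ (y * Complex.I)‖ ≤ B * (2 * ε) ^ m * (2 * ε * K) := by
  have hε0 : 0 < ε := hy0.trans_le hy
  have h1 : ‖lineInt G χ (y * Complex.I)‖ ≤ B * (2 * ε / y) ^ m * ∫ v, |χ v| := by
    refine BoundaryValue.norm_lineInt_le hχ.continuous hχ.2 fun v hv => ?_
    have hv' := abs_le.2 (hχ.3 hv)
    have him : ((y : ℂ) * Complex.I + v).im = y := by simp
    have hn : ‖(y : ℂ) * Complex.I + v‖ ≤ 2 * ε := by
      refine (norm_add_le _ _).trans ?_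
      rw [norm_mul, Complex.norm_I, mul_one, Complex.norm_real, Complex.norm_real,
        Real.norm_eq_abs, Real.norm_eq_abs, abs_of_pos hy0]
      linarith
    have h2 := hB _ (hn.trans hε) (by rw [him]; exact hy0)
    rw [him] at h2
    refine h2.trans ?_
    gcongr
  have h2 := integral_abs_le_of_tsupport hε0.le hχ hK
  calc _ ≤ y ^ m * (B * (2 * ε / y) ^ m * (2 * ε * K)) := by gcongr; exact h1.trans (by gcongr)
    _ = _ := by
      rw [div_pow]
      field_simp

/-- Test functions concentrated near `0` at scale `ε` are mapped to `O(ε)`. -/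
lemma norm_boundary_le_of_scale (hG : DifferentiableOn ℂ G (Ioo (-ρ) ρ ×ℂ Ioo 0 ρ))
    (hL : ∀ φ, IsTest (Ioo (-ρ) ρ) φ →
      Tendsto (fun y : ℝ => lineInt G φ (y * Complex.I)) (𝓝[>] 0) (𝓝 (L φ)))
    (hB : AngularBound G r B m) (hB0 : 0 ≤ B) (hr : r < ρ) {ε M : ℝ} (hε0 : 0 < ε)
    (hε : 2 * ε ≤ r) {ψ : ℝ → ℝ} (hψ : IsTest (Icc (-ε) ε) ψ)
    (hM : ∀ j ≤ m + 1, ∀ x, ε ^ j * |deriv^[j] ψ x| ≤ M) :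
    ‖L ψ‖ ≤ ((m + 1) * (2 * B * 2 ^ m) + 2 * B * 2 ^ m) * M * ε := by
  have hsub : Icc (-ε) ε ⊆ Ioo (-ρ) ρ := fun x hx =>
    ⟨by linarith [hx.1], by linarith [hx.2]⟩
  have hM' : ∀ j ≤ m + 1, ∀ x, |deriv^[j] ψ x| ≤ M / ε ^ j := fun j hj x => by
    rw [le_div_iff₀ (by positivity), mul_comm]
    exact hM j hj x
  -- With height `Y = ε`, the `m + 1` main terms and the remainder are each `O(M ε)` by the angular
  -- bound alone.
  have key := norm_boundary_le hG hL (hψ.mono hsub) m hε0 (by linarith)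
    (K := 2 * B * 2 ^ m * M) fun y hy => by
      refine (hB.norm_lineInt_le hB0 hε hy.1 hy.2 (hψ.iterate_deriv (m + 1))
        (hM' (m + 1) le_rfl)).trans (le_of_eq ?_)
      rw [mul_pow]
      field_simp
      ring
  have hsum : ∑ j ∈ Finset.range (m + 1), ε ^ j * ‖lineInt G (deriv^[j] ψ) (ε * Complex.I)‖ ≤
      ∑ _j ∈ Finset.range (m + 1), 2 * B * 2 ^ m * M * ε := by
    refine Finset.sum_le_sum fun j hj => ?_
    have hj' : j ≤ m + 1 := (Finset.mem_range.1 hj).le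
    have h1 := hB.norm_lineInt_le hB0 hε hε0 le_rfl (hψ.iterate_deriv j) (hM' j hj')
    have h2 : ‖lineInt G (deriv^[j] ψ) (ε * Complex.I)‖ ≤ B * 2 ^ m * (2 * ε * (M / ε ^ j)) := by
      rw [mul_pow] at h1
      have : (0 : ℝ) < ε ^ m := by positivity
      nlinarith
    calc _ ≤ ε ^ j * (B * 2 ^ m * (2 * ε * (M / ε ^ j))) := by gcongr
      _ = _ := by field_simp
  rw [Finset.sum_const, Finset.card_range, nsmul_eq_mul] at hsum
  push_cast at hsum
  linarith

lemma iterate_deriv_dil (φ : ℝ → ℝ) (hφ : ContDiff ℝ ∞ φ) (c : ℝ) (j : ℕ) (x : ℝ) :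
    deriv^[j] (dil φ c) x = c⁻¹ ^ j * dil (deriv^[j] φ) c x := by
  have h1 := iteratedDeriv_comp_sub_div hφ j 0 c x
  simp only [sub_zero] at h1
  unfold dil
  rw [← iteratedDeriv_eq_iterate, ← iteratedDeriv_eq_iterate, iteratedDeriv_const_mul_field, h1]
  ring

/-- The dilation limit for all test functions. -/
theorem tendsto_boundary_dil (hG : DifferentiableOn ℂ G (Ioo (-ρ) ρ ×ℂ Ioo 0 ρ))
    (hL : ∀ φ, IsTest (Ioo (-ρ) ρ) φ →
      Tendsto (fun y : ℝ => lineInt G φ (y * Complex.I)) (𝓝[>] 0) (𝓝 (L φ)))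
    (hB : AngularBound G r B m) (hB0 : 0 ≤ B) (hr0 : 0 < r) (hr : r < ρ)
    (hang : ∀ M : ℝ, Tendsto G (𝓝[{z : ℂ | 0 < z.im ∧ |z.re| ≤ M * z.im}] 0) (𝓝 0))
    {φ : ℝ → ℝ} (hφ : IsTest univ φ) : Tendsto (fun ε : ℝ => L (dil φ ε)) (𝓝[>] 0) (𝓝 0) := by
  obtain ⟨b, hb1, hb⟩ : ∃ b : ℝ, 1 ≤ b ∧ tsupport φ ⊆ Icc (-b) b := by
    obtain ⟨b, hb⟩ := hφ.2.isCompact.isBounded.subset_closedBall 0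
    refine ⟨max b 1, le_max_right _ _, fun x hx => ?_⟩
    have := hb hx
    rw [mem_closedBall_zero_iff, Real.norm_eq_abs] at this
    exact abs_le.1 (this.trans (le_max_left _ _))
  have hφb : IsTest (Icc (-b) b) φ := ⟨hφ.1, hφ.2, hb⟩
  obtain ⟨K, hK0, hK⟩ := exists_bound_iteratedDeriv hφb (m + 1)
  have hK' : ∀ j ≤ m + 1, ∀ x, |deriv^[j] φ x| ≤ K := fun j hj x => by
    rw [← iteratedDeriv_eq_iterate]
    exact hK j hj x
  set Z := B * (2 * b) ^ m * (2 * b * K) with hZ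
  have hZ0 : 0 ≤ Z := by positivity
  rw [tendsto_zero_iff_norm_tendsto_zero, Metric.tendsto_nhds]
  intro e he
  -- The remainder at height `δ ε` will be `(Z / ε) (δ ε) = Z δ`, independent of `ε`; hence `δ` is
  -- fixed first.
  obtain ⟨δ, hδ0, hδ1, hδZ⟩ : ∃ δ : ℝ, 0 < δ ∧ δ ≤ 1 ∧ Z * δ ≤ e / 3 := by
    refine ⟨min 1 (e / 3 / (Z + 1)), by positivity, min_le_left _ _, ?_⟩
    calc _ ≤ Z * (e / 3 / (Z + 1)) := by gcongr; exact min_le_right _ _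
      _ = (Z / (Z + 1)) * (e / 3) := by ring
      _ ≤ 1 * (e / 3) := by
        gcongr
        rw [div_le_one (by positivity)]
        linarith
      _ = e / 3 := one_mul _
  set q := e / (3 * ((m + 1) * (2 * b * K + 1))) with hq
  have hq0 : 0 < q := by positivity
  -- The segment `|Re z| ≤ b ε` at height `δ ε` lies in the cone of opening `b / δ`. The value of
  -- `q` makes the sum of the `m + 1` main terms at most `e / 3`.
  have hsmall := (hang (b / δ)).norm.eventually (gt_mem_nhds (show ‖(0 : ℂ)‖ < q by simpa))
  obtain ⟨r₁, hr₁, hr₁s⟩ := Metric.mem_nhdsWithin_iff.1 hsmall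
  filter_upwards [self_mem_nhdsWithin, Ioo_mem_nhdsGT (show 0 < min (r / (2 * b)) (r₁ / (2 * b)) by
    positivity)] with ε hε0 hε
  have hε0' : 0 < ε := hε0
  have hεr : 2 * (b * ε) < r := by
    have := hε.2.trans_le (min_le_left _ _)
    rw [lt_div_iff₀ (by positivity)] at this
    linarith
  have hεr₁ : 2 * (b * ε) < r₁ := by
    have := hε.2.trans_le (min_le_right _ _)
    rw [lt_div_iff₀ (by positivity)] at this
    linarith
  have hmap : ∀ x ∈ Icc (-b) b, ε * x ∈ Icc (-(b * ε)) (b * ε) := fun x hx =>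
    ⟨by nlinarith [hx.1], by nlinarith [hx.2]⟩
  have hψ : IsTest (Icc (-(b * ε)) (b * ε)) (dil φ ε) := isTest_dil hε0'.ne' hφb hmap
  have hψρ : IsTest (Ioo (-ρ) ρ) (dil φ ε) := hψ.mono fun x hx =>
    ⟨by linarith [hx.1], by linarith [hx.2]⟩
  have hδε : δ * ε ≤ b * ε := by nlinarith
  have key := norm_boundary_le hG hL hψρ m (Y := δ * ε) (K := Z / ε) (by positivity)
    (by linarith) fun y hy => by
      refine (hB.norm_lineInt_le hB0 hεr.le hy.1 (hy.2.trans hδε) (hψ.iterate_deriv (m + 1))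
        (K := ε⁻¹ ^ (m + 1) * (ε⁻¹ * K)) fun x => ?_).trans (le_of_eq ?_)
      · rw [iterate_deriv_dil φ hφ.1, abs_mul, abs_pow, abs_inv, abs_of_pos hε0', dil, abs_mul,
          abs_inv, abs_abs, abs_of_pos hε0']
        gcongr
        exact hK' (m + 1) le_rfl _
      · rw [hZ, inv_pow, mul_pow, mul_pow, mul_pow]
        field_simp
        ring
  have hterm : ∀ j ∈ Finset.range (m + 1),
      (δ * ε) ^ j * ‖lineInt G (deriv^[j] (dil φ ε)) ((δ * ε : ℝ) * Complex.I)‖ ≤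
        q * (2 * b * K) := by
    intro j hj
    have hj' : j ≤ m + 1 := (Finset.mem_range.1 hj).le
    have h1 : lineInt G (deriv^[j] (dil φ ε)) ((δ * ε : ℝ) * Complex.I) =
        (ε⁻¹ ^ j : ℝ) * lineInt G (dil (deriv^[j] φ) ε) ((δ * ε : ℝ) * Complex.I) := by
      rw [← lineInt_const_mul]
      congr 1
      ext x
      exact iterate_deriv_dil φ hφ.1 ε j x
    have h2 : lineInt G (dil (deriv^[j] φ) ε) ((δ * ε : ℝ) * Complex.I) =
        ∫ x : ℝ, ((deriv^[j] φ x : ℝ) : ℂ) * G ((δ * ε : ℝ) * Complex.I + (ε * x : ℝ)) :=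
      integral_dil_mul _ (fun x : ℝ => G ((δ * ε : ℝ) * Complex.I + x)) hε0'.ne'
    have hφj := hφb.iterate_deriv j
    have h3 : ‖lineInt G (dil (deriv^[j] φ) ε) ((δ * ε : ℝ) * Complex.I)‖ ≤
        q * ∫ x, |deriv^[j] φ x| := by
      rw [h2, ← integral_const_mul]
      refine norm_integral_le_of_norm_le
        ((hφj.continuous.abs.integrable_of_hasCompactSupport hφj.2.abs).const_mul q)
        (ae_of_all _ fun x => ?_)
      by_cases hx : x ∈ tsupport (deriv^[j] φ)
      · rw [norm_mul, Complex.norm_real, mul_comm, Real.norm_eq_abs]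
        refine mul_le_mul_of_nonneg_right (le_of_lt (hr₁s ⟨?_, ?_, ?_⟩)) (abs_nonneg _)
        · rw [Metric.mem_ball, dist_zero_right]
          refine (norm_add_le _ _).trans_lt ?_
          rw [norm_mul, Complex.norm_I, mul_one, Complex.norm_real, Complex.norm_real,
            Real.norm_eq_abs, Real.norm_eq_abs, abs_of_pos (by positivity)]
          have := abs_le.2 (hmap x (hφj.3 hx))
          linarith
        · simp
          positivity
        · have := abs_le.2 (hmap x (hφj.3 hx))
          have h4 : b / δ * (δ * ε) = b * ε := by field_simp
          simpa [h4] using this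
      · simp [image_eq_zero_of_notMem_tsupport hx]
    have h4 := integral_abs_le_of_tsupport (by linarith) hφj (hK' j hj')
    have hδj : δ ^ j ≤ 1 := pow_le_one₀ hδ0.le hδ1
    rw [h1, norm_mul, Complex.norm_real, Real.norm_eq_abs, abs_of_pos (by positivity)]
    calc _ ≤ (δ * ε) ^ j * (ε⁻¹ ^ j * (q * (2 * b * K))) := by
          gcongr
          exact h3.trans (by gcongr)
      _ = δ ^ j * (q * (2 * b * K)) := by
        rw [mul_pow, inv_pow]
        field_simp
      _ ≤ 1 * (q * (2 * b * K)) := by gcongr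
      _ = _ := one_mul _
  have hsum := Finset.sum_le_sum hterm
  rw [Finset.sum_const, Finset.card_range, nsmul_eq_mul] at hsum
  have h5 : ((m + 1 : ℕ) : ℝ) * (q * (2 * b * K)) ≤ e / 3 := by
    rw [hq]
    push_cast
    rw [div_mul_eq_mul_div, mul_div_assoc', div_le_div_iff₀ (by positivity) (by positivity)]
    have : 0 < e * (m + 1 : ℝ) := by positivity
    nlinarith
  have h6 : Z / ε * (δ * ε) = Z * δ := by field_simp
  rw [h6] at key
  rw [dist_zero_right, norm_norm]
  linarith

end

section

/-! ### A Tauberian argument in logarithmic coordinates -/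

variable {ρ r : ℝ} {G : ℂ → ℂ} {L : (ℝ → ℝ) → ℂ} {n m : ℕ} {h : ℝ → ℂ} {B C : ℝ}

/-- The derivative of `exp u * f u` is `exp u * (f u + f' u)`. Boundedness of `f` makes the boundary
term at `-∞` vanish, and integration gives `‖f s‖ ≤ ε / 2` far to the left. -/
lemma tendsto_zero_of_add_deriv {f f' : ℝ → ℂ} {K : ℝ} (hd : ∀ u, HasDerivAt f (f' u) u)
    (hK : ∀ u, ‖f u‖ ≤ K) (hlim : Tendsto (fun u => f u + f' u) atBot (𝓝 0)) :
    Tendsto f atBot (𝓝 0) := by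
  rw [tendsto_zero_iff_norm_tendsto_zero, Metric.tendsto_nhds]
  intro ε hε
  obtain ⟨s₁, hs₁⟩ := ((hlim.norm.eventually
    (gt_mem_nhds (show ‖(0 : ℂ)‖ < ε / 2 by simpa using half_pos hε)))).exists_forall_of_atBot
  filter_upwards [eventually_le_atBot s₁] with s hs
  have hexp : ∀ u : ℝ, HasDerivAt (fun u : ℝ => ((Real.exp u : ℝ) : ℂ)) ((Real.exp u : ℝ) : ℂ) u :=
    fun u => (Real.hasDerivAt_exp u).ofReal_comp
  have hfe : ∀ u, HasDerivAt (fun u => ((Real.exp u : ℝ) : ℂ) * f u)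
      (((Real.exp u : ℝ) : ℂ) * (f u + f' u)) u := fun u => by
    convert! (hexp u).mul (hd u) using 1
    ring
  have hnorm : ∀ (u : ℝ) (z : ℂ), ‖((Real.exp u : ℝ) : ℂ) * z‖ = Real.exp u * ‖z‖ := fun u z => by
    rw [norm_mul, Complex.norm_real, Real.norm_eq_abs, abs_of_pos (Real.exp_pos u)]
  have hle : ∀ t ≤ s, Real.exp s * ‖f s‖ ≤ ε / 2 * Real.exp s + K * Real.exp t := by
    intro t ht
    have h1 := image_norm_le_of_norm_deriv_right_le_deriv_boundary (a := t) (b := s)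
      (f := fun u => ((Real.exp u : ℝ) : ℂ) * f u)
      (f' := fun u => ((Real.exp u : ℝ) : ℂ) * (f u + f' u))
      (B := fun u => ε / 2 * Real.exp u + K * Real.exp t) (B' := fun u => ε / 2 * Real.exp u)
      (fun u _ => (hfe u).continuousAt.continuousWithinAt) (fun u _ => (hfe u).hasDerivWithinAt)
      (by
        rw [hnorm]
        have := mul_le_mul_of_nonneg_left (hK t) (Real.exp_pos t).le
        have := mul_pos (half_pos hε) (Real.exp_pos t)
        linarith)
      (fun u => ((Real.hasDerivAt_exp u).const_mul _).add_const _)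
      (fun u hu => by
        rw [hnorm, mul_comm]
        have := hs₁ u (hu.2.le.trans hs)
        gcongr)
    have h2 := h1 (right_mem_Icc.2 ht)
    rwa [hnorm] at h2
  have hlim2 : Tendsto (fun t => ε / 2 * Real.exp s + K * Real.exp t) atBot
      (𝓝 (ε / 2 * Real.exp s + K * 0)) :=
    (Real.tendsto_exp_atBot.const_mul K).const_add _
  have h3 := ge_of_tendsto hlim2 ((eventually_le_atBot s).mono hle)
  rw [mul_zero, add_zero, mul_comm] at h3
  have h4 := le_of_mul_le_mul_right h3 (Real.exp_pos s)
  rw [dist_zero_right, norm_norm]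
  linarith

/-- The correlation of a bounded function with a kernel. -/
def correlation (H : ℝ → ℂ) (κ : ℝ → ℝ) (u : ℝ) : ℂ := ∫ v, (κ v : ℂ) * H (u + v)

lemma integrable_correlation {H : ℝ → ℂ} (hH : Measurable H) (hC : ∀ x, ‖H x‖ ≤ C) {κ : ℝ → ℝ}
    (hκ : Integrable κ) (u : ℝ) : Integrable fun v => (κ v : ℂ) * H (u + v) :=
  hκ.ofReal.mul_bdd (c := C) (hH.comp (measurable_const_add u)).aestronglyMeasurable
    (ae_of_all _ fun _ => hC _)

lemma norm_correlation_le {H : ℝ → ℂ} (hC : ∀ x, ‖H x‖ ≤ C) {κ : ℝ → ℝ}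
    (hκ : Integrable κ) (u : ℝ) : ‖correlation H κ u‖ ≤ C * ∫ v, |κ v| := by
  rw [← integral_const_mul]
  refine norm_integral_le_of_norm_le (hκ.abs.const_mul C) (ae_of_all _ fun v => ?_)
  rw [norm_mul, Complex.norm_real, mul_comm, Real.norm_eq_abs]
  exact mul_le_mul_of_nonneg_right (hC _) (abs_nonneg _)

lemma correlation_sub {H : ℝ → ℂ} (hH : Measurable H) (hC : ∀ x, ‖H x‖ ≤ C) {κ κ' : ℝ → ℝ}
    (hκ : Integrable κ) (hκ' : Integrable κ') (u : ℝ) :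
    correlation H (fun v => κ v - κ' v) u = correlation H κ u - correlation H κ' u := by
  rw [correlation, correlation, correlation,
    ← integral_sub (integrable_correlation hH hC hκ u) (integrable_correlation hH hC hκ' u)]
  simp only [Complex.ofReal_sub, sub_mul]

lemma IsTest.integrable {S : Set ℝ} {φ : ℝ → ℝ} (hφ : IsTest S φ) : Integrable φ :=
  hφ.continuous.integrable_of_hasCompactSupport hφ.2

lemma IsTest.subset_Icc {S : Set ℝ} {φ : ℝ → ℝ} (hφ : IsTest S φ) :
    ∃ b : ℝ, 0 < b ∧ IsTest (Icc (-b) b) φ := by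
  obtain ⟨b, hb⟩ := hφ.2.isCompact.isBounded.subset_closedBall 0
  refine ⟨max b 1, by positivity, hφ.1, hφ.2, fun x hx => ?_⟩
  have := hb hx
  rw [mem_closedBall_zero_iff, Real.norm_eq_abs] at this
  exact abs_le.1 (this.trans (le_max_left _ _))

/-- Shifting the variable puts `u` into the smooth kernel, since `H` is only measurable. -/
lemma hasDerivAt_correlation {H : ℝ → ℂ} (hH : Measurable H) (hC : ∀ x, ‖H x‖ ≤ C) {S : Set ℝ}
    {φ : ℝ → ℝ} (hφ : IsTest S φ) (u : ℝ) :
    HasDerivAt (correlation H φ) (-correlation H (deriv φ) u) u := by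
  obtain ⟨b, hb, hφb⟩ := hφ.subset_Icc
  obtain ⟨K, hK⟩ := hφb.deriv.2.exists_bound_of_continuous hφb.deriv.continuous
  have hK0 : 0 ≤ K := (norm_nonneg _).trans (hK 0)
  have hC0 : 0 ≤ C := (norm_nonneg _).trans (hC 0)
  have hshift : ∀ (χ : ℝ → ℝ) (u : ℝ), correlation H χ u = ∫ v, (χ (v - u) : ℂ) * H v := by
    intro χ u
    rw [correlation, ← integral_sub_right_eq_self (fun v => (χ v : ℂ) * H (u + v)) u]
    simp
  have hsm : ∀ {χ : ℝ → ℝ}, Continuous χ → ∀ u,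
      AEStronglyMeasurable (fun v => (χ (v - u) : ℂ) * H v) volume := fun hχ u =>
    (Complex.continuous_ofReal.comp (hχ.comp (continuous_sub_right u))).aestronglyMeasurable.mul
      hH.aestronglyMeasurable
  have key := hasDerivAt_integral_of_dominated_loc_of_deriv_le (μ := volume) (𝕜 := ℝ) (x₀ := u)
    (F := fun u v => (φ (v - u) : ℂ) * H v)
    (F' := fun u v => ((-deriv φ (v - u) : ℝ) : ℂ) * H v)
    (bound := (Icc (u - b - 1) (u + b + 1)).indicator fun _ => K * C)
    (Metric.ball_mem_nhds u one_pos) (Eventually.of_forall fun u => hsm hφ.continuous u) ?_ ?_ ?_ ?_ ?_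
  · have h1 := key.2
    simp_rw [← hshift] at h1
    convert! h1 using 1
    rw [hshift, ← integral_neg]
    simp
  · have := (integrable_correlation hH hC hφ.integrable u).comp_sub_right u
    simpa using this
  · exact hsm hφ.deriv.continuous.neg u
  · refine ae_of_all _ fun v x hx => ?_
    by_cases hv : v ∈ Icc (u - b - 1) (u + b + 1)
    · rw [indicator_of_mem hv, norm_mul, Complex.norm_real, norm_neg]
      exact mul_le_mul (hK _) (hC _) (norm_nonneg _) hK0
    · rw [indicator_of_notMem hv]
      have h1 : v - x ∉ tsupport (deriv φ) := fun h2 => hv <| by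
        have h3 := hφb.deriv.3 h2
        have h4 := abs_lt.1 (Real.dist_eq x u ▸ Metric.mem_ball.1 hx)
        exact ⟨by linarith [h3.1], by linarith [h3.2]⟩
      simp [image_eq_zero_of_notMem_tsupport h1]
  · exact (integrable_indicator_iff measurableSet_Icc).2 (integrableOn_const (by simp))
  · refine ae_of_all _ fun v x _ => ?_
    have h1 : HasDerivAt (fun x => φ (v - x)) (-deriv φ (v - x)) x := by
      have h2 := (hφ.1.differentiable (by simp) (v - x)).hasDerivAt
      exact h2.comp_const_sub v x
    exact h1.ofReal_comp.mul_const _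

/-- With `f` the correlation against a kernel `χ`, the correlation against `logT χ` is `f + f'`; one
operator is removed at each step. -/
lemma tendsto_correlation_of_iterate_logT {H : ℝ → ℂ} (hH : Measurable H) (hC : ∀ x, ‖H x‖ ≤ C)
    {S : Set ℝ} {φ : ℝ → ℝ} (hφ : IsTest S φ) (n : ℕ)
    (hlim : Tendsto (correlation H (logT^[n] φ)) atBot (𝓝 0)) :
    Tendsto (correlation H φ) atBot (𝓝 0) := by
  induction n with
  | zero => exact hlim
  | succ n ih =>
    have hφn := IsTest.iterate (fun _ hf => hf.logT) n hφ
    refine ih (tendsto_zero_of_add_deriv (hasDerivAt_correlation hH hC hφn)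
      (norm_correlation_le hC hφn.integrable) ?_)
    rw [Function.iterate_succ_apply'] at hlim
    refine hlim.congr fun u => ?_
    rw [← sub_eq_add_neg, ← correlation_sub hH hC hφn.integrable hφn.deriv.integrable]
    rfl

/-- Test functions are dense in `L¹`, and the correlation with a bounded function is controlled by
the `L¹` norm of the kernel. -/
lemma tendsto_correlation_of_integrable {H : ℝ → ℂ} (hH : Measurable H) (hC : ∀ x, ‖H x‖ ≤ C)
    (hlim : ∀ φ, IsTest univ φ → Tendsto (correlation H φ) atBot (𝓝 0)) {κ : ℝ → ℝ}
    (hκ : Integrable κ) : Tendsto (correlation H κ) atBot (𝓝 0) := by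
  have hC0 : 0 ≤ C := (norm_nonneg _).trans (hC 0)
  rw [tendsto_zero_iff_norm_tendsto_zero, Metric.tendsto_nhds]
  intro ε hε
  obtain ⟨g, hgc, hgs, hg⟩ := (memLp_one_iff_integrable.2 hκ).exist_eLpNorm_sub_le
    ENNReal.one_ne_top le_rfl (ε := ε / (2 * (C + 1))) (by positivity)
  have hgt : IsTest univ g := ⟨hgs, hgc, subset_univ _⟩
  have hdi : Integrable fun v => κ v - g v := hκ.sub hgt.integrable
  have hint : ∫ v, |κ v - g v| ≤ ε / (2 * (C + 1)) := by
    rw [eLpNorm_one_eq_lintegral_enorm] at hg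
    have h1 := integral_norm_eq_lintegral_enorm hdi.aestronglyMeasurable
    simp only [Real.norm_eq_abs] at h1
    rw [h1]
    exact ENNReal.toReal_le_of_le_ofReal (by positivity) hg
  filter_upwards [(hlim g hgt).norm.eventually
    (gt_mem_nhds (show ‖(0 : ℂ)‖ < ε / 2 by simpa using half_pos hε))] with u hu
  have h2 := norm_correlation_le hC hdi u
  rw [correlation_sub hH hC hκ hgt.integrable] at h2
  have h3 : C * ∫ v, |κ v - g v| ≤ ε / 2 := by
    calc _ ≤ C * (ε / (2 * (C + 1))) := by gcongr
      _ = (C / (C + 1)) * (ε / 2) := by field_simp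
      _ ≤ 1 * (ε / 2) := by
        gcongr
        rw [div_le_one (by positivity)]
        linarith
      _ = ε / 2 := one_mul _
  have h4 := norm_sub_norm_le (correlation H κ u) (correlation H g u)
  rw [dist_zero_right, norm_norm]
  linarith

end

section

/-! ### The Cesàro mean of the representing function -/

variable {ρ r : ℝ} {G : ℂ → ℂ} {L : (ℝ → ℝ) → ℂ} {n m : ℕ} {h g : ℝ → ℂ} {B C : ℝ}

/-- The mean value of `g` between `0` and `x`. -/
def cesaro (g : ℝ → ℂ) (x : ℝ) : ℂ := ∫ t in (0 : ℝ)..1, g (x * t)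

lemma mul_cesaro (g : ℝ → ℂ) (x : ℝ) : (x : ℂ) * cesaro g x = ∫ t in (0 : ℝ)..x, g t := by
  rcases eq_or_ne x 0 with rfl | hx
  · simp
  · have hx' : (x : ℂ) ≠ 0 := by exact_mod_cast hx
    rw [cesaro, intervalIntegral.integral_comp_mul_left g hx, mul_zero, mul_one,
      Complex.real_smul, Complex.ofReal_inv, mul_inv_cancel_left₀ hx']

lemma cesaro_zero (h0 : g 0 = 0) : cesaro g 0 = 0 := by simp [cesaro, h0]

lemma norm_cesaro_le (hC : ∀ x, ‖g x‖ ≤ C) (x : ℝ) : ‖cesaro g x‖ ≤ C := by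
  simpa [cesaro] using intervalIntegral.norm_integral_le_of_norm_le_const
    (a := 0) (b := 1) (f := fun t => g (x * t)) fun t _ => hC (x * t)

lemma intervalIntegrable_of_bounded (hg : Measurable g) (hC : ∀ x, ‖g x‖ ≤ C) (a b : ℝ) :
    IntervalIntegrable g volume a b :=
  (intervalIntegrable_const (c := C)).mono_fun hg.aestronglyMeasurable
    (ae_of_all _ fun x => (hC x).trans (le_abs_self C))

/-- The substitution `t = exp v` turns the mean over `(0, 1)` into a correlation with the kernel
`exp v` on the negative half line, which is integrable but not smooth. -/
lemma cesaro_mul_exp (g : ℝ → ℂ) (c u : ℝ) :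
    cesaro g (c * Real.exp u) =
      correlation (fun s => g (c * Real.exp s)) ((Iio 0).indicator Real.exp) u := by
  have h1 := integral_expLift_mul ((Iio 0).indicator Real.exp) fun t => g (c * Real.exp u * t)
  have h2 : ∀ t : ℝ, (expLift ((Iio 0).indicator Real.exp) t : ℂ) * g (c * Real.exp u * t) =
      (Ioo (0 : ℝ) 1).indicator (fun t => g (c * Real.exp u * t)) t := by
    intro t
    by_cases ht : 0 < t
    · have h3 : Real.log t < 0 ↔ t < 1 := Real.log_neg_iff ht
      by_cases ht1 : t < 1
      · rw [indicator_of_mem (show t ∈ Ioo (0 : ℝ) 1 from ⟨ht, ht1⟩), expLift, if_pos ht,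
          indicator_of_mem (show Real.log t ∈ Iio (0 : ℝ) from h3.2 ht1), Real.exp_log ht,
          div_self ht.ne', Complex.ofReal_one, one_mul]
      · rw [indicator_of_notMem (fun h => ht1 h.2), expLift, if_pos ht,
          indicator_of_notMem (show Real.log t ∉ Iio (0 : ℝ) from fun h => ht1 (h3.1 h)), zero_div, Complex.ofReal_zero, zero_mul]
    · rw [indicator_of_notMem (fun h => ht h.1), expLift, if_neg ht, Complex.ofReal_zero, zero_mul]
  simp_rw [h2] at h1
  rw [integral_indicator measurableSet_Ioo] at h1
  rw [cesaro, intervalIntegral.integral_of_le zero_le_one, integral_Ioc_eq_integral_Ioo, h1]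
  simp only [correlation, Real.exp_add, mul_assoc]

lemma integrable_indicator_exp : Integrable ((Iio (0 : ℝ)).indicator Real.exp) :=
  (integrable_indicator_iff measurableSet_Iio).2 (integrableOn_exp_Iic 0 |>.mono_set Iio_subset_Iic_self)

lemma tendsto_cesaro_mul_exp (hg : Measurable g) (hC : ∀ x, ‖g x‖ ≤ C) (c : ℝ)
    (hlim : ∀ φ, IsTest univ φ →
      Tendsto (correlation (fun s => g (c * Real.exp s)) φ) atBot (𝓝 0)) :
    Tendsto (fun u => cesaro g (c * Real.exp u)) atBot (𝓝 0) := by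
  simp_rw [cesaro_mul_exp]
  exact tendsto_correlation_of_integrable (H := fun s => g (c * Real.exp s))
    (hg.comp (by fun_prop)) (fun _ => hC _) hlim integrable_indicator_exp

/-- Away from `0` the mean is a continuous primitive divided by `x`; at `0` the hypotheses are the
two lateral limits in logarithmic form. -/
lemma continuous_cesaro (hg : Measurable g) (hC : ∀ x, ‖g x‖ ≤ C) (h0 : g 0 = 0)
    (hr : Tendsto (fun u => cesaro g (1 * Real.exp u)) atBot (𝓝 0))
    (hl : Tendsto (fun u => cesaro g (-1 * Real.exp u)) atBot (𝓝 0)) :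
    Continuous (cesaro g) := by
  rw [continuous_iff_continuousAt]
  intro x
  rcases eq_or_ne x 0 with rfl | hx
  · have hr' : Tendsto (cesaro g) (𝓝[>] 0) (𝓝 0) := by
      refine (hr.comp Real.tendsto_log_nhdsGT_zero).congr' ?_
      filter_upwards [self_mem_nhdsWithin] with t ht
      rw [Function.comp_apply, Real.exp_log ht, one_mul]
    have hl' : Tendsto (cesaro g) (𝓝[<] 0) (𝓝 0) := by
      refine ((hl.comp Real.tendsto_log_nhdsGT_zero).comp
        (show Tendsto (fun t : ℝ => -t) (𝓝[<] 0) (𝓝[>] 0) by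
          simpa using tendsto_neg_nhdsLT (a := (0 : ℝ)))).congr' ?_
      filter_upwards [self_mem_nhdsWithin] with t ht
      rw [Function.comp_apply, Function.comp_apply, Real.exp_log (neg_pos.2 ht), neg_one_mul,
        neg_neg]
    rw [continuousAt_iff_punctured_nhds, cesaro_zero h0, ← nhdsLT_sup_nhdsGT]
    exact hl'.sup hr'
  · have h1 : ContinuousAt (fun x : ℝ => (x : ℂ)⁻¹ * ∫ t in (0 : ℝ)..x, g t) x :=
      (Complex.continuous_ofReal.continuousAt.inv₀ (by exact_mod_cast hx)).mul
        (intervalIntegral.continuous_primitive (intervalIntegrable_of_bounded hg hC) 0).continuousAt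
    refine h1.congr ?_
    filter_upwards [isOpen_ne.mem_nhds hx] with y hy
    have hy' : (y : ℂ) ≠ 0 := by exact_mod_cast hy
    rw [← mul_cesaro, inv_mul_cancel_left₀ hy']

/-- Weak form of `(x * cesaro g x)' = g x`, by parts. Continuity of `g` is needed only near the
support of `ψ`. -/
lemma integral_eulerT_mul_cesaro (hg : Measurable g) (hC : ∀ x, ‖g x‖ ≤ C) {U : Set ℝ}
    (hU : IsOpen U) (hgU : ContinuousOn g U) {ψ : ℝ → ℝ} (hψ : IsTest U ψ) :
    ∫ x, ((eulerT ψ x : ℝ) : ℂ) * cesaro g x = ∫ x, (ψ x : ℂ) * g x := by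
  have hi := intervalIntegrable_of_bounded hg hC
  have hP : Continuous fun x : ℝ => ∫ t in (0 : ℝ)..x, g t := intervalIntegral.continuous_primitive hi 0
  have hi1 : Integrable fun x => ((deriv ψ x : ℝ) : ℂ) * ∫ t in (0 : ℝ)..x, g t :=
    ((Complex.continuous_ofReal.comp hψ.deriv.continuous).mul hP).integrable_of_hasCompactSupport
      ((hψ.deriv.2.comp_left (g := fun x : ℝ => (x : ℂ)) rfl).mul_right)
  have hi0 : Integrable fun x => (ψ x : ℂ) * ∫ t in (0 : ℝ)..x, g t :=
    ((Complex.continuous_ofReal.comp hψ.continuous).mul hP).integrable_of_hasCompactSupport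
      ((hψ.2.comp_left (g := fun x : ℝ => (x : ℂ)) rfl).mul_right)
  have hi2 : Integrable fun x => (ψ x : ℂ) * g x :=
    hψ.integrable.ofReal.mul_bdd (c := C) hg.aestronglyMeasurable (ae_of_all _ hC)
  have hd : ∀ x, HasDerivAt (fun x => (ψ x : ℂ) * ∫ t in (0 : ℝ)..x, g t)
      (((deriv ψ x : ℝ) : ℂ) * (∫ t in (0 : ℝ)..x, g t) + (ψ x : ℂ) * g x) x := by
    intro x
    by_cases hx : x ∈ tsupport ψ
    · have h1 := intervalIntegral.integral_hasDerivAt_right (hi 0 x)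
        (hg.stronglyMeasurable.stronglyMeasurableAtFilter)
        (hgU.continuousAt (hU.mem_nhds (hψ.3 hx)))
      exact ((hψ.1.differentiable (by simp) x).hasDerivAt.ofReal_comp).mul h1
    · have h2 : deriv ψ x = 0 := by
        rw [(notMem_tsupport_iff_eventuallyEq.1 hx).deriv_eq]
        simp
      rw [h2, image_eq_zero_of_notMem_tsupport hx, Complex.ofReal_zero, zero_mul, zero_mul, add_zero]
      refine (hasDerivAt_const x (0 : ℂ)).congr_of_eventuallyEq ?_
      filter_upwards [notMem_tsupport_iff_eventuallyEq.1 hx] with y hy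
      simp [hy]
  have h0 := integral_eq_zero_of_hasDerivAt_of_integrable hd (hi1.add hi2) hi0
  rw [integral_add hi1 hi2] at h0
  have h3 : ∫ x, ((eulerT ψ x : ℝ) : ℂ) * cesaro g x =
      -∫ x, ((deriv ψ x : ℝ) : ℂ) * ∫ t in (0 : ℝ)..x, g t := by
    rw [← integral_neg]
    refine integral_congr_ae (ae_of_all _ fun x => ?_)
    simp only [eulerT, ← mul_cesaro]
    push_cast
    ring
  rw [h3]
  linear_combination -h0

/-! ### Cutoffs at small scales -/

lemma iterate_add_of_isTest {T : (ℝ → ℝ) → ℝ → ℝ} {S : Set ℝ}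
    (hT : ∀ φ, IsTest S φ → IsTest S (T φ))
    (hadd : ∀ φ ψ, IsTest S φ → IsTest S ψ → T (fun x => φ x + ψ x) = fun x => T φ x + T ψ x)
    (n : ℕ) {φ ψ : ℝ → ℝ} (hφ : IsTest S φ) (hψ : IsTest S ψ) :
    T^[n] (fun x => φ x + ψ x) = fun x => T^[n] φ x + T^[n] ψ x := by
  induction n generalizing φ ψ with
  | zero => rfl
  | succ n ih => rw [Function.iterate_succ_apply, hadd φ ψ hφ hψ, ih (hT _ hφ) (hT _ hψ)]; rfl

lemma IsTest.deriv_add {S : Set ℝ} {φ ψ : ℝ → ℝ} (hφ : IsTest S φ) (hψ : IsTest S ψ) :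
    _root_.deriv (fun x => φ x + ψ x) = fun x => _root_.deriv φ x + _root_.deriv ψ x := by
  ext x
  exact deriv_fun_add (hφ.1.differentiable (by simp) x) (hψ.1.differentiable (by simp) x)

lemma IsTest.eulerT_add {S : Set ℝ} {φ ψ : ℝ → ℝ} (hφ : IsTest S φ) (hψ : IsTest S ψ) :
    BoundaryValue.eulerT (fun x => φ x + ψ x) =
      fun x => BoundaryValue.eulerT φ x + BoundaryValue.eulerT ψ x := by
  ext x
  simp only [BoundaryValue.eulerT, hφ.deriv_add hψ]
  ring

lemma IsTest.iterate_eulerT_add {S : Set ℝ} {φ ψ : ℝ → ℝ} (hφ : IsTest S φ) (hψ : IsTest S ψ)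
    (n : ℕ) : BoundaryValue.eulerT^[n] (fun x => φ x + ψ x) =
      fun x => BoundaryValue.eulerT^[n] φ x + BoundaryValue.eulerT^[n] ψ x :=
  iterate_add_of_isTest (fun _ h => h.eulerT) (fun _ _ h h' => h.eulerT_add h') n hφ hψ

lemma IsTest.iterate_deriv_add {S : Set ℝ} {φ ψ : ℝ → ℝ} (hφ : IsTest S φ) (hψ : IsTest S ψ)
    (n : ℕ) : _root_.deriv^[n] (fun x => φ x + ψ x) =
      fun x => _root_.deriv^[n] φ x + _root_.deriv^[n] ψ x :=
  iterate_add_of_isTest (fun _ h => h.deriv) (fun _ _ h h' => h.deriv_add h') n hφ hψ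

lemma IsTest.const_mul {S : Set ℝ} {φ : ℝ → ℝ} (hφ : IsTest S φ) (c : ℝ) :
    IsTest S fun x => c * φ x :=
  ⟨contDiff_const.mul hφ.1, hφ.2.mul_left, tsupport_mul_subset_right.trans hφ.3⟩

lemma IsTest.add {S : Set ℝ} {φ ψ : ℝ → ℝ} (hφ : IsTest S φ) (hψ : IsTest S ψ) :
    IsTest S fun x => φ x + ψ x :=
  ⟨hφ.1.add hψ.1, hφ.2.add hψ.2, (tsupport_add φ ψ).trans (union_subset hφ.3 hψ.3)⟩

lemma IsTest.mul {S S' : Set ℝ} {φ ψ : ℝ → ℝ} (hφ : IsTest S φ) (hψ : IsTest S' ψ) :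
    IsTest (S ∩ S') fun x => φ x * ψ x :=
  ⟨hφ.1.mul hψ.1, hψ.2.mul_left, subset_inter (tsupport_mul_subset_left.trans hφ.3)
    (tsupport_mul_subset_right.trans hψ.3)⟩

lemma IsTest.exists_abs_le {S : Set ℝ} {φ : ℝ → ℝ} (hφ : IsTest S φ) : ∃ M, ∀ x, |φ x| ≤ M :=
  hφ.2.exists_bound_of_continuous hφ.continuous

lemma IsTest.comp_div_mul {χ φ : ℝ → ℝ} (hχ : IsTest univ χ) (hφ : IsTest univ φ) {ε : ℝ}
    (hε : 0 < ε) : IsTest univ fun x => χ (x / ε) * φ x :=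
  ((isTest_comp_div hε.ne' hχ (S' := univ) fun _ _ => mem_univ _).mul hφ).mono (subset_univ _)

lemma abs_comp_div_mul_le {χ φ : ℝ → ℝ} {M₁ M₂ : ℝ} (h₁ : ∀ x, |χ x| ≤ M₁) (h₂ : ∀ x, |φ x| ≤ M₂)
    (ε x : ℝ) : |χ (x / ε) * φ x| ≤ M₁ * M₂ := by
  rw [abs_mul]
  exact mul_le_mul (h₁ _) (h₂ _) (abs_nonneg _) ((abs_nonneg _).trans (h₁ 0))

/-- The transposed Euler operator is a derivation commuting with dilations, so the Leibniz rule
produces no negative power of `ε`. -/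
lemma exists_bound_iterate_eulerT_cutoff (n : ℕ) {χ φ : ℝ → ℝ} (hχ : IsTest univ χ)
    (hφ : IsTest univ φ) :
    ∃ M, ∀ ε : ℝ, 0 < ε → ∀ x, |eulerT^[n] (fun x => χ (x / ε) * φ x) x| ≤ M := by
  induction n generalizing χ φ with
  | zero =>
    obtain ⟨M₁, h₁⟩ := hχ.exists_abs_le
    obtain ⟨M₂, h₂⟩ := hφ.exists_abs_le
    exact ⟨M₁ * M₂, fun ε _ x => abs_comp_div_mul_le h₁ h₂ ε x⟩
  | succ n ih =>
    obtain ⟨M₁, h₁⟩ := ih hχ.eulerT hφ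
    obtain ⟨M₂, h₂⟩ := ih hχ hφ.eulerT
    refine ⟨M₁ + M₂, fun ε hε x => ?_⟩
    have he : eulerT (fun x => χ (x / ε) * φ x) =
        fun x => eulerT χ (x / ε) * φ x + χ (x / ε) * eulerT φ x := by
      have h3 := eulerT_comp_div χ ε
      ext x
      have h4 := congr_fun h3 x
      have h5 : DifferentiableAt ℝ (fun x => χ (x / ε)) x :=
        (hχ.1.comp (contDiff_id.div_const ε)).differentiable (by simp) x
      simp only [eulerT] at h4 ⊢
      rw [deriv_fun_mul h5 (hφ.1.differentiable (by simp) x)]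
      linear_combination φ x * h4
    rw [Function.iterate_succ_apply, he,
      (hχ.eulerT.comp_div_mul hφ hε).iterate_eulerT_add (hχ.comp_div_mul hφ.eulerT hε)]
    exact (abs_add_le _ _).trans (add_le_add (h₁ ε hε x) (h₂ ε hε x))

/-- Each derivative falling on the cutoff costs `ε⁻¹`, which the factor `ε ^ j` pays for; those
falling on `φ` leave a spare power, harmless since `ε ≤ 1`. -/
lemma exists_bound_iterate_deriv_cutoff (j : ℕ) {χ φ : ℝ → ℝ} (hχ : IsTest univ χ)
    (hφ : IsTest univ φ) :
    ∃ M, ∀ ε : ℝ, 0 < ε → ε ≤ 1 →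
      ∀ x, ε ^ j * |deriv^[j] (fun x => χ (x / ε) * φ x) x| ≤ M := by
  induction j generalizing χ φ with
  | zero =>
    obtain ⟨M₁, h₁⟩ := hχ.exists_abs_le
    obtain ⟨M₂, h₂⟩ := hφ.exists_abs_le
    refine ⟨M₁ * M₂, fun ε _ _ x => ?_⟩
    rw [pow_zero, one_mul]
    exact abs_comp_div_mul_le h₁ h₂ ε x
  | succ j ih =>
    obtain ⟨M₁, h₁⟩ := ih hχ.deriv hφ
    obtain ⟨M₂, h₂⟩ := ih hχ hφ.deriv
    refine ⟨M₁ + M₂, fun ε hε hε1 x => ?_⟩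
    have he : deriv (fun x => χ (x / ε) * φ x) =
        fun x => ε⁻¹ * (deriv χ (x / ε) * φ x) + χ (x / ε) * deriv φ x := by
      ext x
      have h5 : HasDerivAt (fun x => χ (x / ε)) (deriv χ (x / ε) * (1 / ε)) x :=
        (hχ.1.differentiable (by simp) (x / ε)).hasDerivAt.comp x ((hasDerivAt_id x).div_const ε)
      rw [(h5.fun_mul (hφ.1.differentiable (by simp) x).hasDerivAt).deriv]
      ring
    have h6 := hχ.deriv.comp_div_mul hφ hε
    have h7 : deriv^[j] (fun x => ε⁻¹ * (deriv χ (x / ε) * φ x)) x =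
        ε⁻¹ * deriv^[j] (fun x => deriv χ (x / ε) * φ x) x := by
      rw [← iteratedDeriv_eq_iterate, iteratedDeriv_const_mul_field, iteratedDeriv_eq_iterate]
    rw [Function.iterate_succ_apply, he,
      (h6.const_mul ε⁻¹).iterate_deriv_add (hχ.comp_div_mul hφ.deriv hε)]
    beta_reduce
    rw [h7]
    have h8 := h₂ ε hε hε1 x
    have h9 : ε ^ (j + 1) * |ε⁻¹ * deriv^[j] (fun x => deriv χ (x / ε) * φ x) x| =
        ε ^ j * |deriv^[j] (fun x => deriv χ (x / ε) * φ x) x| := by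
      rw [abs_mul, abs_of_pos (inv_pos.2 hε), pow_succ]
      field_simp
    have h10 : ε ^ (j + 1) * |deriv^[j] (fun x => χ (x / ε) * deriv φ x) x| ≤
        ε ^ j * |deriv^[j] (fun x => χ (x / ε) * deriv φ x) x| :=
      mul_le_mul_of_nonneg_right (pow_le_pow_of_le_one hε.le hε1 j.le_succ) (abs_nonneg _)
    calc _ ≤ ε ^ (j + 1) * (|ε⁻¹ * deriv^[j] (fun x => deriv χ (x / ε) * φ x) x| +
          |deriv^[j] (fun x => χ (x / ε) * deriv φ x) x|) :=
          mul_le_mul_of_nonneg_left (abs_add_le _ _) (by positivity)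
      _ ≤ _ := by
        rw [mul_add, h9]
        exact add_le_add (h₁ ε hε hε1 x) (h10.trans h8)

end

section

/-! ### The representation by a continuous function -/

variable {ρ r : ℝ} {G : ℂ → ℂ} {L : (ℝ → ℝ) → ℂ} {n m : ℕ} {h : ℝ → ℂ} {B C : ℝ}

/-- `L` is a bare function on functions; its additivity is inherited from the line integrals in the
limit. -/
lemma BoundaryData.map_add (D : BoundaryData ρ G L n h C) {φ ψ : ℝ → ℝ}
    (hφ : IsTest (Ioo (-ρ) ρ) φ) (hψ : IsTest (Ioo (-ρ) ρ) ψ) :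
    L (fun x => φ x + ψ x) = L φ + L ψ := by
  refine tendsto_nhds_unique (D.tendsto _ (hφ.add hψ))
    (((D.tendsto _ hφ).add (D.tendsto _ hψ)).congr' ?_)
  filter_upwards [Ioo_mem_nhdsGT D.pos] with y hy
  exact (lineInt_add (isOpen_rect ρ) D.diff.continuousOn hφ hψ
    fun v hv => mem_rect_of_line hv hy).symm

lemma isOpen_punctured (ρ : ℝ) : IsOpen (Ioo (-ρ) ρ \ {0}) := isOpen_Ioo.sdiff isClosed_singleton

/-- Extending `h` by zero gives a function that is bounded and measurable on the whole line, as
correlations and Cesàro means require. -/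
lemma BoundaryData.indicator (D : BoundaryData ρ G L n h C) :
    BoundaryData ρ G L n ((Ioo (-ρ) ρ \ {0}).indicator h) C where
  pos := D.pos
  diff := D.diff
  tendsto := D.tendsto
  contOn := D.contOn.congr fun x hx => indicator_of_mem hx h
  bound x hx := by rw [indicator_of_mem hx]; exact D.bound x hx
  repr φ hφ := by
    rw [D.repr φ hφ]
    refine integral_congr_ae (ae_of_all _ fun x => ?_)
    by_cases hx : x ∈ Ioo (-ρ) ρ \ {0}
    · simp only [indicator_of_mem hx]
    · have h1 := image_eq_zero_of_notMem_tsupport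
        fun h2 => hx ((IsTest.iterate (fun _ hf => hf.eulerT) n hφ).3 h2)
      simp [h1]
  right := D.right

lemma BoundaryData.measurable_indicator (D : BoundaryData ρ G L n h C) :
    Measurable ((Ioo (-ρ) ρ \ {0}).indicator h) := by
  classical
  rw [← piecewise_eq_indicator]
  exact D.contOn.measurable_piecewise continuousOn_const (isOpen_punctured ρ).measurableSet

lemma BoundaryData.norm_indicator_le (D : BoundaryData ρ G L n h C) (x : ℝ) :
    ‖(Ioo (-ρ) ρ \ {0}).indicator h x‖ ≤ C := by
  by_cases hx : x ∈ Ioo (-ρ) ρ \ {0}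
  · rw [indicator_of_mem hx]
    exact D.bound x hx
  · rw [indicator_of_notMem hx, norm_zero]
    exact D.nonneg

/-- A sign `σ` and a scale `exp u` combine into one dilation, under which `L` of a lift is the
correlation of `h (σ exp s)` with `logT^[n] φ`; the iterates of `logT` are then removed. -/
lemma BoundaryData.tendsto_correlation (D : BoundaryData ρ G L n h C) (hm : Measurable h)
    (hC : ∀ x, ‖h x‖ ≤ C) (hlim : ∀ φ, IsTest univ φ → Tendsto (fun ε : ℝ => L (dil φ ε)) (𝓝[>] 0) (𝓝 0))
    {σ : ℝ} (hσ : |σ| = 1) {φ : ℝ → ℝ} (hφ : IsTest univ φ) :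
    Tendsto (correlation (fun s => h (σ * Real.exp s)) φ) atBot (𝓝 0) := by
  obtain ⟨b, hb, hφb⟩ := hφ.subset_Icc
  have hσ0 : σ ≠ 0 := by
    rintro rfl
    simp at hσ
  refine tendsto_correlation_of_iterate_logT (H := fun s => h (σ * Real.exp s))
    (hm.comp (by fun_prop)) (fun _ => hC _) hφ n ?_
  have h1 : IsTest univ (dil (expLift φ) σ) := isTest_dil hσ0 (isTest_expLift hφb) fun _ _ => mem_univ _
  have h2 : Tendsto Real.exp atBot (𝓝[>] 0) :=
    tendsto_nhdsWithin_iff.2 ⟨Real.tendsto_exp_atBot, Eventually.of_forall Real.exp_pos⟩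
  refine ((hlim _ h1).comp h2).congr' ?_
  have h3 : ∀ᶠ u in atBot, Real.exp u < ρ / Real.exp b :=
    Real.tendsto_exp_atBot.eventually (gt_mem_nhds (div_pos D.pos (Real.exp_pos b)))
  filter_upwards [h3] with u hu
  have habs : |σ * Real.exp u| = Real.exp u := by
    rw [abs_mul, hσ, one_mul, abs_of_pos (Real.exp_pos u)]
  have h4 := D.apply_dil_expLift hφb (c := σ * Real.exp u)
    (mul_ne_zero hσ0 (Real.exp_pos u).ne') (by
      rw [habs]
      exact (lt_div_iff₀ (Real.exp_pos b)).1 hu)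
  have h5 : dil (dil (expLift φ) σ) (Real.exp u) = dil (expLift φ) (σ * Real.exp u) := by
    ext x
    simp only [dil, habs, hσ, abs_of_pos (Real.exp_pos u), div_div]
    rw [inv_one, one_mul, mul_comm (Real.exp u) σ]
  rw [Function.comp_apply, h5, h4]
  simp only [correlation, Real.exp_add, mul_assoc]

/-- A smooth cutoff equal to one near the origin. -/
lemma exists_cutoff : ∃ χ : ℝ → ℝ, IsTest (Icc (-1) 1) χ ∧ ∀ x ∈ Icc (-(1 / 2) : ℝ) (1 / 2), χ x = 1 := by
  let χ : ContDiffBump (0 : ℝ) := ⟨1 / 2, 1, by norm_num, by norm_num⟩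
  refine ⟨χ, ⟨χ.contDiff, χ.hasCompactSupport, ?_⟩, fun x hx => ?_⟩
  · rw [χ.tsupport_eq, Real.closedBall_eq_Icc]
    exact fun x hx => by simpa [χ] using hx
  · refine χ.one_of_mem_closedBall ?_
    rw [Real.closedBall_eq_Icc]
    simpa [χ] using hx

lemma isTest_cutoff_mul {χ φ : ℝ → ℝ} {S : Set ℝ} (hχ : IsTest (Icc (-1) 1) χ) (hφ : IsTest S φ)
    {ε : ℝ} (hε : 0 < ε) : IsTest (Icc (-ε) ε ∩ S) fun x => χ (x / ε) * φ x := by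
  refine (isTest_comp_div hε.ne' hχ fun x hx => ?_).mul hφ
  constructor <;> nlinarith [hx.1, hx.2]

lemma isTest_sub_cutoff_mul {χ φ : ℝ → ℝ} {S : Set ℝ} (hχ : IsTest (Icc (-1) 1) χ)
    (h1 : ∀ x ∈ Icc (-(1 / 2) : ℝ) (1 / 2), χ x = 1) (hφ : IsTest S φ) {ε : ℝ} (hε : 0 < ε) :
    IsTest (S \ {0}) fun x => (1 - χ (x / ε)) * φ x := by
  have hc : ContDiff ℝ ∞ fun x => 1 - χ (x / ε) :=
    contDiff_const.sub (hχ.1.comp (contDiff_id.div_const ε))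
  refine ⟨hc.mul hφ.1, hφ.2.mul_left, fun x hx => ⟨hφ.3 (tsupport_mul_subset_right hx), ?_⟩⟩
  rintro rfl
  refine notMem_tsupport_iff_eventuallyEq.2 ?_ hx
  filter_upwards [Icc_mem_nhds (show -(ε / 2) < 0 by linarith) (half_pos hε)] with y hy
  rw [h1 (y / ε), sub_self, zero_mul, Pi.zero_apply]
  constructor
  · rw [le_div_iff₀ hε]; linarith [hy.1]
  · rw [div_le_iff₀ hε]; linarith [hy.2]

/-- If the distribution is represented by a bounded continuous function away from `0` and it is
controlled by an analytic function obeying an angular bound, then it is represented near `0`. -/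
lemma BoundaryData.repr_of_punctured (D : BoundaryData ρ G L n h C) (hB : AngularBound G r B m)
    (hB0 : 0 ≤ B) (hr0 : 0 < r) (hr : r < ρ) {k : ℝ → ℂ} (hk : Continuous k) (hkC : ∀ x, ‖k x‖ ≤ C)
    {N : ℕ} (hrepr : ∀ φ, IsTest (Ioo (-ρ) ρ \ {0}) φ → L φ = ∫ x, ((eulerT^[N] φ x : ℝ) : ℂ) * k x)
    {φ : ℝ → ℝ} (hφ : IsTest (Ioo (-ρ) ρ) φ) : L φ = ∫ x, ((eulerT^[N] φ x : ℝ) : ℂ) * k x := by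
  obtain ⟨χ, hχ, hχ1⟩ := exists_cutoff
  have hiter : ∀ {S : Set ℝ} {ψ : ℝ → ℝ}, IsTest S ψ → IsTest S (eulerT^[N] ψ) :=
    fun hψ => IsTest.iterate (fun _ hf => hf.eulerT) N hψ
  have hχu := hχ.mono (subset_univ _)
  have hφu := hφ.mono (subset_univ _)
  obtain ⟨M₁, hM₁⟩ := exists_bound_iterate_eulerT_cutoff N hχu hφu
  choose M₂ hM₂ using fun j => exists_bound_iterate_deriv_cutoff j hχu hφu
  set M := ∑ j ∈ Finset.range (m + 2), |M₂ j|
  have hint : ∀ {S : Set ℝ} {ψ : ℝ → ℝ}, IsTest S ψ →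
      Integrable fun x => ((eulerT^[N] ψ x : ℝ) : ℂ) * k x := fun hψ =>
    (hiter hψ).integrable.ofReal.mul_bdd (c := C) hk.aestronglyMeasurable (ae_of_all _ hkC)
  have hC0 : 0 ≤ C := D.nonneg
  -- The first summand bounds `L` on the part of `φ` near `0`, by the angular bound; the second
  -- bounds the integral, whose integrand is bounded on an interval of length `2 ε`.
  set K := ((m + 1) * (2 * B * 2 ^ m) + 2 * B * 2 ^ m) * M + C * (2 * M₁) with hK
  have key : ∀ ε : ℝ, 0 < ε → ε ≤ 1 → 2 * ε ≤ r →
      ‖L φ - ∫ x, ((eulerT^[N] φ x : ℝ) : ℂ) * k x‖ ≤ K * ε := by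
    intro ε hε hε1 hεr
    have hs := isTest_cutoff_mul hχ hφ hε
    have ho := isTest_sub_cutoff_mul hχ hχ1 hφ hε
    have hsplit : φ = fun x => χ (x / ε) * φ x + (1 - χ (x / ε)) * φ x := by
      ext x
      ring
    have hL : L φ = L (fun x => χ (x / ε) * φ x) + L fun x => (1 - χ (x / ε)) * φ x := by
      conv_lhs => rw [hsplit]
      exact D.map_add (hs.mono inter_subset_right) (ho.mono sdiff_subset)
    have hJ : ∫ x, ((eulerT^[N] φ x : ℝ) : ℂ) * k x =
        (∫ x, ((eulerT^[N] (fun x => χ (x / ε) * φ x) x : ℝ) : ℂ) * k x) +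
          ∫ x, ((eulerT^[N] (fun x => (1 - χ (x / ε)) * φ x) x : ℝ) : ℂ) * k x := by
      rw [← integral_add (hint hs) (hint ho)]
      conv_lhs => rw [hsplit]
      rw [(hs.mono inter_subset_right).iterate_eulerT_add (ho.mono sdiff_subset)]
      simp only [Complex.ofReal_add, add_mul]
    have hLs := norm_boundary_le_of_scale D.diff D.tendsto hB hB0 hr hε hεr
      (hs.mono inter_subset_left) (M := M) fun j hj x =>
        (hM₂ j ε hε hε1 x).trans ((le_abs_self _).trans
          (Finset.single_le_sum (f := fun j => |M₂ j|) (fun _ _ => abs_nonneg _)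
            (Finset.mem_range.2 (by omega))))
    have hJs : ‖∫ x, ((eulerT^[N] (fun x => χ (x / ε) * φ x) x : ℝ) : ℂ) * k x‖ ≤
        C * (2 * ε * M₁) := by
      have h1 := integral_abs_le_of_tsupport hε.le (hiter (hs.mono inter_subset_left)) (hM₁ ε hε)
      refine le_trans ?_ (mul_le_mul_of_nonneg_left h1 hC0)
      rw [← integral_const_mul]
      refine norm_integral_le_of_norm_le ((hiter hs).integrable.abs.const_mul C)
        (ae_of_all _ fun v => ?_)
      rw [norm_mul, Complex.norm_real, mul_comm, Real.norm_eq_abs]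
      exact mul_le_mul_of_nonneg_right (hkC _) (abs_nonneg _)
    rw [hL, hJ, hrepr _ ho, add_sub_add_right_eq_sub]
    refine (norm_sub_le _ _).trans ((add_le_add hLs hJs).trans (le_of_eq ?_))
    rw [hK]
    ring
  -- The difference does not depend on `ε` and is `O(ε)`, hence zero.
  rw [← sub_eq_zero, ← norm_le_zero_iff]
  have hlim : Tendsto (fun ε => K * ε) (𝓝[>] 0) (𝓝 0) := by
    simpa using ((continuous_const_mul K).tendsto 0).mono_left nhdsWithin_le_nhds
  refine ge_of_tendsto hlim ?_
  filter_upwards [Ioo_mem_nhdsGT (show (0 : ℝ) < min 1 (r / 2) by positivity)] with ε hε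
  have h1 := hε.2.le.trans (min_le_left _ _)
  have h2 := hε.2.le.trans (min_le_right _ _)
  exact key ε hε.1 h1 (by linarith)

/-- The conclusions for a boundary value centred at the origin with lateral limit zero. -/
theorem BoundaryData.conclusions (D : BoundaryData ρ G L n h C) :
    (∀ M : ℝ, Tendsto G (𝓝[{z : ℂ | 0 < z.im ∧ |z.re| ≤ M * z.im}] 0) (𝓝 0)) ∧
    (∀ φ, IsTest univ φ → Tendsto (fun ε : ℝ => L (dil φ ε)) (𝓝[>] 0) (𝓝 0)) ∧
    ∃ k : ℝ → ℂ, Continuous k ∧ k 0 = 0 ∧ ∀ φ, IsTest (Ioo (-ρ) ρ) φ →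
      L φ = ∫ x, ((eulerT^[n + 1] φ x : ℝ) : ℂ) * k x := by
  obtain ⟨⟨r, hr0, hr, -, B, hB0, hB⟩, hang⟩ := D.exists_bound_and_tendsto
  have hlim : ∀ φ, IsTest univ φ → Tendsto (fun ε : ℝ => L (dil φ ε)) (𝓝[>] 0) (𝓝 0) :=
    fun φ hφ => tendsto_boundary_dil D.diff D.tendsto hB hB0 hr0 hr hang hφ
  set g := (Ioo (-ρ) ρ \ {0}).indicator h
  have hg : Measurable g := D.measurable_indicator
  have hgC : ∀ x, ‖g x‖ ≤ C := D.norm_indicator_le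
  have hg0 : g 0 = 0 := indicator_of_notMem (by simp) h
  have hside : ∀ σ : ℝ, |σ| = 1 → Tendsto (fun u => cesaro g (σ * Real.exp u)) atBot (𝓝 0) :=
    fun σ hσ => tendsto_cesaro_mul_exp hg hgC σ fun φ hφ =>
      D.indicator.tendsto_correlation hg hgC hlim hσ hφ
  have hk : Continuous (cesaro g) :=
    continuous_cesaro hg hgC hg0 (hside 1 (by simp)) (hside (-1) (by simp))
  refine ⟨hang, hlim, cesaro g, hk, cesaro_zero hg0, fun φ hφ => ?_⟩
  refine D.repr_of_punctured hB hB0 hr0 hr hk (norm_cesaro_le hgC) (fun ψ hψ => ?_) hφ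
  -- The outermost of the `n + 1` operators is absorbed by passing from the Cesàro mean back to `g`.
  rw [Function.iterate_succ_apply', integral_eulerT_mul_cesaro hg hgC (isOpen_punctured ρ)
    D.indicator.contOn (IsTest.iterate (fun _ hf => hf.eulerT) n hψ)]
  exact D.indicator.repr ψ hψ

end

section

/-! ### Translation to distributions on an interval -/

variable {Ω : Opens ℝ} {ρ : ℝ} {n : ℕ}

lemma isTest_coe (Φ : 𝓓(Ω, ℝ)) : IsTest Ω Φ :=
  ⟨Φ.contDiff, Φ.hasCompactSupport, Φ.tsupport_subset⟩

open scoped Classical in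
/-- The bundled test function on `Ω` given by `φ`, or `0` if `φ` is not a test function on `Ω`. -/
def testOf (Ω : Opens ℝ) (φ : ℝ → ℝ) : 𝓓(Ω, ℝ) :=
  if h : IsTest Ω φ then ⟨φ, h.1, h.2, h.3⟩ else 0

lemma coe_testOf {φ : ℝ → ℝ} (hφ : IsTest Ω φ) : ⇑(testOf Ω φ) = φ := by
  rw [testOf, dif_pos hφ]
  rfl

lemma testOf_coe (Φ : 𝓓(Ω, ℝ)) : testOf Ω Φ = Φ := DFunLike.coe_injective (coe_testOf (isTest_coe Φ))

lemma isTest_comp_sub {S S' : Set ℝ} {φ : ℝ → ℝ} (hφ : IsTest S φ) {c : ℝ}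
    (hS : ∀ x ∈ S, x + c ∈ S') : IsTest S' fun x => φ (x - c) := by
  refine isTest_of_forall_notMem (hφ.1.comp (by fun_prop)) (K := (fun x => x + c) '' tsupport φ)
    (hφ.2.isCompact.image (by fun_prop)) ?_ fun x hx => ?_
  · rintro _ ⟨x, hx, rfl⟩
    exact hS x (hφ.3 hx)
  · exact image_eq_zero_of_notMem_tsupport fun h1 => hx ⟨x - c, h1, by simp⟩

lemma coe_transposeD_iterate {c : ℝ} (n : ℕ) {Φ : 𝓓(Ω, ℝ)} {φ : ℝ → ℝ}
    (h : ∀ x, Φ x = φ (x - c)) (x : ℝ) : ((transposeD c)^[n] Φ) x = eulerT^[n] φ (x - c) := by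
  induction n generalizing Φ φ with
  | zero => exact h x
  | succ n ih =>
    refine ih fun x => ?_
    change -((x - c) * deriv Φ x) = -((x - c) * deriv φ (x - c))
    rw [funext h, deriv_comp_sub_const]

lemma tsupport_transposeD_iterate_subset (c : ℝ) (n : ℕ) (Φ : 𝓓(Ω, ℝ)) :
    tsupport ((transposeD c)^[n] Φ) ⊆ tsupport Φ := by
  induction n generalizing Φ with
  | zero => exact subset_rfl
  | succ n ih =>
    refine (ih (transposeD c Φ)).trans (subset_trans (closure_mono ?_)
      (tsupport_deriv_subset (f := Φ) (𝕜 := ℝ)))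
    intro x hx h0
    exact hx (show -((x - c) * deriv Φ x) = 0 by simp [h0])

lemma IsTest.integrable_mul_const {S : Set ℝ} {φ : ℝ → ℝ} (hφ : IsTest S φ) (γ : ℂ) :
    Integrable fun x => (φ x : ℂ) * γ :=
  hφ.integrable.ofReal.mul_const γ

/-- Dual form of `(x γ)' = γ`: this lets constants pass through the Euler operator, both when `γ` is
subtracted and when it is restored. -/
lemma integral_eulerT {S : Set ℝ} {φ : ℝ → ℝ} (hφ : IsTest S φ) : ∫ x, eulerT φ x = ∫ x, φ x := by
  have hi : Integrable fun x => x * φ x :=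
    (continuous_id.mul hφ.continuous).integrable_of_hasCompactSupport hφ.2.mul_left
  have hd : ∀ x, HasDerivAt (fun x => x * φ x) (φ x - eulerT φ x) x := fun x => by
    convert! (hasDerivAt_id x).mul (hφ.1.differentiable (by simp) x).hasDerivAt using 1
    simp [eulerT]
  have h0 := integral_eq_zero_of_hasDerivAt_of_integrable hd
    (hφ.integrable.sub hφ.eulerT.integrable) hi
  rw [integral_sub hφ.integrable hφ.eulerT.integrable] at h0
  linarith

lemma integral_iterate_eulerT {S : Set ℝ} (n : ℕ) {φ : ℝ → ℝ} (hφ : IsTest S φ) :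
    ∫ x, eulerT^[n] φ x = ∫ x, φ x := by
  induction n generalizing φ with
  | zero => rfl
  | succ n ih => rw [Function.iterate_succ_apply, ih hφ.eulerT, integral_eulerT hφ]

lemma integral_dil (φ : ℝ → ℝ) {c : ℝ} (hc : c ≠ 0) : ∫ x, dil φ c x = ∫ x, φ x := by
  have := integral_dil_mul φ (fun _ => 1) hc
  simp only [mul_one, integral_complex_ofReal] at this
  exact_mod_cast this

/-- The distribution `f` translated by `c`, minus the constant `γ`. -/
def shiftedPairing (f : 𝓓'(Ω, ℂ)) (c : ℝ) (γ : ℂ) (φ : ℝ → ℝ) : ℂ :=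
  f (testOf Ω fun x => φ (x - c)) - γ * ((∫ x, φ x : ℝ) : ℂ)

lemma eventually_shiftedPairing_dil (f : 𝓓'(Ω, ℂ)) {c : ℝ} (hc : c ∈ Ω) (γ : ℂ)
    (Φ : 𝓓((⊤ : Opens ℝ), ℝ)) :
    ∀ᶠ ε : ℝ in 𝓝[>] 0,
      shiftedPairing f c γ (dil Φ ε) = dilationPairing f c ε Φ - γ * ((∫ x, Φ x : ℝ) : ℂ) := by
  obtain ⟨r, hr, hrΩ⟩ := Metric.isOpen_iff.1 Ω.isOpen c hc
  obtain ⟨b, hb, hΦ⟩ := (isTest_coe Φ).subset_Icc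
  filter_upwards [Ioo_mem_nhdsGT (show (0 : ℝ) < r / b by positivity)] with ε hε
  have hεb : ε * b < r := (lt_div_iff₀ hb).1 hε.2
  have ht : IsTest Ω fun x => Φ ((x - c) / ε) := by
    refine isTest_comp_sub (S := Icc (-(ε * b)) (ε * b)) (φ := fun x => Φ (x / ε))
      (isTest_comp_div hε.1.ne' hΦ fun x hx => ?_) fun x hx => hrΩ ?_
    · constructor <;> nlinarith [hx.1, hx.2, hε.1]
    · rw [Metric.mem_ball, Real.dist_eq, add_sub_cancel_right]
      exact (abs_le.2 hx).trans_lt hεb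
  -- For such small `ε` the rescaled support lies in `Ω`, so neither `rescale` nor `testOf` takes
  -- its default value `0`.
  have hres : rescale Ω c ε Φ = testOf Ω fun x => Φ ((x - c) / ε) := by
    refine DFunLike.coe_injective ?_
    rw [coe_testOf ht, rescale, dif_pos ⟨ht.2, ht.3⟩]
    rfl
  have hdil : (testOf Ω fun x => dil Φ ε (x - c)) = ε⁻¹ • testOf Ω fun x => Φ ((x - c) / ε) := by
    refine DFunLike.coe_injective ?_
    rw [coe_testOf]
    · ext x
      change |ε|⁻¹ * Φ ((x - c) / ε) = ε⁻¹ * (testOf Ω fun x => Φ ((x - c) / ε)) x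
      rw [coe_testOf ht, abs_of_pos hε.1]
    · exact ht.const_mul |ε|⁻¹
  rw [shiftedPairing, dilationPairing, hdil, hres, map_smul, integral_dil _ hε.1.ne']

/-- Reduction to the normalized problem. Since `γ` is its own Euler derivative of every order,
subtracting it from `F`, `f` and `h` preserves the representation and costs `‖γ‖` in the bound. -/
lemma boundaryData_shift {R : ℝ} {F : ℂ → ℂ} {f : 𝓓'(Ω, ℂ)} {c : ℝ} {γ : ℂ} (hρ : 0 < ρ)
    (hρR : ρ ≤ R) (hΩ : Ioo (c - ρ) (c + ρ) ⊆ (Ω : Set ℝ))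
    (hF : DifferentiableOn ℂ F ((Ω : Set ℝ) ×ℂ Ioo 0 R)) (hf : IsBoundaryValue F f)
    (hright : HasRightLimit f c γ) {fn : 𝓓'(Ω, ℂ)} {h : ℝ → ℂ} {C : ℝ}
    (hD : EqIterD n c (Ioo (c - ρ) (c + ρ)) f fn)
    (hcont : ContinuousOn h (Ioo (c - ρ) (c + ρ) \ {c}))
    (hbd : ∀ x ∈ Ioo (c - ρ) (c + ρ) \ {c}, ‖h x‖ ≤ C)
    (hfn : EqFunOn (Ioo (c - ρ) (c + ρ) \ {c}) fn h) :
    BoundaryData ρ (fun z => F (z + c) - γ) (shiftedPairing f c γ) n (fun x => h (x + c) - γ)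
      (C + ‖γ‖) := by
  have hmem : ∀ x ∈ Ioo (-ρ) ρ, x + c ∈ Ioo (c - ρ) (c + ρ) := fun x hx =>
    ⟨by linarith [hx.1], by linarith [hx.2]⟩
  have hmem' : ∀ x ∈ Ioo (-ρ) ρ \ {0}, x + c ∈ Ioo (c - ρ) (c + ρ) \ {c} := fun x hx =>
    ⟨hmem x hx.1, by simpa using hx.2⟩
  have hrect : ∀ z ∈ Ioo (-ρ) ρ ×ℂ Ioo 0 ρ, z + c ∈ (Ω : Set ℝ) ×ℂ Ioo 0 R := fun z hz => by
    rw [Complex.mem_reProdIm] at hz ⊢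
    simpa using ⟨hΩ (hmem _ hz.1), hz.2.1, hz.2.2.trans_le hρR⟩
  have hdiff : DifferentiableOn ℂ (fun z => F (z + c)) (Ioo (-ρ) ρ ×ℂ Ioo 0 ρ) :=
    hF.comp (by fun_prop) hrect
  refine ⟨hρ, hdiff.sub_const γ, fun φ hφ => ?_, ?_, fun x hx => ?_, fun φ hφ => ?_, fun φ hφ => ?_⟩
  · have ht := isTest_comp_sub hφ fun x hx => hΩ (hmem x hx)
    have h1 := hf (testOf Ω fun x => φ (x - c))
    refine (h1.sub_const (γ * ((∫ x, φ x : ℝ) : ℂ))).congr' ?_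
    filter_upwards [Ioo_mem_nhdsGT hρ] with y hy
    have hi : Integrable fun v : ℝ => (φ v : ℂ) * F (y * Complex.I + v + c) :=
      integrable_lineInt_integrand (Q := fun z => F (z + c)) (isOpen_rect ρ) hdiff.continuousOn
        hφ.continuous hφ.2 fun v hv => mem_rect_of_line (hφ.3 hv) hy
    simp only [lineInt, mul_sub]
    rw [integral_sub hi (hφ.integrable_mul_const γ), integral_mul_const,
      integral_complex_ofReal, mul_comm γ, coe_testOf ht,
      ← integral_add_right_eq_self (fun x => φ (x - c) • F ⟨x, y⟩) c]
    congr 1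
    refine integral_congr_ae (ae_of_all _ fun v => ?_)
    simp only [add_sub_cancel_right, Complex.real_smul]
    congr 2
    apply Complex.ext <;> simp
  · exact (hcont.comp (by fun_prop) hmem').sub continuousOn_const
  · exact (norm_sub_le _ _).trans (by gcongr; exact hbd _ (hmem' x hx))
  · have ht := isTest_comp_sub hφ hmem'
    have htΩ : IsTest Ω fun x => φ (x - c) := ht.mono (sdiff_subset.trans hΩ)
    have hφn := IsTest.iterate (fun _ hf => hf.eulerT) n hφ
    have hcoe := coe_testOf htΩ
    have hsupp : tsupport (testOf Ω fun x => φ (x - c)) ⊆ Ioo (c - ρ) (c + ρ) \ {c} := by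
      rw [hcoe]
      exact ht.3
    have hi : Integrable fun x => ((eulerT^[n] φ x : ℝ) : ℂ) * h (x + c) := by
      have := continuous_mul_of_tsupport_subset (φ := fun x => ((eulerT^[n] φ x : ℝ) : ℂ))
        (g := fun x => h (x + c)) (isOpen_punctured ρ)
        (Complex.continuous_ofReal.comp hφn.continuous) (hcont.comp (by fun_prop) hmem')
        (by rw [tsupport_ofReal_comp]; exact hφn.3)
      exact this.integrable_of_hasCompactSupport
        ((hφn.2.comp_left (g := fun x : ℝ => (x : ℂ)) rfl).mul_right)
    rw [shiftedPairing, hD _ (hsupp.trans sdiff_subset),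
      hfn _ ((tsupport_transposeD_iterate_subset c n _).trans hsupp)]
    simp only [mul_sub]
    rw [integral_sub hi (hφn.integrable_mul_const γ), integral_mul_const,
      integral_complex_ofReal, integral_iterate_eulerT n hφ, mul_comm γ]
    congr 1
    rw [← integral_add_right_eq_self _ c]
    refine integral_congr_ae (ae_of_all _ fun v => ?_)
    simp only [coe_transposeD_iterate n (fun x => congr_fun hcoe x), add_sub_cancel_right,
      Complex.real_smul]
  · have hφt := coe_testOf (hφ.mono (S' := ((⊤ : Opens ℝ) : Set ℝ)) fun _ _ => trivial)
    have h1 := hright (testOf ⊤ φ) (by rw [hφt]; exact hφ.3)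
    have h2 := eventually_shiftedPairing_dil f 
      (hΩ (show c ∈ Ioo (c - ρ) (c + ρ) from ⟨by linarith, by linarith⟩)) γ (testOf ⊤ φ)
    have h3 := h1.sub_const (γ * ((∫ x, testOf ⊤ φ x : ℝ) : ℂ))
    rw [sub_self] at h3
    refine h3.congr' ?_
    filter_upwards [h2] with ε hε
    rw [← hε, hφt]

/-- A boundary value with a right lateral limit at a point where it is distributionally bounded
has a point value there, and the analytic function has the same angular limit. -/
theorem HasRightLimit.pointValue_and_angularLimit (a b R : ℝ) (hR : 0 < R) (F : ℂ → ℂ)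
    (hF : AnalyticOnNhd ℂ F (Ioo a b ×ℂ Ioo 0 R))
    (f : 𝓓'(openInterval a b, ℂ))
    (hf : IsBoundaryValue F f)
    (x₀ : ℝ) (hx₀ : x₀ ∈ Ioo a b) (γ : ℂ)
    (hright : HasRightLimit f x₀ γ)
    (hbdd : DistributionallyBoundedAt f x₀) :
    HasPointValue f x₀ γ ∧
      HasDilationLimit univ f x₀ γ ∧
      HasAngularLimit F x₀ γ := by
  obtain ⟨n, fn, δ, h, hδ, hδΩ, hD, hcont, ⟨C, hC⟩, hfn⟩ := hbdd
  obtain ⟨ρ, hρ, hρδ, hρR⟩ : ∃ ρ > 0, ρ ≤ δ ∧ ρ ≤ R :=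
    ⟨min δ R, lt_min hδ hR, min_le_left _ _, min_le_right _ _⟩
  have hsub : Ioo (x₀ - ρ) (x₀ + ρ) ⊆ Ioo (x₀ - δ) (x₀ + δ) :=
    Ioo_subset_Ioo (by linarith) (by linarith)
  have hsub' : Ioo (x₀ - ρ) (x₀ + ρ) \ {x₀} ⊆ Ioo (x₀ - δ) (x₀ + δ) \ {x₀} :=
    sdiff_subset_sdiff_left hsub
  have D := boundaryData_shift hρ hρR (hsub.trans hδΩ) hF.differentiableOn hf hright
    (fun φ hφ => hD φ (hφ.trans hsub)) (hcont.mono hsub') (fun x hx => hC x (hsub' hx))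
    (fun φ hφ => hfn φ (hφ.trans hsub'))
  obtain ⟨hang, hlim, k, hk, hk0, hrepr⟩ := D.conclusions
  -- The constant subtracted in the reduction is restored; since `k 0 = 0`, the representing
  -- function takes the value `γ` at `x₀`.
  refine ⟨⟨n + 1, ρ, fun x => k (x - x₀) + γ, hρ, hsub.trans hδΩ, by fun_prop, by simp [hk0],
    fun Φ hΦ => ?_⟩, fun Φ _ => ?_, fun M => ?_⟩
  · have hφ : IsTest (Ioo (-ρ) ρ) fun x => Φ (x - -x₀) :=
      isTest_comp_sub (S := Ioo (x₀ - ρ) (x₀ + ρ)) ⟨Φ.contDiff, Φ.hasCompactSupport, hΦ⟩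
        fun x hx => ⟨by linarith [hx.1], by linarith [hx.2]⟩
    have hφn := IsTest.iterate (fun _ hf => hf.eulerT) (n + 1) hφ
    have h1 := hrepr _ hφ
    have h2 : (fun x => Φ (x - x₀ - -x₀)) = Φ := by
      ext x
      congr 1
      ring
    rw [shiftedPairing, h2, testOf_coe, sub_eq_iff_eq_add] at h1
    have hi : Integrable fun x => ((eulerT^[n + 1] (fun x => Φ (x - -x₀)) x : ℝ) : ℂ) * k x :=
      ((Complex.continuous_ofReal.comp hφn.continuous).mul hk).integrable_of_hasCompactSupport
        ((hφn.2.comp_left (g := fun x : ℝ => (x : ℂ)) rfl).mul_right)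
    rw [h1, ← integral_iterate_eulerT (n + 1) hφ, ← integral_complex_ofReal, mul_comm γ,
      ← integral_mul_const, ← integral_add hi (hφn.integrable_mul_const γ),
      ← integral_sub_right_eq_self _ x₀]
    refine integral_congr_ae (ae_of_all _ fun v => ?_)
    have h3 := coe_transposeD_iterate (n + 1) (Φ := Φ) (φ := fun x => Φ (x - -x₀)) (c := x₀)
      (fun x => (congr_fun h2 x).symm) v
    simp only [h3, Complex.real_smul, mul_add]
  · have h1 := (hlim _ ((isTest_coe Φ).mono (subset_univ _))).add_const
      (γ * ((∫ x, Φ x : ℝ) : ℂ))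
    rw [zero_add] at h1
    refine h1.congr' ?_
    filter_upwards [eventually_shiftedPairing_dil f (show x₀ ∈ openInterval a b from hx₀) γ Φ]
      with ε hε
    rw [hε, sub_add_cancel]
  · have h1 : Tendsto (fun z : ℂ => z - x₀) (𝓝[{z : ℂ | 0 < z.im ∧ |z.re - x₀| ≤ M * z.im}] x₀)
        (𝓝[{z : ℂ | 0 < z.im ∧ |z.re| ≤ M * z.im}] 0) := by
      refine tendsto_nhdsWithin_iff.2 ⟨?_, ?_⟩
      · have : Tendsto (fun z : ℂ => z - x₀) (𝓝 x₀) (𝓝 ((x₀ : ℂ) - x₀)) :=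
          (continuous_sub_right (x₀ : ℂ)).tendsto _
        rw [sub_self] at this
        exact this.mono_left nhdsWithin_le_nhds
      · filter_upwards [self_mem_nhdsWithin] with z hz
        simpa using hz
    simpa using ((hang M).comp h1).add_const γ

end

end BoundaryValue

end

theorem theorem3p2 (a b R : ℝ) (hR : 0 < R) (F : ℂ → ℂ)
    (hF : AnalyticOnNhd ℂ F (Set.Ioo a b ×ℂ Set.Ioo 0 R))
    (f : 𝓓'(BoundaryValue.openInterval a b, ℂ))
    (hf : BoundaryValue.IsBoundaryValue F f)
    (x₀ : ℝ) (hx₀ : x₀ ∈ Set.Ioo a b) (γ : ℂ)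
    (hright : BoundaryValue.HasRightLimit f x₀ γ)
    (hbdd : BoundaryValue.DistributionallyBoundedAt f x₀) :
    BoundaryValue.HasPointValue f x₀ γ ∧
      BoundaryValue.HasDilationLimit Set.univ f x₀ γ ∧
      BoundaryValue.HasAngularLimit F x₀ γ :=
  BoundaryValue.HasRightLimit.pointValue_and_angularLimit a b R hR F hF f hf x₀ hx₀ γ hright hbdd
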